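/- **Setting.** Let $\Delta\subset\mathbb H^3$ be a truncated hyperideal tetrahedron with triangles of truncation $T_1,\dots,T_4$ and right-angled hexagonal faces $H_1,\dots,H_4$, where $T_k$ is opposite to $H_k$. Edges are intersections of two hexagonal faces; short edges are intersections of a triangle of truncation and a hexagonal face. * The $D$-block $D_\alpha$ is the union of $\Delta$ and its mirror image along $H_1,\dots,H_4$ with the six edges removed. Here $e_{jk}=H_j\cap H_k$, $l_{jk}$ and $\alpha_{jk}$ are the length of and the dihedral angle at $e_{jk}$, $s_{jk}$ is the length of $T_j\cap H_k$, and $\gamma_{jk}$ is a simple loop around $e_{jk}$. * The dual $D$-block $D_l$ is the union of $\Delta$ and its mirror image along $T_1,\dots,T_4$ with the doubles of the six edges removed. Here $e_{jk}$ is the edge joining $T_j$ and $T_k$, $l_{jk}$ and $\alpha_{jk}$ are the length of and the dihedral angle at $e_{jk}$, $s_{jk}$ is the length of $H_j\cap T_k$, and $\gamma_{jk}$ is the simple loop formed by $e_{jk}$ and its double (pushed into $D_l$). Let $D$ be $D_\alpha$ or $D_l$, let $\rho:\pi_1(D)\to\mathrm{PSL}(2;\mathbb C)$ be its holonomy representation,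 and let $\mathrm{Ad}_\rho:\pi_1(D)\to\mathrm{SL}(3;\mathbb C)$ be its adjoint representation, realised as the symmetric square so that $\mathrm{Ad}_\rho(\gamma)^T$ acts on binary quadratic forms, in the basis $X^2,XY,Y^2$, as $\mathrm{Sym}^2(\rho(\gamma)^T)$, where a linear form $pX+qY$ is identified with the column vector $(p,q)^T$. Let $\mathrm H_*(D;\mathrm{Ad}_\rho)$ be the homology of the complex $\mathbb C^3\otimes_{\mathrm{Ad}_\rho}\mathrm C_*(\widetilde D;\mathbb Z)$ for a finite CW structure on $D$ (made compact by removing open tubular neighbourhoods of the edges instead of the edges), where $\mathbf v\otimes(\gamma\cdot\mathbf c)=(\mathrm{Ad}_\rho(\gamma)^T\mathbf v)\otimes\mathbf c$. For a based complex with chain bases $\mathbf c_k$ and homology bases $\mathbf h_k$, the Reidemeister torsion is $\pm\prod_k[\mathbf b_k\sqcup\widetilde{\mathbf b}_{k-1}\sqcup\widetilde{\mathbf h}_k;\mathbf c_k]^{(-1)^{k+1}}\in\mathbb C^*/\{\pm1\}$, where $\mathbf b_k$ is a basis of $\partial(\mathrm C_{k+1})$, tildes denote lifts to chains, and $[\mathbf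 b;\mathbf c]$ is the determinant of the matrix expressing $\mathbf b$ in $\mathbf c$; for $D$ one takes $\mathbf c_k=\{\mathbf e_r\otimes c\}$, with $\mathbf e_r$ the standard basis of $\mathbb C^3$ and $c$ running over one lift of each $k$-cell. For $1\le j<k\le 4$ let $\mathbf I_{jk}\ne0$ be an invariant vector of $\mathrm{Ad}_\rho([\gamma_{jk}])^T$; it is unique up to scalar. **Proposition.** 1. $\mathrm H_k(D;\mathrm{Ad}_\rho)=0$ for $k\neq1$. 2. $\mathrm H_1(D;\mathrm{Ad}_\rho)\cong\mathbb C^6$, with a basis $\mathbf h_D=\{\mathbf I_{jk}\otimes[\gamma_{jk}]\}_{1\le j<k\le4}$. Suppose further that each $\mathbf I_{jk}=(x,y,z)^T$ is normalised by $y^2-4xz=1$; equivalently, the form $xX^2+yXY+zY^2$ is the product of two linear forms $aX+bY$, $cX+dY$, given by eigenvectors of $\rho([\gamma_{jk}])^T$, with $ad-bc=1$. Then 3. $$\mathrm{Tor}(D_\alpha,\mathbf h_D;\mathrm{Ad}_\rho)=\pm\frac{i\,\sinh l_{14}\,\sinh s_{24}\,\sinh s_{34}}{32\,\sin\alpha_{12}\,\sin\alpha_{13}\,\sin\alpha_{23}};$$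 4. $$\mathrm{Tor}(D_l,\mathbf h_D;\mathrm{Ad}_\rho)=\pm\frac{i\,\sin\alpha_{14}\,\sinh s_{24}\,\sinh s_{34}}{32\,\sinh l_{12}\,\sinh l_{13}\,\sinh l_{23}}.$$ -/

import Mathlib

open scoped Matrix

noncomputable section

/-! ## Torsion of a based chain complex over `ℂ` -/

namespace ReidemeisterTorsion

section Complex

variable {C : ℕ → Type} [∀ k, AddCommGroup (C k)] [∀ k, Module ℂ (C k)]

/-- The cycles in degree `k` of `⋯ → C 2 → C 1 → C 0 → 0`, where `d k : C (k + 1) → C k`. -/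
def cycles (d : ∀ k, C (k + 1) →ₗ[ℂ] C k) : ∀ k, Submodule ℂ (C k)
  | 0 => ⊤
  | k + 1 => LinearMap.ker (d k)

/-- The homology in degree `k`: cycles modulo boundaries. -/
abbrev Homology (d : ∀ k, C (k + 1) →ₗ[ℂ] C k) (k : ℕ) : Type :=
  cycles d k ⧸ (LinearMap.range (d k)).submoduleOf (cycles d k)

/-- The homology class of a cycle. -/
def homologyClass (d : ∀ k, C (k + 1) →ₗ[ℂ] C k) (k : ℕ) (z : C k) (hz : z ∈ cycles d k) :
    Homology d k :=
  Submodule.Quotient.mk ⟨z, hz⟩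

variable {ι η : ℕ → Type}

/-- The auxiliary choices in the definition of the torsion of a complex with homology bases `h`:
chains `bLift (k + 1)` in `C (k + 1)` whose boundaries form a basis of the image of
`d k : C (k + 1) → C k`, and cycles `hLift k` representing `h k`.  There is no boundary below
degree `0`, so `bLift 0` is the empty family.  The field `reindex` enumerates the new family of
vectors of `C k` by the index type of the given basis of `C k`; changing it only
changes the sign of a determinant. -/
structure Choice (d : ∀ k, C (k + 1) →ₗ[ℂ] C k) (ι : ℕ → Type)
    (h : ∀ k, η k → Homology d k) where
  rank : ℕ → ℕ
  rank_zero : rank 0 = 0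
  bLift : ∀ k, Fin (rank k) → C k
  b_linearIndependent : ∀ k, LinearIndependent ℂ fun i => d k (bLift (k + 1) i)
  b_span : ∀ k, Submodule.span ℂ (Set.range fun i => d k (bLift (k + 1) i)) =
    LinearMap.range (d k)
  hLift : ∀ k, η k → C k
  hLift_mem : ∀ k i, hLift k i ∈ cycles d k
  hLift_class : ∀ k i, homologyClass d k (hLift k i) (hLift_mem k i) = h k i
  reindex : ∀ k, ι k ≃ (Fin (rank (k + 1)) ⊕ Fin (rank k)) ⊕ η k

/-- The new family `b_k ⊔ b̃_{k-1} ⊔ h̃_k` of vectors of `C k`. -/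
def Choice.newBasis {d : ∀ k, C (k + 1) →ₗ[ℂ] C k} {h : ∀ k, η k → Homology d k}
    (T : Choice d ι h) (k : ℕ) (i : ι k) : C k :=
  Sum.elim (Sum.elim (fun j => d k (T.bLift (k + 1) j)) (T.bLift k)) (T.hLift k) (T.reindex k i)

/-- `∏ₖ [b_k ⊔ b̃_{k-1} ⊔ h̃_k ; c_k] ^ (-1)^(k+1)` over `0 ≤ k ≤ n`, where `[b; c]` is the
determinant of the matrix expressing the family `b` in the basis `c`. -/
def Choice.value [∀ k, Fintype (ι k)] [∀ k, DecidableEq (ι k)]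
    {d : ∀ k, C (k + 1) →ₗ[ℂ] C k} {h : ∀ k, η k → Homology d k}
    (T : Choice d ι h) (c : ∀ k, Module.Basis (ι k) ℂ (C k)) (n : ℕ) : ℂ :=
  ∏ k ∈ Finset.range (n + 1), (c k).det (T.newBasis k) ^ ((-1 : ℤ) ^ (k + 1))

/-- The torsion of a complex which vanishes above degree `n`, with bases `c` of the chain spaces and
`h` of the homology.  It is an element of `ℂˣ/{±1}`, represented here by the set of all
complex numbers that arise, with either sign, from any auxiliary choices.  That the torsion is
`± t` is therefore the equation `torsion d c h n = {t, -t}`. -/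
def torsion [∀ k, Fintype (ι k)] [∀ k, DecidableEq (ι k)]
    (d : ∀ k, C (k + 1) →ₗ[ℂ] C k) (c : ∀ k, Module.Basis (ι k) ℂ (C k))
    (h : ∀ k, η k → Homology d k) (n : ℕ) : Set ℂ :=
  {t | ∃ T : Choice d ι h, t = T.value c n ∨ t = -T.value c n}

end Complex

/-! ## Twisted chain complex of a finite CW complex -/

/-- Translation by `g` of a chain in a free `ℤ[π]`-module with basis `S`; the element `(γ, s)` is the
translate by `γ` of the basis element `s`. -/
def leftTranslate {π S : Type} [Group π] (g : π) (c : π × S →₀ ℤ) : π × S →₀ ℤ :=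
  c.mapDomain fun p => (g * p.1, p.2)

/-- The cellular chain complex of the universal cover of a finite CW complex with fundamental
group `π`.  One lift of every cell is fixed, so that the `k`-cells of the universal cover are the
pairs `(γ, s)`, standing for the translate by `γ : π` of the lift of the `k`-cell `s`.  The chain
`bd k s` is the boundary of the lift of `s`. -/
structure CoveredComplex (π : Type) [Group π] where
  dim : ℕ
  cell : ℕ → Type
  [fintype_cell : ∀ k, Fintype (cell k)]
  [decidableEq_cell : ∀ k, DecidableEq (cell k)]
  isEmpty_cell : ∀ k, dim < k → IsEmpty (cell k)
  bd : ∀ k, cell (k + 1) → (π × cell k →₀ ℤ)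
  bd_bd : ∀ k s, ((bd (k + 1) s).sum fun p n => n • leftTranslate p.1 (bd k p.2)) = 0

namespace CoveredComplex

attribute [instance] CoveredComplex.fintype_cell CoveredComplex.decidableEq_cell

variable {π : Type} [Group π] (K : CoveredComplex π) {N : ℕ}
  (ϱ : π →* Matrix.SpecialLinearGroup (Fin N) ℂ)

/-- The space `ℂ^N ⊗_ϱ C_k(K̃; ℤ)`, the quotient of the tensor product over `ℤ` by the relations
`v ⊗ (γ • c) = (ϱ(γ)ᵀ v) ⊗ c`.  As `C_k(K̃; ℤ)` is free over `ℤ[π]` on the chosen lifts, every element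
is uniquely of the form `∑ₛ vₛ ⊗ s`; it is recorded as the family `(vₛ)`. -/
abbrev Chain (N k : ℕ) : Type := K.cell k → Fin N → ℂ

/-- The map `v ↦ v ⊗ c` for a chain `c` of the universal cover:
`v ⊗ (γ • s) = (ϱ(γ)ᵀ v) ⊗ s` for cells `s`, extended additively in `c`. -/
def tensor {k : ℕ} (c : π × K.cell k →₀ ℤ) : (Fin N → ℂ) →ₗ[ℂ] K.Chain N k :=
  c.sum fun p n => n • (LinearMap.single ℂ (fun _ : K.cell k => Fin N → ℂ) p.2 ∘ₗ
    Matrix.mulVecLin (ϱ p.1).1ᵀ)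

/-- The twisted boundary operator `∂(v ⊗ s) = v ⊗ ∂s`. -/
def boundary (k : ℕ) : K.Chain N (k + 1) →ₗ[ℂ] K.Chain N k :=
  ∑ s : K.cell (k + 1), K.tensor ϱ (K.bd k s) ∘ₗ LinearMap.proj s

/-- The standard basis `e_r ⊗ s` of the space of twisted `k`-chains. -/
def stdBasis (N k : ℕ) : Module.Basis (Σ _ : K.cell k, Fin N) ℂ (K.Chain N k) :=
  Pi.basis fun _ => Pi.basisFun ℂ (Fin N)

theorem tensor_zero {k : ℕ} : K.tensor ϱ (0 : π × K.cell k →₀ ℤ) = 0 := by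
  simp [tensor]

theorem tensor_add {k : ℕ} (c c' : π × K.cell k →₀ ℤ) :
    K.tensor ϱ (c + c') = K.tensor ϱ c + K.tensor ϱ c' := by
  classical
  exact Finsupp.sum_add_index' (by simp) (by intros; rw [add_smul])

theorem tensor_smul {k : ℕ} (n : ℤ) (c : π × K.cell k →₀ ℤ) :
    K.tensor ϱ (n • c) = n • K.tensor ϱ c :=
  map_zsmul (⟨⟨K.tensor ϱ, K.tensor_zero ϱ⟩, K.tensor_add ϱ⟩ :
    (π × K.cell k →₀ ℤ) →+ ((Fin N → ℂ) →ₗ[ℂ] K.Chain N k)) n c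

theorem tensor_single {k : ℕ} (p : π × K.cell k) (n : ℤ) (v : Fin N → ℂ) :
    K.tensor ϱ (Finsupp.single p n) v = n • Pi.single p.2 ((ϱ p.1).1ᵀ *ᵥ v) := by
  rw [tensor, Finsupp.sum_single_index (by simp)]
  rfl

/-- The defining relation of the twisted tensor product. -/
theorem tensor_leftTranslate {k : ℕ} (g : π) (c : π × K.cell k →₀ ℤ) (v : Fin N → ℂ) :
    K.tensor ϱ (leftTranslate g c) v = K.tensor ϱ c ((ϱ g).1ᵀ *ᵥ v) := by
  induction c using Finsupp.induction_linear with
  | zero => simp [leftTranslate, tensor_zero]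
  | add c c' h h' =>
    rw [show leftTranslate g (c + c') = leftTranslate g c + leftTranslate g c' from Finsupp.mapDomain_add]
    simp [tensor_add, h, h']
  | single p n =>
    rw [show leftTranslate g (Finsupp.single p n) = Finsupp.single (g * p.1, p.2) n from
      Finsupp.mapDomain_single]
    simp [tensor_single, Matrix.mulVec_mulVec, Matrix.transpose_mul]

theorem boundary_tensor {k : ℕ} (c : π × K.cell (k + 1) →₀ ℤ) (v : Fin N → ℂ) :
    K.boundary ϱ k (K.tensor ϱ c v) =
      K.tensor ϱ (c.sum fun p n => n • leftTranslate p.1 (K.bd k p.2)) v := by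
  classical
  induction c using Finsupp.induction_linear with
  | zero => simp [tensor_zero]
  | add c c' h h' =>
    rw [Finsupp.sum_add_index' (by simp) (by intros; rw [add_smul]), tensor_add, tensor_add]
    simp [h, h']
  | single p n =>
    rw [tensor_single, Finsupp.sum_single_index (by simp), tensor_smul, map_zsmul,
      LinearMap.smul_apply, tensor_leftTranslate]
    congr 1
    simp only [boundary, LinearMap.sum_apply, LinearMap.comp_apply, LinearMap.proj_apply]
    rw [Finset.sum_eq_single p.2]
    · simp
    · intro b _ hb
      simp [Pi.single_eq_of_ne hb]
    · simp

theorem boundary_boundary (k : ℕ) (x : K.Chain N (k + 2)) :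
    K.boundary ϱ k (K.boundary ϱ (k + 1) x) = 0 := by
  conv_lhs => rw [boundary.eq_1 K ϱ (k + 1)]
  simp [boundary_tensor, K.bd_bd, tensor_zero]

end CoveredComplex

/-! ## The adjoint representation -/

/-- The action of `A` on binary quadratic forms induced by its action on linear forms, where the vector
`(p, q)` stands for `p X + q Y`; matrix in the basis `X², XY, Y²`. -/
def symSq (A : Matrix (Fin 2) (Fin 2) ℂ) : Matrix (Fin 3) (Fin 3) ℂ :=
  !![A 0 0 ^ 2, A 0 0 * A 0 1, A 0 1 ^ 2;
     2 * A 0 0 * A 1 0, A 0 0 * A 1 1 + A 0 1 * A 1 0, 2 * A 0 1 * A 1 1;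
     A 1 0 ^ 2, A 1 0 * A 1 1, A 1 1 ^ 2]

theorem symSq_mul (A B : Matrix (Fin 2) (Fin 2) ℂ) : symSq (A * B) = symSq A * symSq B := by
  ext i j
  fin_cases i <;> fin_cases j <;>
    simp [symSq, Matrix.mul_apply, Fin.sum_univ_two, Fin.sum_univ_three] <;> ring

theorem symSq_det (A : Matrix (Fin 2) (Fin 2) ℂ) : (symSq A).det = A.det ^ 3 := by
  rw [Matrix.det_fin_three, Matrix.det_fin_two]
  simp [symSq]
  ring

/-- The adjoint representation of `SL(2, ℂ)`, realised as the symmetric square in such a way that the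
transpose of `Ad A` acts on quadratic forms, in the basis `X², XY, Y²`, as the symmetric square
of the transpose of `A`.  It takes the same value at `A` and `-A`. -/
def Ad : Matrix.SpecialLinearGroup (Fin 2) ℂ →* Matrix.SpecialLinearGroup (Fin 3) ℂ where
  toFun A := ⟨(symSq A.1ᵀ)ᵀ, by rw [Matrix.det_transpose, symSq_det, Matrix.det_transpose, A.2,
    one_pow]⟩
  map_one' := by
    apply Subtype.ext
    ext i j
    fin_cases i <;> fin_cases j <;> simp [symSq]
  map_mul' A B := by
    apply Subtype.ext
    change (symSq (A.1 * B.1)ᵀ)ᵀ = (symSq A.1ᵀ)ᵀ * (symSq B.1ᵀ)ᵀ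
    rw [Matrix.transpose_mul, symSq_mul, Matrix.transpose_mul]

end ReidemeisterTorsion

/-! ## The cell structure of the blocks -/

namespace DBlock

open ReidemeisterTorsion

/-- The `k`-dimensional faces of a truncated tetrahedron from which open tubular neighbourhoods of
the six edges have been removed.

This ball has 14 facets, one for each nonempty proper subset of the index set `Fin 4`:
* `{j}` is the facet `G_j` along which the two copies of the ball are glued in the double;
* `{j, k}` is the facet on the boundary of the tubular neighbourhood of the edge `e_jk`;
* the complement of `{k}` is the remaining facet `G'_k` of the truncated tetrahedron, opposite `G_k`.

For the block `D_α` one has `G_j = H_j` and `G'_k = T_k`, and `e_jk` is the edge `H_j ∩ H_k`.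
For the dual block `D_l` one has `G_j = T_j` and `G'_k = H_k`, and `e_jk` joins `T_j` and `T_k`.

Two facets meet if and only if one of the subsets contains the other, and the faces of codimension
`c` are the nonempty intersections of `c` facets, that is, the flags `S₁ ⊂ ⋯ ⊂ S_c`.
A flag is recorded by its level function, which takes the value `i` on `S_{i+1} \ S_i` (with
`S₀ = ∅` and `S_{c+1} = Fin 4`); its values are exactly `0, …, c`, and `k = 3 - c`. -/
abbrev Face (k : ℕ) : Type :=
  {f : Fin 4 → Fin 4 // ∀ i : Fin 4, (∃ a, f a = i) ↔ i.val + k < 4}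

/-- The effect on levels of leaving out the set `S_{i+1}` of a flag: the levels `i` and `i + 1` are
merged. -/
def merge (i x : Fin 4) : Fin 4 := if x ≤ i then x else x - 1

def inversions (f : Fin 4 → Fin 4) : ℕ :=
  (Finset.univ.filter fun p : Fin 4 × Fin 4 => p.1 < p.2 ∧ f p.2 < f p.1).card

/-- The incidence number of a face `f` and a face `g` of dimension one less.  It is nonzero exactly
if the flag of `f` arises from that of `g` by leaving out one set `S_{i+1}`.  The inversions fix an
orientation of every cell; in particular the incidence numbers of an edge with its two end points are
opposite. -/
def incidence (f g : Fin 4 → Fin 4) : ℤ :=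
  ∑ i : Fin 4, if ∀ a, f a = merge i (g a) then
    (-1) ^ ((i : ℕ) + inversions f + inversions g) else 0

theorem merge_isFace_iff {k : ℕ} (hk : k < 2) (υ : Face k) (j : Fin 4) :
    (∀ i : Fin 4, (∃ a, merge j (υ.1 a) = i) ↔ i.val + (k + 1) < 4) ↔ j.val + k < 3 := by
  have h : ∀ i, (∃ a, merge j (υ.1 a) = i) ↔ ∃ x : Fin 4, x.val + k < 4 ∧ merge j x = i := by
    intro i
    constructor
    · rintro ⟨a, ha⟩; exact ⟨_, (υ.2 _).1 ⟨a, rfl⟩, ha⟩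
    · rintro ⟨x, hx, hxi⟩
      obtain ⟨a, rfl⟩ := (υ.2 x).2 hx
      exact ⟨a, hxi⟩
  simp only [h]
  clear h υ
  interval_cases k <;> revert j <;> decide

theorem incidence_sq {k : ℕ} (σ : Face (k + 2)) (υ : Face k) :
    ∑ τ : Face (k + 1), incidence σ.1 τ.1 * incidence τ.1 υ.1 = 0 := by
  have hk : k < 2 := by
    have := (σ.2 (σ.1 0)).1 ⟨0, rfl⟩
    omega
  have key : ∀ τ : Face (k + 1), incidence σ.1 τ.1 * incidence τ.1 υ.1 =
      ∑ j : Fin 4, if ∀ a, τ.1 a = merge j (υ.1 a) then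
        ∑ i : Fin 4, (if ∀ a, σ.1 a = merge i (merge j (υ.1 a)) then
          (-1) ^ ((i : ℕ) + j + inversions σ.1 + inversions υ.1) else 0) else (0 : ℤ) := by
    intro τ
    conv_lhs => rw [incidence, incidence, Finset.mul_sum]
    refine Finset.sum_congr rfl fun j _ => ?_
    split_ifs with h
    · rw [Finset.sum_mul]
      refine Finset.sum_congr rfl fun i _ => ?_
      simp only [h]
      split_ifs
      · rw [← pow_add, show (i : ℕ) + inversions σ.1 + inversions τ.1 +
          ((j : ℕ) + inversions τ.1 + inversions υ.1) =
          ((i : ℕ) + j + inversions σ.1 + inversions υ.1) + 2 * inversions τ.1 by ring, pow_add,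
          pow_mul]
        simp
      · simp
    · simp
  simp only [key]
  rw [Finset.sum_comm]
  have step : ∀ j : Fin 4, (∑ τ : Face (k + 1), if ∀ a, τ.1 a = merge j (υ.1 a) then
        ∑ i : Fin 4, (if ∀ a, σ.1 a = merge i (merge j (υ.1 a)) then
          (-1) ^ ((i : ℕ) + j + inversions σ.1 + inversions υ.1) else 0) else (0 : ℤ)) =
      if j.val + k < 3 then ∑ i : Fin 4, (if ∀ a, σ.1 a = merge i (merge j (υ.1 a)) then
          (-1) ^ ((i : ℕ) + j + inversions σ.1 + inversions υ.1) else 0) else (0 : ℤ) := by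
    intro j
    split_ifs with hj
    · have hf := (merge_isFace_iff hk υ j).2 hj
      rw [Finset.sum_eq_single (⟨fun a => merge j (υ.1 a), hf⟩ : Face (k + 1))]
      · simp
      · intro τ _ hτ
        rw [if_neg]
        intro h
        exact hτ (Subtype.ext (funext h))
      · simp
    · refine Finset.sum_eq_zero fun τ _ => ?_
      rw [if_neg]
      intro h
      exact hj ((merge_isFace_iff hk υ j).1 (by simpa only [← h] using τ.2))
  simp only [step]
  have bound : ∀ i j : Fin 4, j.val + k < 3 → (∀ a, σ.1 a = merge i (merge j (υ.1 a))) →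
      i.val + k < 2 := by
    intro i j hj h
    have hf := (merge_isFace_iff hk υ j).2 hj
    have h2 : ∀ x : Fin 4, x.val + (k + 1) < 4 → (merge i x).val + (k + 2) < 4 := by
      intro x hx
      obtain ⟨a, rfl⟩ := (hf x).2 hx
      rw [← h]
      exact (σ.2 _).1 ⟨a, rfl⟩
    clear h hf
    interval_cases k <;> revert i j <;> decide
  have fact : ∀ i j x : Fin 4, i < j → merge i (merge j x) = merge (j - 1) (merge i x) := by
    decide
  have q01 : (∀ a, σ.1 a = merge 0 (merge 1 (υ.1 a))) ↔ ∀ a, σ.1 a = merge 0 (merge 0 (υ.1 a)) :=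
    forall_congr' fun a => by rw [fact 0 1 _ (by decide)]; rfl
  have q02 : (∀ a, σ.1 a = merge 0 (merge 2 (υ.1 a))) ↔ ∀ a, σ.1 a = merge 1 (merge 0 (υ.1 a)) :=
    forall_congr' fun a => by rw [fact 0 2 _ (by decide)]; rfl
  have q12 : (∀ a, σ.1 a = merge 1 (merge 2 (υ.1 a))) ↔ ∀ a, σ.1 a = merge 1 (merge 1 (υ.1 a)) :=
    forall_congr' fun a => by rw [fact 1 2 _ (by decide)]; rfl
  have neg : ∀ i j : Fin 4, j.val + k < 3 → ¬ i.val + k < 2 →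
      ¬ ∀ a, σ.1 a = merge i (merge j (υ.1 a)) := fun i j hj hi h => hi (bound i j hj h)
  interval_cases k
  · simp only [Fin.sum_univ_four, q01, q02, q12, if_neg (neg 2 0 (by decide) (by decide)),
      if_neg (neg 3 0 (by decide) (by decide)), if_neg (neg 2 1 (by decide) (by decide)),
      if_neg (neg 3 1 (by decide) (by decide)), if_neg (neg 2 2 (by decide) (by decide)),
      if_neg (neg 3 2 (by decide) (by decide))]
    clear key step bound neg q01 q02 q12 fact
    norm_num [pow_add]
    try (split_ifs <;> ring)
  · simp only [Fin.sum_univ_four, q01, if_neg (neg 1 0 (by decide) (by decide)),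
      if_neg (neg 2 0 (by decide) (by decide)), if_neg (neg 3 0 (by decide) (by decide)),
      if_neg (neg 1 1 (by decide) (by decide)), if_neg (neg 2 1 (by decide) (by decide)),
      if_neg (neg 3 1 (by decide) (by decide))]
    clear key step bound neg q01 fact
    norm_num [pow_add]
    try (split_ifs <;> ring)
/-- The face with level function `f` lies in the facet `G_j`. -/
def InGlued (j : Fin 4) (f : Fin 4 → Fin 4) : Prop := ∀ a, f a = 0 ↔ a = j

instance (j : Fin 4) (f : Fin 4 → Fin 4) : Decidable (InGlued j f) :=
  inferInstanceAs (Decidable (∀ _, _))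

/-- The `k`-cells of the block.  The block consists of two copies of the ball, the copy `true`
and its mirror image `false`, glued by the identity along `G_0, …, G_3`.  The cells in a glued
facet are listed in the copy `true` only. -/
abbrev BlockCell (k : ℕ) : Type :=
  {c : Bool × Face k // (∃ j, InGlued j c.2.1) → c.1 = true}

/-- The fundamental group of the block, based in the copy `true`, is free on three generators: the
`j`-th generator is the loop that passes through `G_j` into the mirror image and returns
through `G_3`.  The element `crossing j` is this loop, for all `j`; it is trivial for `j = 3`.  Hence
the loop that leaves through `G_j` and returns through `G_k` is
`crossing j * (crossing k)⁻¹`. -/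
def crossing (j : Fin 4) : FreeGroup (Fin 3) :=
  if h : j.val < 3 then FreeGroup.of ⟨j.val, h⟩ else 1

/-- The universal cover of the block consists of balls `(γ, ε)`, one for each `γ` in the fundamental group
and each copy `ε`.  Crossing `G_j` leads from the ball `(γ, true)` to the ball
`(γ * crossing j, false)`, that is, these two are glued along `G_j`.

The cells of the balls `(1, true)` and `(1, false)` that are not in a glued facet, and the
glued cells of `(1, true)`, are chosen as the lifts of the cells of the block; `place ε f` is
the cell of the universal cover given by the face `f` of the ball `(1, ε)`. -/
def place {k : ℕ} (ε : Bool) (f : Face k) : FreeGroup (Fin 3) × BlockCell k :=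
  if h : ∃ j, InGlued j f.1 then
    (if ε then 1 else (crossing h.choose)⁻¹, ⟨(true, f), fun _ => rfl⟩)
  else (1, ⟨(ε, f), fun h' => absurd h' h⟩)

/-- The boundary of the lift of a cell. -/
def blockBd (k : ℕ) (c : BlockCell (k + 1)) : FreeGroup (Fin 3) × BlockCell k →₀ ℤ :=
  ∑ g : Face k, Finsupp.single (place c.1.1 g) (incidence c.1.2.1 g.1)

theorem inGlued_of_incidence {k : ℕ} (f : Face (k + 1)) (g : Face k) {j : Fin 4}
    (hj : InGlued j f.1) (h : incidence f.1 g.1 ≠ 0) : InGlued j g.1 := by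
  obtain ⟨i, -, hi⟩ := Finset.exists_ne_zero_of_sum_ne_zero h
  have hfg : ∀ a, f.1 a = merge i (g.1 a) := by
    by_contra hcon
    exact hi (if_neg hcon)
  have hk : k < 2 := by
    obtain ⟨b, hb⟩ : ∃ b, b ≠ j := ⟨j + 1, (by decide : ∀ j : Fin 4, j + 1 ≠ j) j⟩
    have h0 : f.1 b ≠ 0 := fun h0 => hb ((hj b).1 h0)
    have := (f.2 (f.1 b)).1 ⟨b, rfl⟩
    have h1 : (f.1 b).val ≠ 0 := fun h1 => h0 (Fin.ext h1)
    omega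
  have hi0 : i ≠ 0 := by
    rintro rfl
    obtain ⟨a, ha⟩ := (g.2 0).2 (by simp; omega)
    obtain ⟨b, hb⟩ := (g.2 1).2 (by simp; omega)
    have ha' := (hj a).1 (by rw [hfg, ha]; rfl)
    have hb' := (hj b).1 (by rw [hfg, hb]; rfl)
    rw [ha'] at ha
    rw [hb', ha] at hb
    exact absurd hb (by decide)
  intro a
  rw [← hj a, hfg]
  exact (by decide : ∀ i x : Fin 4, i ≠ 0 → (x = 0 ↔ merge i x = 0)) i (g.1 a) hi0

theorem inGlued_unique {k : ℕ} (f : Face k) {i j : Fin 4} (hi : InGlued i f.1)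
    (hj : InGlued j f.1) : i = j :=
  (hj i).1 ((hi i).2 rfl)

theorem place_of_inGlued {k : ℕ} (ε : Bool) (f : Face k) {j : Fin 4} (hj : InGlued j f.1) :
    place ε f = (if ε then 1 else (crossing j)⁻¹, ⟨(true, f), fun _ => rfl⟩) := by
  have h : ∃ j, InGlued j f.1 := ⟨j, hj⟩
  rw [place, dif_pos h, inGlued_unique f h.choose_spec hj]

/-- The boundary of any ball of the universal cover is computed in the same way. -/
theorem leftTranslate_blockBd_place {k : ℕ} (ε : Bool) (f : Face (k + 1)) :
    leftTranslate (place ε f).1 (blockBd k (place ε f).2) =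
      ∑ g : Face k, Finsupp.single (place ε g) (incidence f.1 g.1) := by
  have hsum : ∀ (γ : FreeGroup (Fin 3)) (c : BlockCell (k + 1)), leftTranslate γ (blockBd k c) =
      ∑ g : Face k, Finsupp.single (γ * (place c.1.1 g).1, (place c.1.1 g).2)
        (incidence c.1.2.1 g.1) := by
    intro γ c
    rw [leftTranslate, blockBd, Finsupp.mapDomain_finsetSum]
    simp only [Finsupp.mapDomain_single]
  rw [hsum]
  refine Finset.sum_congr rfl fun g _ => ?_
  by_cases h : ∃ j, InGlued j f.1
  · obtain ⟨j, hj⟩ := h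
    by_cases h0 : incidence f.1 g.1 = 0
    · simp [place_of_inGlued ε f hj, h0]
    · have hg := inGlued_of_incidence f g hj h0
      simp [place_of_inGlued _ f hj, place_of_inGlued _ g hg]
  · simp [place.eq_1 ε f, dif_neg h]

theorem blockBd_blockBd (k : ℕ) (c : BlockCell (k + 2)) :
    ((blockBd (k + 1) c).sum fun p n => n • leftTranslate p.1 (blockBd k p.2)) = 0 := by
  classical
  rw [blockBd, ← Finsupp.sum_finsetSum_index (by simp) (by intros; rw [add_smul])]
  have h1 : ∀ g : Face (k + 1), ((Finsupp.single (place c.1.1 g) (incidence c.1.2.1 g.1)).sum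
      fun p n => n • leftTranslate p.1 (blockBd k p.2)) =
      ∑ e : Face k, Finsupp.single (place c.1.1 e) (incidence c.1.2.1 g.1 * incidence g.1 e.1) := by
    intro g
    rw [Finsupp.sum_single_index (by simp), leftTranslate_blockBd_place, Finset.smul_sum]
    simp only [Finsupp.smul_single, smul_eq_mul]
  rw [Finset.sum_congr rfl fun g _ => h1 g, Finset.sum_comm]
  refine Finset.sum_eq_zero fun e _ => ?_
  rw [← Finsupp.single_finsetSum, incidence_sq, Finsupp.single_zero]

/-- The block, compactified by removing open tubular neighbourhoods of the edges instead of the edges,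
with its cell structure and universal cover. -/
def block : CoveredComplex (FreeGroup (Fin 3)) where
  dim := 3
  cell := BlockCell
  isEmpty_cell k hk := ⟨fun c => by
    have := (c.1.2.2 (c.1.2.1 0)).1 ⟨0, rfl⟩
    omega⟩
  bd := blockBd
  bd_bd := blockBd_blockBd

/-- The smallest index different from `j` and `k`. -/
def lo (j k : Fin 4) : Fin 4 :=
  if j ≠ 0 ∧ k ≠ 0 then 0 else if j ≠ 1 ∧ k ≠ 1 then 1 else 2

/-- The largest index different from `j` and `k`. -/
def hi (j k : Fin 4) : Fin 4 :=
  if j ≠ 3 ∧ k ≠ 3 then 3 else if j ≠ 2 ∧ k ≠ 2 then 2 else 1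

/-- The indices of the six edges. -/
abbrev EdgePair : Type := {p : Fin 4 × Fin 4 // p.1 < p.2}

/-- The element of the fundamental group represented by `γ_jk`: it leaves the copy `true` through
`G_j` and returns through `G_k`. -/
def loop (p : EdgePair) : FreeGroup (Fin 3) := crossing p.1.1 * (crossing p.1.2)⁻¹

/-- The edge of the ball, running from `G_j` to `G_k`, in which the facet around `e_jk` meets
`G'_m`, for `m` the smallest index different from `j` and `k`.  (In the other such edge
the facet meets `G'_n`, where `n` is the remaining index.) -/
def parallelEdge (p : EdgePair) : Face 1 :=
  ⟨fun a => if a = p.1.1 ∨ a = p.1.2 then 0 else if a = lo p.1.1 p.1.2 then 1 else 2,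
    by revert p; decide⟩

/-- The chain of a lift to the universal cover of the loop `γ_jk`.  The double of the facet around `e_jk`
is a cylinder, and `γ_jk` is realised as one of its boundary circles, which consists of
`parallelEdge` and its mirror image.  In `D_α` this is a simple loop around `e_jk`; in `D_l` it is
parallel to the curve formed by `e_jk` and its double.  The lift begins in `G_k`, runs through the
ball `(1, true)` to `G_j` and through the ball `(crossing j, false)` to the translate by `loop p`
of its initial point. -/
def loopLift (p : EdgePair) : FreeGroup (Fin 3) × BlockCell 1 →₀ ℤ :=
  Finsupp.single (place true (parallelEdge p)) 1 -
    leftTranslate (crossing p.1.1) (Finsupp.single (place false (parallelEdge p)) 1)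

/-- The index types of a homology basis concentrated in degree one. -/
abbrev BasisIndex : ℕ → Type
  | 1 => EdgePair
  | _ => Empty

/-- A family of classes in degree one, as a family of families over all degrees. -/
def inDegreeOne {H : ℕ → Type} (h : EdgePair → H 1) : ∀ k, BasisIndex k → H k
  | 0, e => e.elim
  | 1, p => h p
  | _ + 2, e => e.elim

section Twisted

variable (ρ : FreeGroup (Fin 3) →* Matrix.SpecialLinearGroup (Fin 2) ℂ)

/-- The complex `C_*(D; Ad_ρ)`. -/
def twistedBoundary (k : ℕ) : block.Chain 3 (k + 1) →ₗ[ℂ] block.Chain 3 k :=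
  block.boundary (Ad.comp ρ) k

/-- The twisted homology `H_k(D; Ad_ρ)`. -/
abbrev TwistedHomology (k : ℕ) : Type := Homology (twistedBoundary ρ) k

/-- `v` is an invariant vector of the transpose of `Ad_ρ(γ)`. -/
def IsInvariantVector (γ : FreeGroup (Fin 3)) (v : Fin 3 → ℂ) : Prop :=
  v ≠ 0 ∧ (Ad (ρ γ)).1ᵀ *ᵥ v = v

/-- The quadratic form `v 0 X² + v 1 XY + v 2 Y²` has discriminant one, in other words, it is a product
`(a X + b Y)(c X + d Y)` with `a d - b c = 1`.  This fixes an invariant vector up to sign: it is the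
product of two eigenvectors of the transpose of `ρ(γ)` that span a parallelogram of area one. -/
def IsNormalized (v : Fin 3 → ℂ) : Prop := v 1 ^ 2 - 4 * v 0 * v 2 = 1

/-- The classes `h p` are the classes `I_jk ⊗ [γ_jk]`. -/
def Represents (I : EdgePair → Fin 3 → ℂ) (h : EdgePair → TwistedHomology ρ 1) : Prop :=
  ∀ p, ∃ hz : block.tensor (Ad.comp ρ) (loopLift p) (I p) ∈ cycles (twistedBoundary ρ) 1,
    h p = homologyClass (twistedBoundary ρ) 1 _ hz

/-- The torsion `Tor(D, h; Ad_ρ)`, as a set of the form `{t, -t}`. -/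
def blockTorsion (h : EdgePair → TwistedHomology ρ 1) : Set ℂ :=
  torsion (twistedBoundary ρ) (block.stdBasis 3) (inDegreeOne h) block.dim

end Twisted

/-! ## Hyperbolic geometry -/

/-- The Lorentzian inner product on `ℝ^{3,1}`. -/
def mink (x y : Fin 4 → ℝ) : ℝ := -(x 0 * y 0) + x 1 * y 1 + x 2 * y 2 + x 3 * y 3

/-- Hyperbolic space, in the hyperboloid model. -/
def hyperbolicSpace : Set (Fin 4 → ℝ) := {x | mink x x = -1 ∧ 0 < x 0}

/-- The hyperbolic distance. -/
def hdist (x y : Fin 4 → ℝ) : ℝ := Real.arcosh (-mink x y)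

/-- The reflection of hyperbolic space in the plane with unit normal vector `n`. -/
def reflect (n x : Fin 4 → ℝ) : Fin 4 → ℝ := x - (2 * mink n x) • n

/-- The identification of `ℝ^{3,1}` with the Hermitian matrices, `mink x x = -det (hermitian x)`.
`A` in `SL(2, ℂ)` acts by `X ↦ A X Aᴴ`, which identifies `PSL(2, ℂ)` with the group of
orientation preserving isometries of hyperbolic space. -/
def hermitian (x : Fin 4 → ℝ) : Matrix (Fin 2) (Fin 2) ℂ :=
  !![(x 0 + x 3 : ℂ), x 1 + Complex.I * x 2; x 1 - Complex.I * x 2, x 0 - x 3]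

/-- A truncated hyperideal tetrahedron, given by the outward unit normal vectors `u j` of the planes of
its hexagonal faces `H_j` and `v k` of the planes of its triangles of truncation `T_k`.

The vector `v k` is the hyperideal vertex opposite `H_k`: it is spacelike, the `v k` span the
tetrahedron whose faces are orthogonal to the `u j`, each of its edges meets
hyperbolic space, and it is truncated by the polar planes of its vertices. -/
structure TruncatedHyperidealTetrahedron where
  u : Fin 4 → Fin 4 → ℝ
  v : Fin 4 → Fin 4 → ℝ
  u_unit : ∀ j, mink (u j) (u j) = 1
  v_unit : ∀ k, mink (v k) (v k) = 1
  orthogonal : ∀ j k, j ≠ k → mink (u j) (v k) = 0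
  outward : ∀ j, mink (u j) (v j) < 0
  edge_meets : ∀ j k, j ≠ k → ∃ s t : ℝ, 0 < s ∧ 0 < t ∧ s • v j + t • v k ∈ hyperbolicSpace

namespace TruncatedHyperidealTetrahedron

variable (Δ : TruncatedHyperidealTetrahedron)

/-- The polyhedron. -/
def carrier : Set (Fin 4 → ℝ) :=
  {x | x ∈ hyperbolicSpace ∧ ∀ i, mink (Δ.u i) x ≤ 0 ∧ mink (Δ.v i) x ≤ 0}

/-- The hexagonal face `H_j`. -/
def hexagon (j : Fin 4) : Set (Fin 4 → ℝ) := {x | x ∈ Δ.carrier ∧ mink (Δ.u j) x = 0}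

/-- The triangle of truncation `T_k`. -/
def triangle (k : Fin 4) : Set (Fin 4 → ℝ) := {x | x ∈ Δ.carrier ∧ mink (Δ.v k) x = 0}

/-- The vertex of the polyhedron in which `T_m` meets the edge joining `T_m` and `T_n`. -/
def vertex (m n : Fin 4) : Fin 4 → ℝ :=
  (Real.sqrt (mink (Δ.v m) (Δ.v n) ^ 2 - 1))⁻¹ •
    (Δ.v n - mink (Δ.v m) (Δ.v n) • Δ.v m)

/-- The length of the edge joining `T_m` and `T_n`, which is the intersection of the two hexagons with
indices different from `m` and `n`. -/
def edgeLength (m n : Fin 4) : ℝ := hdist (Δ.vertex m n) (Δ.vertex n m)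

/-- The dihedral angle at the edge `H_j ∩ H_k`. -/
def dihedralAngle (j k : Fin 4) : ℝ := Real.arccos (-mink (Δ.u j) (Δ.u k))

/-- The length of the short edge `T_k ∩ H_j`. -/
def shortLength (k j : Fin 4) : ℝ := hdist (Δ.vertex k (lo j k)) (Δ.vertex k (hi j k))

theorem mink_comm (x y : Fin 4 → ℝ) : mink x y = mink y x := by
  simp only [mink]; ring

theorem mink_vertices_lt {m n : Fin 4} (h : m ≠ n) : mink (Δ.v m) (Δ.v n) < -1 := by
  obtain ⟨s, t, hs, ht, hx, -⟩ := Δ.edge_meets m n h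
  have h1 := Δ.v_unit m
  have h2 := Δ.v_unit n
  have e : mink (s • Δ.v m + t • Δ.v n) (s • Δ.v m + t • Δ.v n) =
      s ^ 2 * mink (Δ.v m) (Δ.v m) + t ^ 2 * mink (Δ.v n) (Δ.v n) +
        2 * (s * t) * mink (Δ.v m) (Δ.v n) := by
    simp only [mink, Pi.add_apply, Pi.smul_apply, smul_eq_mul]; ring
  rw [e, h1, h2] at hx
  have hst := mul_pos hs ht
  by_contra hc
  nlinarith [sq_nonneg (s - t), mul_nonneg hst.le (by linarith : 0 ≤ mink (Δ.v m) (Δ.v n) + 1)]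

theorem time_pos {p q : Fin 4 → ℝ} (hp : p ∈ hyperbolicSpace) (hq : mink q q < 0)
    (hpq : mink p q < 0) : 0 < q 0 := by
  obtain ⟨hp1, hp0⟩ := hp
  by_contra hcon
  push Not at hcon
  simp only [mink] at *
  have hcs : (p 1 * q 1 + p 2 * q 2 + p 3 * q 3) ^ 2 ≤
      (p 1 ^ 2 + p 2 ^ 2 + p 3 ^ 2) * (q 1 ^ 2 + q 2 ^ 2 + q 3 ^ 2) := by
    nlinarith [sq_nonneg (p 1 * q 2 - p 2 * q 1), sq_nonneg (p 1 * q 3 - p 3 * q 1),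
      sq_nonneg (p 2 * q 3 - p 3 * q 2)]
  have hle : (p 1 ^ 2 + p 2 ^ 2 + p 3 ^ 2) * (q 1 ^ 2 + q 2 ^ 2 + q 3 ^ 2) ≤
      p 0 ^ 2 * q 0 ^ 2 := by
    apply mul_le_mul <;> nlinarith
  have hnn : 0 ≤ -(p 0 * q 0) := by nlinarith
  have habs : |p 1 * q 1 + p 2 * q 2 + p 3 * q 3| ≤ -(p 0 * q 0) := by
    apply abs_le_of_sq_le_sq _ hnn
    nlinarith
  linarith [neg_abs_le (p 1 * q 1 + p 2 * q 2 + p 3 * q 3)]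

/-- The vertex lies on the faces that it should lie on. -/
theorem vertex_mem {m n : Fin 4} (h : m ≠ n) :
    Δ.vertex m n ∈ Δ.triangle m ∧ ∀ j, j ≠ m → j ≠ n → Δ.vertex m n ∈ Δ.hexagon j := by
  set c := mink (Δ.v m) (Δ.v n) with hc
  have hc1 : c < -1 := Δ.mink_vertices_lt h
  set r := (Real.sqrt (c ^ 2 - 1))⁻¹ with hr
  have hpos : 0 < c ^ 2 - 1 := by nlinarith
  have hr0 : 0 < r := inv_pos.2 (Real.sqrt_pos.2 hpos)
  have hr2 : r ^ 2 * (c ^ 2 - 1) = 1 := by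
    rw [hr, inv_pow, Real.sq_sqrt hpos.le, inv_mul_cancel₀ hpos.ne']
  have lin : ∀ y, mink y (Δ.vertex m n) = r * (mink y (Δ.v n) - c * mink y (Δ.v m)) := by
    intro y
    have hv : Δ.vertex m n = r • (Δ.v n - c • Δ.v m) := rfl
    rw [hv]
    clear_value r c
    simp only [mink, Pi.smul_apply, Pi.sub_apply, smul_eq_mul]; ring
  have vm : mink (Δ.v m) (Δ.vertex m n) = 0 := by
    rw [lin, Δ.v_unit, ← hc]; ring
  have vn : mink (Δ.v n) (Δ.vertex m n) = r * (1 - c ^ 2) := by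
    rw [lin, Δ.v_unit, mink_comm _ (Δ.v m), ← hc]; ring
  have norm : mink (Δ.vertex m n) (Δ.vertex m n) = -1 := by
    rw [lin, mink_comm _ (Δ.v n), mink_comm _ (Δ.v m), vm, vn]; linarith
  have time : 0 < Δ.vertex m n 0 := by
    obtain ⟨s, t, hs, ht, hx⟩ := Δ.edge_meets m n h
    refine time_pos hx (by rw [norm]; norm_num) ?_
    have e : mink (s • Δ.v m + t • Δ.v n) (Δ.vertex m n) =
        s * mink (Δ.v m) (Δ.vertex m n) + t * mink (Δ.v n) (Δ.vertex m n) := by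
      simp only [mink, Pi.add_apply, Pi.smul_apply, smul_eq_mul]; ring
    rw [e, vm, vn]
    have := mul_pos ht (mul_pos hr0 hpos)
    linarith
  have um : ∀ i, mink (Δ.u i) (Δ.vertex m n) ≤ 0 := by
    intro i
    rw [lin]
    refine mul_nonpos_of_nonneg_of_nonpos hr0.le ?_
    have nonpos : ∀ k, mink (Δ.u i) (Δ.v k) ≤ 0 := by
      intro k
      by_cases hik : i = k
      · subst hik; exact (Δ.outward i).le
      · exact (Δ.orthogonal i k hik).le
    nlinarith [nonpos m, nonpos n]
  have vk : ∀ k, mink (Δ.v k) (Δ.vertex m n) ≤ 0 := by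
    intro k
    by_cases hkm : k = m
    · subst hkm; exact vm.le
    by_cases hkn : k = n
    · subst hkn; rw [vn]; nlinarith
    · rw [lin]
      refine mul_nonpos_of_nonneg_of_nonpos hr0.le ?_
      nlinarith [Δ.mink_vertices_lt hkm, Δ.mink_vertices_lt hkn]
  have mem : Δ.vertex m n ∈ Δ.carrier := ⟨⟨norm, time⟩, fun i => ⟨um i, vk i⟩⟩
  refine ⟨⟨mem, vm⟩, fun j hjm hjn => ⟨mem, ?_⟩⟩
  rw [lin, Δ.orthogonal j n hjn, Δ.orthogonal j m hjm]; ring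

/-! The quantities `l_jk`, `α_jk`, `s_jk` in the labelling for the block `D_α`: `e_jk` is the edge
`H_j ∩ H_k`, and `s_jk` is the length of `T_j ∩ H_k`. -/

def lα (j k : Fin 4) : ℝ := Δ.edgeLength (lo j k) (hi j k)

def αα (j k : Fin 4) : ℝ := Δ.dihedralAngle j k

def sα (j k : Fin 4) : ℝ := Δ.shortLength j k

/-! The quantities `l_jk`, `α_jk`, `s_jk` in the labelling for the dual block `D_l`: `e_jk` is the edge
joining `T_j` and `T_k`, and `s_jk` is the length of `H_j ∩ T_k`. -/

def ll (j k : Fin 4) : ℝ := Δ.edgeLength j k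

def αl (j k : Fin 4) : ℝ := Δ.dihedralAngle (lo j k) (hi j k)

def sl (j k : Fin 4) : ℝ := Δ.shortLength k j

end TruncatedHyperidealTetrahedron

/-- `ρ` lifts to `SL(2, ℂ)` the holonomy representation of the double of a polyhedron along faces with unit
normal vectors `n j`.  The developing map carries the ball `(γ, true)` of the universal cover to the
image of the polyhedron under the holonomy of `γ`.  The mirror image developed across the face `G_j` is
the image of the polyhedron under the reflection in that face, so the holonomy of `crossing j` is the
product of the reflections in `G_j` and `G_3`. -/
def IsHolonomyLift (n : Fin 4 → Fin 4 → ℝ)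
    (ρ : FreeGroup (Fin 3) →* Matrix.SpecialLinearGroup (Fin 2) ℂ) : Prop :=
  ∀ (j : Fin 4) (x : Fin 4 → ℝ),
    hermitian (reflect (n j) (reflect (n 3) x)) =
      (ρ (crossing j)).1 * hermitian x * (ρ (crossing j)).1ᴴ

end DBlock

end

/-! ### Chain complexes with adapted bases. -/

noncomputable section

namespace ReidemeisterTorsion

section Splitting

variable {C : ℕ → Type} [∀ k, AddCommGroup (C k)] [∀ k, Module ℂ (C k)]
variable {d : ∀ k, C (k + 1) →ₗ[ℂ] C k} {β η : ℕ → Type}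

/-! The block is two balls glued along four discs, hence a handlebody of genus three. A discrete
Morse matching on its cells (`cellEquiv`, `height_lt`) leaves one critical vertex and three critical
edges, which join `G_a` to `G_3` for `a < 3` in the mirror copy. Matched cells contribute only block
triangular matrices with diagonal blocks `±1`, so everything happens between a 9-dimensional space
of critical edges and a 3-dimensional space over the critical vertex. The difference 6 is the rank
of the first homology.

The critical edges are filled by the six cycles `I_jk ⊗ γ_jk` and by three auxiliary chains, which
carry the vectors of the edges 01, 02, 12. The boundaries of the auxiliary chains give the 3×3
determinant `baseProduct` in degree 0. In degree 1, cocycles dual to the critical edges make the 9×9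
matrix block triangular, with one 3×3 block for each of `G_0`, `G_1`, `G_2`; its determinant is
`facetProduct` up to sign. If both are nonzero, the family is a basis adapted to the complex, which
yields the homology and the torsion `± facetProduct / baseProduct` (`homology_and_torsion`). Since
torsion is only defined up to sign, it suffices to know its square.

In the Hermitian model, with `N_j` the matrix of the normal `n_j`, the holonomy of `γ_jk` is `± N_j
adj(N_k)`, and its invariant form is a multiple of `axis N_j N_k`. The triple product at a facet is
then `±4i det n`, up to the scalars, and the base product is a Gram determinant of the projections
of `n_0, n_1, n_2` orthogonal to `n_3`, hence a multiple of `(det n)²`. Normalising the forms gives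
torsion squared `= -(det n)² / (1024 ∏ (1 - ⟨n_j, n_k⟩²))` (`torsion_of_normals`).

This applies to `n = u` for `D_α` and to `n = v` for `D_l`. Gram determinants of mixed families of
`u`'s and `v`'s convert the two determinants into lengths and angles (`sinh_mul_sin_sq_eq_det_u_sq`,
`sin_mul_sinh_sq_eq_det_v_sq`). -/

theorem homologyClass_eq_iff {k : ℕ} {z z' : C k} (hz : z ∈ cycles d k) (hz' : z' ∈ cycles d k) :
    homologyClass d k z hz = homologyClass d k z' hz' ↔ ∃ x, z = z' + d k x := by
  rw [homologyClass, homologyClass, Submodule.Quotient.eq, Submodule.submoduleOf,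
    Submodule.mem_comap]
  constructor
  · rintro ⟨x, hx⟩
    exact ⟨x, by rw [hx]; simp⟩
  · rintro ⟨x, hx⟩
    exact ⟨x, by simp [hx]⟩

theorem sum_smul_homologyClass {α : Type} [Fintype α] {k : ℕ} (a : α → ℂ) (z : α → C k)
    (hz : ∀ i, z i ∈ cycles d k) :
    ∑ i, a i • homologyClass d k (z i) (hz i) = homologyClass d k (∑ i, a i • z i)
      (Submodule.sum_mem _ fun i _ => Submodule.smul_mem _ _ (hz i)) := by
  have h : (⟨∑ i, a i • z i, Submodule.sum_mem _ fun i _ => Submodule.smul_mem _ _ (hz i)⟩ :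
      cycles d k) = ∑ i, a i • (⟨z i, hz i⟩ : cycles d k) := by
    apply Subtype.ext
    simp
  simp only [homologyClass]
  rw [h]
  simp only [← Submodule.mkQ_apply, map_sum, map_smul]

/-- Chains `lift k` and cycles `cyc k` such that the boundaries of `lift (k + 1)`, the chains
`lift k` and the cycles `cyc k` are meant to be a basis of `C k`. -/
structure Splitting (d : ∀ k, C (k + 1) →ₗ[ℂ] C k) (β η : ℕ → Type) where
  lift : ∀ k, β k → C k
  cyc : ∀ k, η k → C k
  cyc_mem : ∀ k i, cyc k i ∈ cycles d k

namespace Splitting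

variable (S : Splitting d β η)

def family (k : ℕ) : (β (k + 1) ⊕ β k) ⊕ η k → C k :=
  Sum.elim (Sum.elim (fun j => d k (S.lift (k + 1) j)) (S.lift k)) (S.cyc k)

theorem d_cyc (k : ℕ) (i : η (k + 1)) : d k (S.cyc (k + 1) i) = 0 :=
  S.cyc_mem (k + 1) i

variable [∀ k, Fintype (β k)] [∀ k, Fintype (η k)]
variable (hd : ∀ k x, d k (d (k + 1) x) = 0)
variable (b : ∀ k, Module.Basis ((β (k + 1) ⊕ β k) ⊕ η k) ℂ (C k))
  (hb : ∀ k, ⇑(b k) = S.family k)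

include hd hb in
-- The differential kills boundaries and cycles, so only the coordinates along the lifts survive,
-- and they become coordinates along the boundaries of these lifts. In an adapted basis every
-- differential is a partial identity matrix.
theorem d_apply (k : ℕ) (x : C (k + 1)) :
    d k x = ∑ i, (b (k + 1)).repr x (Sum.inl (Sum.inr i)) • b k (Sum.inl (Sum.inl i)) := by
  conv_lhs => rw [← (b (k + 1)).sum_repr x]
  simp [Fintype.sum_sum_type, hb, family, hd, d_cyc]

include hd hb in
theorem repr_d_inl_inl (k : ℕ) (x : C (k + 1)) (i : β (k + 1)) :
    (b k).repr (d k x) (Sum.inl (Sum.inl i)) = (b (k + 1)).repr x (Sum.inl (Sum.inr i)) := by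
  classical
  rw [S.d_apply hd b hb, map_sum, Finsupp.finsetSum_apply]
  simp [Finsupp.single_apply]

include hd hb in
theorem repr_d_inl_inr (k : ℕ) (x : C (k + 1)) (i : β k) :
    (b k).repr (d k x) (Sum.inl (Sum.inr i)) = 0 := by
  classical
  rw [S.d_apply hd b hb, map_sum, Finsupp.finsetSum_apply]
  simp

include hd hb in
theorem repr_d_inr (k : ℕ) (x : C (k + 1)) (i : η k) :
    (b k).repr (d k x) (Sum.inr i) = 0 := by
  classical
  rw [S.d_apply hd b hb, map_sum, Finsupp.finsetSum_apply]
  simp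

include hd hb in
-- The lift coordinates of a chain are the boundary coordinates of its differential, which vanish
-- for a cycle. In degree 0 there are no lifts.
theorem repr_cycle [IsEmpty (β 0)] (k : ℕ) (z : C k) (hz : z ∈ cycles d k) (i : β k) :
    (b k).repr z (Sum.inl (Sum.inr i)) = 0 := by
  cases k with
  | zero => exact isEmptyElim i
  | succ k =>
    rw [← S.repr_d_inl_inl hd b hb, show d k z = 0 from hz]
    simp

include hd hb in
theorem linearIndependent_class (k : ℕ) :
    LinearIndependent ℂ fun i => homologyClass d k (S.cyc k i) (S.cyc_mem k i) := by
  classical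
  rw [Fintype.linearIndependent_iff]
  intro g hg i
  rw [sum_smul_homologyClass, show (0 : Homology d k) = homologyClass d k 0 (zero_mem _) from
    rfl, homologyClass_eq_iff] at hg
  obtain ⟨x, hx⟩ := hg
  rw [zero_add] at hx
  have h2 := S.repr_d_inr hd b hb k x i
  rw [← hx] at h2
  have h3 : ∀ j, S.cyc k j = b k (Sum.inr j) := fun j => by rw [hb]; rfl
  simpa [h3, Finsupp.single_apply] using h2

include hd hb in
theorem span_class [IsEmpty (β 0)] (k : ℕ) :
    ⊤ ≤ Submodule.span ℂ (Set.range fun i => homologyClass d k (S.cyc k i) (S.cyc_mem k i)) := by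
  rintro ⟨z, hz⟩ -
  have h : homologyClass d k z hz =
      ∑ i, (b k).repr z (Sum.inr i) • homologyClass d k (S.cyc k i) (S.cyc_mem k i) := by
    rw [sum_smul_homologyClass, homologyClass_eq_iff]
    -- A cycle has boundary and homology coordinates only; the former supply the chain whose
    -- boundary is the difference.
    refine ⟨∑ i, (b k).repr z (Sum.inl (Sum.inl i)) • S.lift (k + 1) i, ?_⟩
    have h2 := (b k).sum_repr z
    simp only [Fintype.sum_sum_type, S.repr_cycle hd b hb k z hz, hb, family, Sum.elim_inl,
      Sum.elim_inr, zero_smul, Finset.sum_const_zero, add_zero] at h2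
    rw [map_sum, add_comm]
    simp only [map_smul]
    exact h2.symm
  change homologyClass d k z hz ∈ _
  rw [h]
  exact Submodule.sum_mem _ fun i _ => Submodule.smul_mem _ _ (Submodule.subset_span ⟨i, rfl⟩)

/-- The classes of the cycles form a basis of the homology. -/
def homologyBasis [IsEmpty (β 0)] (k : ℕ) : Module.Basis (η k) ℂ (Homology d k) :=
  Module.Basis.mk (S.linearIndependent_class hd b hb k) (S.span_class hd b hb k)

theorem homologyBasis_apply [IsEmpty (β 0)] (k : ℕ) (i : η k) :
    S.homologyBasis hd b hb k i = homologyClass d k (S.cyc k i) (S.cyc_mem k i) := by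
  simp [homologyBasis]

omit [∀ k, Fintype (β k)] [∀ k, Fintype (η k)] in
include hb in
theorem linearIndependent_d_lift (k : ℕ) :
    LinearIndependent ℂ fun i => d k (S.lift (k + 1) i) := by
  have h := (b k).linearIndependent.comp (fun i : β (k + 1) => Sum.inl (Sum.inl i))
    (Sum.inl_injective.comp Sum.inl_injective)
  rw [hb] at h
  exact h

include hd hb in
theorem span_d_lift (k : ℕ) :
    Submodule.span ℂ (Set.range fun i => d k (S.lift (k + 1) i)) = LinearMap.range (d k) := by
  apply le_antisymm
  · rw [Submodule.span_le]
    rintro _ ⟨i, rfl⟩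
    exact ⟨_, rfl⟩
  · rintro _ ⟨x, rfl⟩
    rw [S.d_apply hd b hb]
    refine Submodule.sum_mem _ fun i _ => Submodule.smul_mem _ _ (Submodule.subset_span ⟨i, ?_⟩)
    rw [hb]
    rfl

/-- The matrix expressing the boundaries of other lifts in terms of the boundaries of `lift`. -/
def liftMatrix {β' : ℕ → Type} (S' : Splitting d β' η) (k : ℕ) : Matrix (β k) (β' k) ℂ :=
  Matrix.of fun i j => (b k).repr (S'.lift k j) (Sum.inl (Sum.inr i))

include hd hb in
-- In the coordinates of `b k`, new boundaries have boundary coordinates only, new cycles are old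
-- cycles plus boundaries, and new lifts are arbitrary. The matrix is therefore triangular up to the
-- order of its blocks, with diagonal blocks `liftMatrix (k + 1)`, `liftMatrix k` and the identity.
theorem det_family_eq [∀ k, DecidableEq (β k)] [∀ k, DecidableEq (η k)] [IsEmpty (β 0)]
    (S' : Splitting d β η)
    (hS : ∀ k i, homologyClass d k (S'.cyc k i) (S'.cyc_mem k i) =
      homologyClass d k (S.cyc k i) (S.cyc_mem k i)) (k : ℕ) :
    (b k).det (S'.family k) = (liftMatrix b S' (k + 1)).det * (liftMatrix b S' k).det := by
  have hcyc : ∀ i, ∃ x, S'.cyc k i = S.cyc k i + d k x := by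
    intro i
    exact (homologyClass_eq_iff _ _).1 (hS k i)
  choose x hx using hcyc
  have h3 : ∀ j, S.cyc k j = b k (Sum.inr j) := fun j => by rw [hb]; rfl
  -- Eliminating the identity block of the cycles leaves a Schur complement that is block triangular
  -- for boundaries and lifts.
  rw [Module.Basis.det_apply, ← Matrix.fromBlocks_toBlocks ((b k).toMatrix (S'.family k)),
    show ((b k).toMatrix (S'.family k)).toBlocks₂₂ = 1 from ?_, Matrix.det_fromBlocks_one₂₂,
    ← Matrix.fromBlocks_toBlocks (_ - _), show Matrix.toBlocks₂₁ (_ - _) = 0 from ?_,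
    Matrix.det_fromBlocks_zero₂₁]
  · congr 2
    · ext i j
      simp [Matrix.toBlocks₁₁, Matrix.toBlocks₁₂, Matrix.toBlocks₂₁, Matrix.mul_apply,
        Module.Basis.toMatrix_apply, family, liftMatrix, S.repr_d_inl_inl hd b hb,
        S.repr_d_inr hd b hb]
    · ext i j
      simp [Matrix.toBlocks₁₁, Matrix.toBlocks₁₂, Matrix.toBlocks₂₁, Matrix.toBlocks₂₂,
        Matrix.mul_apply,
        Module.Basis.toMatrix_apply, family, liftMatrix, S.repr_cycle hd b hb _ _ (S'.cyc_mem k _)]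
  · ext i j
    simp [Matrix.toBlocks₁₁, Matrix.toBlocks₁₂, Matrix.toBlocks₂₁, Matrix.mul_apply,
        Module.Basis.toMatrix_apply, family, S.repr_d_inl_inr hd b hb,
        S.repr_d_inr hd b hb]
  · ext i j
    simp [Matrix.toBlocks₂₂, Module.Basis.toMatrix_apply, family, hx, h3,
        S.repr_d_inr hd b hb, Matrix.one_apply, Finsupp.single_apply, eq_comm]

end Splitting

end Splitting

end ReidemeisterTorsion
end

/-! ### Independence of the torsion from the auxiliary choices. -/

noncomputable section

namespace ReidemeisterTorsion

section TorsionOfSplitting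

variable {C : ℕ → Type} [∀ k, AddCommGroup (C k)] [∀ k, Module ℂ (C k)]
variable {d : ∀ k, C (k + 1) →ₗ[ℂ] C k} {ι β η : ℕ → Type}

def Choice.toSplitting {h : ∀ k, η k → Homology d k} (T : Choice d ι h) :
    Splitting d (fun k => Fin (T.rank k)) η where
  lift := T.bLift
  cyc := T.hLift
  cyc_mem := T.hLift_mem

theorem Choice.newBasis_eq {h : ∀ k, η k → Homology d k} (T : Choice d ι h) (k : ℕ) :
    T.newBasis k = T.toSplitting.family k ∘ T.reindex k :=
  rfl

/-- The same splitting with the lifts enumerated differently. -/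
def Splitting.reindex {β' : ℕ → Type} (S : Splitting d β η) (σ : ∀ k, β k ≃ β' k) :
    Splitting d β' η where
  lift k j := S.lift k ((σ k).symm j)
  cyc := S.cyc
  cyc_mem := S.cyc_mem

theorem Splitting.family_reindex {β' : ℕ → Type} (S : Splitting d β η) (σ : ∀ k, β k ≃ β' k)
    (k : ℕ) : (S.reindex σ).family k ∘
      Equiv.sumCongr (Equiv.sumCongr (σ (k + 1)) (σ k)) (Equiv.refl _) = S.family k := by
  ext j
  rcases j with (j | j) | j <;> simp [family, reindex]

variable [∀ k, Fintype (ι k)] [∀ k, DecidableEq (ι k)]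
  [∀ k, Fintype (β k)] [∀ k, Fintype (η k)]

theorem det_comp_equiv {V : Type*} [AddCommGroup V] [Module ℂ V] {α J : Type*} [Fintype α]
    [DecidableEq α] (c : Module.Basis α ℂ V) (f : J → V) (e e' : α ≃ J) :
    c.det (f ∘ e') = c.det (f ∘ e) ∨ c.det (f ∘ e') = -c.det (f ∘ e) := by
  have h : f ∘ e' = (f ∘ e) ∘ (e'.trans e.symm) := by
    ext x
    simp
  rw [h, AlternatingMap.map_perm]
  rcases Int.units_eq_one_or (Equiv.Perm.sign (e'.trans e.symm)) with h | h <;> simp [h]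

theorem det_comp_eq_mul {V : Type*} [AddCommGroup V] [Module ℂ V] {α J : Type*} [Fintype α]
    [DecidableEq α] [Fintype J] [DecidableEq J] (c : Module.Basis α ℂ V) (b : Module.Basis J ℂ V)
    (f : J → V) (e : α ≃ J) :
    c.det (f ∘ e) = c.det (b ∘ e) * b.det f := by
  have h : b.det f = (b.reindex e.symm).det (f ∘ e) := by
    rw [Module.Basis.det_apply, Module.Basis.det_apply,
      ← Matrix.det_submatrix_equiv_self e (b.toMatrix f)]
    congr 1
  rw [h, Module.Basis.det_apply, Module.Basis.det_apply, Module.Basis.det_apply, ← Matrix.det_mul]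
  congr 1
  have h2 : (b ∘ e : α → V) = b.reindex e.symm := by
    ext x
    simp
  rw [h2, Module.Basis.toMatrix_mul_toMatrix]

theorem isUnit_sign_zpow {s : ℂ} (hs : s = 1 ∨ s = -1) (k : ℕ) :
    s ^ ((-1 : ℤ) ^ k) = 1 ∨ s ^ ((-1 : ℤ) ^ k) = -1 := by
  rcases neg_one_pow_eq_or ℤ k with h | h <;> rcases hs with rfl | rfl <;> simp [h]

theorem prod_sign {n : ℕ} {s : ℕ → ℂ} (hs : ∀ k, s k = 1 ∨ s k = -1) :
    ∏ k ∈ Finset.range n, s k = 1 ∨ ∏ k ∈ Finset.range n, s k = -1 := by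
  induction n with
  | zero => simp
  | succ n ih =>
    rw [Finset.prod_range_succ]
    rcases ih with h | h <;> rcases hs n with h' | h' <;> simp [h, h']

/-- Each interior `p k` occurs in two consecutive factors with opposite exponents, so only the two
ends remain. -/
theorem prod_telescope (p : ℕ → ℂ) (hp : ∀ k, p k ≠ 0) (n : ℕ) :
    ∏ k ∈ Finset.range n, (p (k + 1) * p k) ^ ((-1 : ℤ) ^ (k + 1)) =
      (p 0)⁻¹ * p n ^ ((-1 : ℤ) ^ n) := by
  induction n with
  | zero => simp [hp]
  | succ n ih =>
    rw [Finset.prod_range_succ, ih, mul_zpow, pow_succ (-1 : ℤ) n, mul_neg_one, zpow_neg (p n)]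
    have := zpow_ne_zero ((-1 : ℤ) ^ n) (hp n)
    field_simp

section Value

variable (S : Splitting d β η) (hd : ∀ k x, d k (d (k + 1) x) = 0)
  (b : ∀ k, Module.Basis ((β (k + 1) ⊕ β k) ⊕ η k) ℂ (C k)) (hb : ∀ k, ⇑(b k) = S.family k)
  {h : ∀ k, η k → Homology d k}
  (hS : ∀ k i, h k i = homologyClass d k (S.cyc k i) (S.cyc_mem k i))
  (c : ∀ k, Module.Basis (ι k) ℂ (C k)) (e : ∀ k, ι k ≃ (β (k + 1) ⊕ β k) ⊕ η k)

omit [∀ k, Fintype (ι k)] [∀ k, DecidableEq (ι k)] in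
include hd hb in
-- In positive degree both numbers are the dimension of the image of the same differential.
theorem Choice.rank_eq_card [IsEmpty (β 0)] (T : Choice d ι h) (k : ℕ) :
    T.rank k = Fintype.card (β k) := by
  cases k with
  | zero => rw [T.rank_zero, Fintype.card_eq_zero]
  | succ k =>
    have h1 := finrank_span_eq_card (T.b_linearIndependent k)
    have h2 := finrank_span_eq_card (S.linearIndependent_d_lift b hb k)
    rw [T.b_span] at h1
    rw [S.span_d_lift hd b hb] at h2
    rw [← h2, h1, Fintype.card_fin]

include hd hb hS in
-- Up to sign, passing to another choice multiplies the determinant in degree `k` by the transition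
-- determinants `p (k + 1) * p k`. These cancel in the alternating product.
theorem Choice.value_eq [IsEmpty (β 0)] (n : ℕ) [IsEmpty (β (n + 1))] (T : Choice d ι h) :
    T.value c n =
        ∏ k ∈ Finset.range (n + 1), (c k).det (S.family k ∘ e k) ^ ((-1 : ℤ) ^ (k + 1)) ∨
      T.value c n =
        -∏ k ∈ Finset.range (n + 1), (c k).det (S.family k ∘ e k) ^ ((-1 : ℤ) ^ (k + 1)) := by
  classical
  have σ : ∀ k, Fin (T.rank k) ≃ β k := fun k =>
    Fintype.equivOfCardEq (by rw [Fintype.card_fin, Choice.rank_eq_card S hd b hb T])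
  set S' := T.toSplitting.reindex σ with hS'
  set p : ℕ → ℂ := fun k => (Splitting.liftMatrix b S' k).det with hp
  have hdet : ∀ k, ∃ s : ℂ, (s = 1 ∨ s = -1) ∧
      (c k).det (T.newBasis k) = s * ((c k).det (S.family k ∘ e k) * (p (k + 1) * p k)) := by
    intro k
    have h1 : (c k).det (S'.family k ∘ e k) =
        (c k).det (S.family k ∘ e k) * (p (k + 1) * p k) := by
      rw [det_comp_eq_mul (c k) (b k), S.det_family_eq hd b hb S', hb]
      intro k i
      rw [← hS, ← T.hLift_class]
      rfl
    have h2 : T.newBasis k = S'.family k ∘ ((T.reindex k).trans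
        (Equiv.sumCongr (Equiv.sumCongr (σ (k + 1)) (σ k)) (Equiv.refl _))) := by
      rw [T.newBasis_eq, ← Splitting.family_reindex T.toSplitting σ k]
      rfl
    rw [h2, ← h1]
    rcases det_comp_equiv (c k) (S'.family k) (e k) ((T.reindex k).trans
        (Equiv.sumCongr (Equiv.sumCongr (σ (k + 1)) (σ k)) (Equiv.refl _))) with h3 | h3
    · exact ⟨1, Or.inl rfl, by rw [h3, one_mul]⟩
    · exact ⟨-1, Or.inr rfl, by rw [h3, neg_one_mul]⟩
  choose s hs hsd using hdet
  -- A kernel vector of the transition matrix would be a linear relation between the boundaries of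
  -- the chosen lifts, which are independent.
  have hp0 : ∀ k, p k ≠ 0 := by
    intro k
    cases k with
    | zero => simp [hp]
    | succ k =>
      intro h0
      obtain ⟨w, hw, hw0⟩ := Matrix.exists_mulVec_eq_zero_iff.2 h0
      have hli : LinearIndependent ℂ fun i => d k (S'.lift (k + 1) i) :=
        (T.b_linearIndependent k).comp _ (σ (k + 1)).symm.injective
      rw [Fintype.linearIndependent_iff] at hli
      apply hw
      ext i
      refine hli w ?_ i
      have h1 : d k (∑ j, w j • S'.lift (k + 1) j) = 0 := by
        rw [S.d_apply hd b hb]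
        refine Finset.sum_eq_zero fun i _ => ?_
        have h2 := congr_fun hw0 i
        simp only [Matrix.mulVec, dotProduct, Splitting.liftMatrix, Matrix.of_apply,
          Pi.zero_apply] at h2
        rw [map_sum, Finsupp.finsetSum_apply]
        simp only [map_smul, Finsupp.smul_apply, smul_eq_mul]
        rw [← Finset.sum_congr rfl fun j _ => mul_comm _ _, h2, zero_smul]
      simpa using h1
  have key : T.value c n = (∏ k ∈ Finset.range (n + 1), s k ^ ((-1 : ℤ) ^ (k + 1))) *
      ∏ k ∈ Finset.range (n + 1), (c k).det (S.family k ∘ e k) ^ ((-1 : ℤ) ^ (k + 1)) := by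
    rw [Choice.value]
    simp only [hsd, mul_zpow]
    rw [Finset.prod_mul_distrib, Finset.prod_mul_distrib]
    simp only [← mul_zpow]
    -- There are no lifts in degrees `0` and `n + 1`, so both ends of the telescope are determinants
    -- of empty matrices.
    rw [prod_telescope p hp0, show p 0 = 1 by simp [hp], show p (n + 1) = 1 by simp [hp]]
    simp
  rw [key]
  rcases prod_sign (n := n + 1) (s := fun k => s k ^ ((-1 : ℤ) ^ (k + 1)))
    (fun k => isUnit_sign_zpow (hs k) (k + 1)) with h1 | h1 <;> simp [h1]

omit [∀ k, Fintype (ι k)] [∀ k, DecidableEq (ι k)] in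
include hd hb hS e in
theorem Splitting.nonempty_choice [IsEmpty (β 0)] : Nonempty (Choice d ι h) := by
  classical
  let σ : ∀ k, β k ≃ Fin (Fintype.card (β k)) := fun k => Fintype.equivFin (β k)
  refine ⟨⟨fun k => Fintype.card (β k), Fintype.card_eq_zero, (S.reindex σ).lift, ?_, ?_, S.cyc,
    S.cyc_mem, fun k i => (hS k i).symm, fun k => (e k).trans
      (Equiv.sumCongr (Equiv.sumCongr (σ (k + 1)) (σ k)) (Equiv.refl _))⟩⟩
  · exact fun k => (S.linearIndependent_d_lift b hb k).comp _ (σ (k + 1)).symm.injective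
  · intro k
    rw [← S.span_d_lift hd b hb]
    congr 1
    exact (σ (k + 1)).symm.surjective.range_comp fun i => d k (S.lift (k + 1) i)

end Value

omit [∀ k, Fintype (β k)] [∀ k, Fintype (η k)] in
/-- The basis of `C k` given by a splitting. -/
theorem Splitting.exists_basis (S : Splitting d β η) (c : ∀ k, Module.Basis (ι k) ℂ (C k))
    (e : ∀ k, ι k ≃ (β (k + 1) ⊕ β k) ⊕ η k)
    (hne : ∀ k, (c k).det (S.family k ∘ e k) ≠ 0) :
    ∃ b : ∀ k, Module.Basis ((β (k + 1) ⊕ β k) ⊕ η k) ℂ (C k), ∀ k, ⇑(b k) = S.family k := by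
  have h : ∀ k, ∃ b : Module.Basis ((β (k + 1) ⊕ β k) ⊕ η k) ℂ (C k), ⇑b = S.family k := by
    intro k
    obtain ⟨h1, h2⟩ := (c k).is_basis_iff_det.2 (isUnit_iff_ne_zero.2 (hne k))
    refine ⟨(Module.Basis.mk h1 h2.ge).reindex (e k), ?_⟩
    ext i
    simp
  choose b hb using h
  exact ⟨b, hb⟩

/-- A splitting with nonzero determinants computes the torsion. -/
theorem Splitting.torsion_eq (S : Splitting d β η) (hd : ∀ k x, d k (d (k + 1) x) = 0)
    (c : ∀ k, Module.Basis (ι k) ℂ (C k)) (e : ∀ k, ι k ≃ (β (k + 1) ⊕ β k) ⊕ η k)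
    (hne : ∀ k, (c k).det (S.family k ∘ e k) ≠ 0) {h : ∀ k, η k → Homology d k}
    (hS : ∀ k i, h k i = homologyClass d k (S.cyc k i) (S.cyc_mem k i))
    [IsEmpty (β 0)] (n : ℕ) [IsEmpty (β (n + 1))] {t : ℂ}
    (ht : t = ∏ k ∈ Finset.range (n + 1), (c k).det (S.family k ∘ e k) ^ ((-1 : ℤ) ^ (k + 1)) ∨
      t = -∏ k ∈ Finset.range (n + 1), (c k).det (S.family k ∘ e k) ^ ((-1 : ℤ) ^ (k + 1))) :
    torsion d c h n = {t, -t} := by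
  obtain ⟨b, hb⟩ := S.exists_basis c e hne
  have hval := fun T : Choice d ι h => Choice.value_eq S hd b hb hS c e n T
  set v := ∏ k ∈ Finset.range (n + 1), (c k).det (S.family k ∘ e k) ^ ((-1 : ℤ) ^ (k + 1))
  -- All values agree up to sign, but the set of values equals `{t, -t}` only if some choice exists.
  obtain ⟨T⟩ := S.nonempty_choice hd b hb hS e
  ext x
  simp only [torsion, Set.mem_ofPred_eq, Set.mem_insert_iff, Set.mem_singleton_iff]
  constructor
  · rintro ⟨T, hT⟩
    rcases hval T with h1 | h1 <;> rcases ht with rfl | rfl <;> simp_all [or_comm]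
  · intro hx
    refine ⟨T, ?_⟩
    rcases hval T with h1 | h1 <;> rcases ht with rfl | rfl <;> simp_all [or_comm]

end TorsionOfSplitting

end ReidemeisterTorsion
end

noncomputable section

namespace DBlock

open ReidemeisterTorsion

/-! ## An acyclic matching on the cells of the block -/

/-- No other element has the same level as `x`. -/
def Alone (f : Fin 4 → Fin 4) (x : Fin 4) : Prop := ∀ y, f y = f x → y = x

instance (f : Fin 4 → Fin 4) (x : Fin 4) : Decidable (Alone f x) :=
  inferInstanceAs (Decidable (∀ _, _))

/-- The element which is split off, or joined to the preceding block. -/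
def pivot (ε : Bool) (f : Fin 4 → Fin 4) : Fin 4 :=
  if ε then
    if ¬ (f 0 = 0 ∧ Alone f 0) then 0 else if ¬ (f 1 = 1 ∧ Alone f 1) then 1
    else if ¬ (f 2 = 2 ∧ Alone f 2) then 2 else 3
  else if f 3 = 0 ∧ ∃ a, a ≠ 3 ∧ f a = 0 ∧ ∀ b, f b = 0 → b = a ∨ b = 3 then
    if f 0 ≠ 0 then 0 else 1
  else 3

/-- The least possible level of the pivot. -/
def floor (ε : Bool) (f : Fin 4 → Fin 4) : Fin 4 :=
  if ε then pivot ε f else if pivot ε f = 3 then 0 else 1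

/-- A level function is an ordered partition. In the copy `true` the pivot is the first `x` whose
block is not `{x}` in position `x`, and 3 if 0, 1, 2 are all in place. In the copy `false` it is 3,
unless the first block is `{a, 3}`: splitting off 3 would then leave the first block `{a}`, a face
in a glued facet, which is not listed in this copy. In that case the pivot is the least element
outside the first block. A source can have its pivot split off, a target can have it joined to the
preceding block, and a critical cell admits neither move. -/
def IsSource (ε : Bool) (f : Fin 4 → Fin 4) : Prop := ¬ Alone f (pivot ε f)

def IsTarget (ε : Bool) (f : Fin 4 → Fin 4) : Prop :=
  Alone f (pivot ε f) ∧ floor ε f < f (pivot ε f)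

def IsCritical (ε : Bool) (f : Fin 4 → Fin 4) : Prop :=
  Alone f (pivot ε f) ∧ f (pivot ε f) ≤ floor ε f

instance (ε : Bool) (f : Fin 4 → Fin 4) : Decidable (IsSource ε f) :=
  inferInstanceAs (Decidable (¬ _))
instance (ε : Bool) (f : Fin 4 → Fin 4) : Decidable (IsTarget ε f) :=
  inferInstanceAs (Decidable (_ ∧ _))
instance (ε : Bool) (f : Fin 4 → Fin 4) : Decidable (IsCritical ε f) :=
  inferInstanceAs (Decidable (_ ∧ _))

/-- Join the pivot to the preceding block. -/
def up (ε : Bool) (f : Fin 4 → Fin 4) : Fin 4 → Fin 4 :=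
  fun a => merge (f (pivot ε f) - 1) (f a)

/-- Split off the pivot from its block. -/
def down (ε : Bool) (f : Fin 4 → Fin 4) : Fin 4 → Fin 4 :=
  fun a => if a = pivot ε f ∨ f (pivot ε f) < f a then f a + 1 else f a

/-- The condition on the level function of a cell of dimension `k` of the block. -/
def IsCell (k : ℕ) (ε : Bool) (f : Fin 4 → Fin 4) : Prop :=
  (∀ i : Fin 4, (∃ a, f a = i) ↔ i.val + k < 4) ∧ ((∃ j, InGlued j f) → ε = true)

instance (k : ℕ) (ε : Bool) (f : Fin 4 → Fin 4) : Decidable (IsCell k ε f) :=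
  inferInstanceAs (Decidable (_ ∧ _))

/-- A height function for which the matching is acyclic. -/
def height (ε : Bool) (f : Fin 4 → Fin 4) : ℕ :=
  if IsSource ε f then 0 else if IsCritical ε f then 1000 + (if f 2 = 0 then 2 else if f 1 = 0 then 1 else 0)
  else if ε then 1 + 4 * (3 - (pivot ε f).val) + (f (pivot ε f)).val
  else if f 3 = 0 then 100 else 101 + (f 3).val

/-- This turns a quantifier over level functions into four quantifiers over `Fin 4`, so that
statements about faces become finite checks. -/
theorem forall_levels {P : (Fin 4 → Fin 4) → Prop}
    (h : ∀ a b c d : Fin 4, P ![a, b, c, d]) (f : Fin 4 → Fin 4) : P f := by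
  have : f = ![f 0, f 1, f 2, f 3] := by
    ext i
    fin_cases i <;> rfl
  rw [this]
  exact h _ _ _ _

theorem isCell_up {k : ℕ} (hk : k < 4) (ε : Bool) : ∀ f, IsCell k ε f → IsTarget ε f → IsCell (k + 1) ε (up ε f) ∧ IsSource ε (up ε f) ∧ down ε (up ε f) = f := by
  refine forall_levels ?_
  interval_cases k <;> cases ε <;> decide +kernel

theorem isCell_down {k : ℕ} (hk : k < 4) (ε : Bool) : ∀ f, IsCell (k + 1) ε f → IsSource ε f → IsCell k ε (down ε f) ∧ IsTarget ε (down ε f) ∧ up ε (down ε f) = f := by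
  refine forall_levels ?_
  interval_cases k <;> cases ε <;> decide +kernel

end DBlock
end

/-! ### Acyclicity of the matching and its critical cells. -/

noncomputable section

namespace DBlock

open ReidemeisterTorsion

/-- The copy of the ball in which a cell of the block is listed. -/
def side (ε : Bool) (f : Fin 4 → Fin 4) : Bool := ε || decide (∃ j, InGlued j f)

/-- This is the acyclicity of the matching: among the noncritical faces of a source, its partner is
strictly highest. Faces in a glued facet are compared as cells of the copy `true`, whence `side`. -/
theorem height_lt {k : ℕ} (hk : k < 4) (ε : Bool) : ∀ (g : Fin 4 → Fin 4) (i : Fin 4),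
    IsCell k (side ε g) g → IsCell (k + 1) ε (fun a => merge i (g a)) →
    IsSource ε (fun a => merge i (g a)) →
    (side ε g = ε ∧ g = down ε fun a => merge i (g a)) ∨
      height (side ε g) g < height ε (down ε fun a => merge i (g a)) ∨
      IsCritical (side ε g) g := by
  refine forall_levels ?_
  interval_cases k <;> cases ε <;> decide +kernel

theorem incidence_down {k : ℕ} (hk : k < 4) (ε : Bool) : ∀ f : Fin 4 → Fin 4,
    IsCell (k + 1) ε f → IsSource ε f →
    incidence f (down ε f) = 1 ∨ incidence f (down ε f) = -1 := by
  refine forall_levels ?_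
  interval_cases k <;> cases ε <;> decide +kernel

/-- The critical edge joining `G_a` to `G_3`, for `a < 3`. -/
def criticalEdge (a : Fin 3) : Fin 4 → Fin 4 :=
  (parallelEdge ⟨(a.castSucc, 3), Fin.castSucc_lt_last a⟩).1

/-- One vertex and three edges remain, as for a bouquet of three circles. -/
theorem isCritical_iff {k : ℕ} (hk : k < 4) (ε : Bool) : ∀ f : Fin 4 → Fin 4, IsCell k ε f →
    (IsCritical ε f ↔ (k = 0 ∧ ε = true ∧ f = id) ∨
      (k = 1 ∧ ε = false ∧ ∃ a, f = criticalEdge a)) := by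
  refine forall_levels ?_
  interval_cases k <;> cases ε <;> decide +kernel

theorem not_isSource_zero (ε : Bool) : ∀ f : Fin 4 → Fin 4, IsCell 0 ε f → ¬ IsSource ε f := by
  refine forall_levels ?_
  cases ε <;> decide +kernel

/-- An edge has exactly one block with two elements. In the copy `false` it is the first block; the
pivot is 3 if 3 lies outside it, and another element outside it otherwise, so the pivot is alone.
Hence all source edges lie in the copy `true`, where both the augmentation of boundaries and the
edge cocycles vanish. -/
theorem not_isSource_one : ∀ f : Fin 4 → Fin 4, IsCell 1 false f → ¬ IsSource false f := by
  refine forall_levels ?_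
  decide +kernel

end DBlock
end

/-! ### End points of edges in the glued facets. -/

noncomputable section

namespace DBlock

open ReidemeisterTorsion

/-- The signed number of end points of an edge in the facet `G_a`. -/
def endpointCount (a : Fin 4) (f : Fin 4 → Fin 4) : ℤ :=
  ∑ w : Face 0, if w.1 a = 0 then incidence f w.1 else 0

theorem sum_incidence_edge : ∀ f : Fin 4 → Fin 4, (∀ i : Fin 4, (∃ a, f a = i) ↔ i.val + 1 < 4) →
    ∑ w : Face 0, incidence f w.1 = 0 := by
  refine forall_levels ?_
  decide +kernel

theorem endpointCount_parallelEdge : ∀ (p : EdgePair) (a : Fin 4),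
    endpointCount a (parallelEdge p).1 = if a = p.1.1 then 1 else if a = p.1.2 then -1 else 0 := by
  decide +kernel

end DBlock
end

/-! ### Determinants of block triangular families. -/

noncomputable section

namespace ReidemeisterTorsion

variable {S : Type} [Fintype S] [DecidableEq S]

/-- The determinant of a block matrix which is triangular for some height function on the blocks. -/
theorem det_eq_prod_blocks {n : ℕ} (A : Matrix (Σ _ : S, Fin n) (Σ _ : S, Fin n) ℂ) (h : S → ℕ)
    (hA : ∀ i j, A i j ≠ 0 → i.1 = j.1 ∨ h i.1 < h j.1) :
    A.det = ∏ s, (Matrix.of fun q r => A ⟨s, q⟩ ⟨s, r⟩).det := by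
  classical
  -- Ties in the height are broken by an arbitrary enumeration, so as to obtain a linear order on
  -- the blocks.
  let g : S → ℕ ×ₗ Fin (Fintype.card S) := fun s => toLex (h s, Fintype.equivFin S s)
  have hg : Function.Injective g := fun s t hst => by
    have := congrArg (fun x => (ofLex x).2) hst
    exact (Fintype.equivFin S).injective this
  let _ : LinearOrder S := LinearOrder.lift' g hg
  have hlt : ∀ s t : S, h s < h t → s < t := fun s t hst => by
    change g s < g t
    exact Prod.Lex.toLex_lt_toLex.2 (Or.inl hst)
  have htri : A.BlockTriangular Sigma.fst := by
    intro i j hij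
    by_contra hne
    rcases hA i j hne with h1 | h1
    · exact hij.ne h1.symm
    · exact lt_asymm hij (hlt _ _ h1)
  rw [htri.det_fintype]
  refine Finset.prod_congr rfl fun s _ => ?_
  let e : Fin n ≃ {i : Σ _ : S, Fin n // i.1 = s} :=
    { toFun := fun q => ⟨⟨s, q⟩, rfl⟩
      invFun := fun i => i.1.2
      left_inv := fun q => rfl
      right_inv := by rintro ⟨⟨t, q⟩, rfl⟩; rfl }
  rw [← Matrix.det_submatrix_equiv_self e]
  rfl

/-- The determinant of a family of vectors which is block triangular with respect to functionals
that differ from the coordinates by a unitriangular transformation. -/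
theorem det_stdBasis_eq_prod {n : ℕ} (W : (Σ _ : S, Fin n) → S → Fin n → ℂ)
    (ψ : S → (S → Fin n → ℂ) →ₗ[ℂ] (Fin n → ℂ)) (h : S → ℕ) (crit : S → Prop)
    (hψ : ∀ s, ¬ crit s → ∀ x, ψ s x = x s)
    (hψ' : ∀ s s' v, crit s → crit s' → ψ s (Pi.single s' v) = if s = s' then v else 0)
    (hW : ∀ s s' r, s ≠ s' → ¬ h s < h s' → ψ s (W ⟨s', r⟩) = 0) :
    (Pi.basis fun _ : S => Pi.basisFun ℂ (Fin n)).det W =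
      ∏ s, (Matrix.of fun q r => ψ s (W ⟨s, r⟩) q).det := by
  classical
  set b := Pi.basis fun _ : S => Pi.basisFun ℂ (Fin n) with hb
  let A : Matrix (Σ _ : S, Fin n) (Σ _ : S, Fin n) ℂ := Matrix.of fun i j => ψ i.1 (W j) i.2
  let B : Matrix (Σ _ : S, Fin n) (Σ _ : S, Fin n) ℂ := Matrix.of fun i j => ψ i.1 (b j) i.2
  have hAB : A = B * b.toMatrix W := by
    ext i j
    simp only [A, B, Matrix.mul_apply, Matrix.of_apply, Module.Basis.toMatrix_apply]
    conv_lhs => rw [← b.sum_repr (W j)]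
    rw [map_sum, Finset.sum_apply]
    exact Finset.sum_congr rfl fun x _ => by rw [map_smul, Pi.smul_apply, smul_eq_mul, mul_comm]
  have hbs : ∀ j : Σ _ : S, Fin n, b j = Pi.single j.1 (Pi.single j.2 1) := by
    rintro ⟨s, r⟩
    ext t q
    simp [hb, Pi.basis_apply]
  have hB : B.det = 1 := by
    -- The functionals agree with the coordinates off the critical indices and restrict to
    -- coordinates on the critical part. Thus `B` is unitriangular, the only other entries having
    -- critical row and noncritical column.
    rw [det_eq_prod_blocks B (fun s => if crit s then 0 else 1)]
    · refine Finset.prod_eq_one fun s _ => ?_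
      convert Matrix.det_one (n := Fin n) (R := ℂ) using 2
      ext q r
      simp only [B, Matrix.of_apply, hbs]
      by_cases hs : crit s
      · rw [hψ' s s _ hs hs, if_pos rfl]
        simp [Matrix.one_apply, Pi.single_apply]
      · rw [hψ s hs]
        simp [Matrix.one_apply, Pi.single_apply]
    · intro i j hij
      simp only [B, Matrix.of_apply, hbs] at hij
      by_contra hcon
      push Not at hcon
      obtain ⟨h1, h2⟩ := hcon
      apply hij
      by_cases hs : crit i.1
      · by_cases hs' : crit j.1
        · rw [hψ' _ _ _ hs hs', if_neg h1]; rfl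
        · simp [hs, hs'] at h2
      · rw [hψ _ hs, Pi.single_eq_of_ne h1]; rfl
  rw [Module.Basis.det_apply, ← one_mul (Matrix.det _), ← hB, ← Matrix.det_mul, ← hAB,
    det_eq_prod_blocks A h]
  · rfl
  · intro i j hij
    by_contra hcon
    push Not at hcon
    apply hij
    simp only [A, Matrix.of_apply]
    rw [hW i.1 j.1 j.2 hcon.1 (not_lt.2 hcon.2)]
    rfl

theorem prod_eq_or_neg (D : S → ℂ) (t : Finset S) (h : ∀ s, s ∉ t → D s = 1 ∨ D s = -1) :
    ∏ s, D s = ∏ s ∈ t, D s ∨ ∏ s, D s = -∏ s ∈ t, D s := by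
  have h1 : ∀ u : Finset S, (∀ s ∈ u, s ∉ t) → ∏ s ∈ u, D s = 1 ∨ ∏ s ∈ u, D s = -1 := by
    intro u
    induction u using Finset.induction_on with
    | empty => simp
    | insert a u ha ih =>
      intro hu
      rw [Finset.prod_insert ha]
      rcases ih fun s hs => hu s (Finset.mem_insert_of_mem hs) with h2 | h2 <;>
        rcases h a (hu a (Finset.mem_insert_self _ _)) with h3 | h3 <;> simp [h2, h3]
  rw [← Finset.prod_mul_prod_compl t]
  rcases h1 tᶜ (fun s hs => Finset.mem_compl.1 hs) with h2 | h2 <;> simp [h2]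

end ReidemeisterTorsion
end

/-! ### Twisted chains of the block. -/

noncomputable section

namespace DBlock

open ReidemeisterTorsion

theorem isCell (k : ℕ) (c : BlockCell k) : IsCell k c.1.1 c.1.2.1 := ⟨c.1.2.2, c.2⟩

theorem lt_four_of_face {k : ℕ} (f : Face k) : k < 4 := by
  have := (f.2 (f.1 0)).1 ⟨0, rfl⟩
  omega

def IsCell.toCell {k : ℕ} {ε : Bool} {f : Fin 4 → Fin 4} (h : IsCell k ε f) : BlockCell k :=
  ⟨(ε, ⟨f, h.1⟩), h.2⟩

theorem cell_ext {k : ℕ} {c c' : BlockCell k} (h1 : c.1.1 = c'.1.1) (h2 : c.1.2.1 = c'.1.2.1) :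
    c = c' :=
  Subtype.ext (Prod.ext h1 (Subtype.ext h2))

theorem place_self {k : ℕ} (c : BlockCell k) : place c.1.1 c.1.2 = (1, c) := by
  by_cases h : ∃ j, InGlued j c.1.2.1
  · obtain ⟨j, hj⟩ := h
    have h1 : c.1.1 = true := c.2 ⟨j, hj⟩
    rw [place_of_inGlued _ _ hj, h1]
    simp only [if_true]
    congr 1
    exact cell_ext h1.symm rfl
  · rw [place, dif_neg h]

theorem place_face {k : ℕ} (ε : Bool) (f : Face k) : (place ε f).2.1 = (side ε f.1, f) := by
  by_cases h : ∃ j, InGlued j f.1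
  · rw [place, dif_pos h, side]
    simp [h]
  · rw [place, dif_neg h, side]
    simp [h]

theorem isCell_side {k : ℕ} (ε : Bool) (f : Face k) : IsCell k (side ε f.1) f.1 := by
  refine ⟨f.2, fun h => ?_⟩
  simp [side, h]

theorem exists_of_incidence_ne_zero {f g : Fin 4 → Fin 4} (h : incidence f g ≠ 0) :
    ∃ i, f = fun a => merge i (g a) := by
  obtain ⟨i, -, hi⟩ := Finset.exists_ne_zero_of_sum_ne_zero h
  refine ⟨i, ?_⟩
  by_contra hcon
  exact hi (if_neg fun h' => hcon (funext h'))

section Chains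

variable (ρ : FreeGroup (Fin 3) →* Matrix.SpecialLinearGroup (Fin 2) ℂ)

/-- The transpose of the adjoint representation. -/
def act (γ : FreeGroup (Fin 3)) : Matrix (Fin 3) (Fin 3) ℂ := (Ad (ρ γ)).1ᵀ

theorem act_one : act ρ 1 = 1 := by simp [act]

theorem act_mul (γ δ : FreeGroup (Fin 3)) : act ρ (γ * δ) = act ρ δ * act ρ γ := by
  simp [act, Matrix.transpose_mul]

theorem act_inv_mul (γ : FreeGroup (Fin 3)) : act ρ γ⁻¹ * act ρ γ = 1 := by
  rw [← act_mul, mul_inv_cancel, act_one]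

/-- The twisted chains of the block. -/
abbrev BlockChain (k : ℕ) : Type := BlockCell k → Fin 3 → ℂ

/-- The twisted boundary operator. -/
def chainBoundary (k : ℕ) : BlockChain (k + 1) →ₗ[ℂ] BlockChain k := twistedBoundary ρ k

/-- The map `v ↦ v ⊗ c`. -/
def chainTensor {k : ℕ} (c : FreeGroup (Fin 3) × BlockCell k →₀ ℤ) (v : Fin 3 → ℂ) :
    BlockChain k := block.tensor (Ad.comp ρ) c v

theorem chainTensor_single {k : ℕ} (p : FreeGroup (Fin 3) × BlockCell k) (n : ℤ)
    (v : Fin 3 → ℂ) : chainTensor ρ (Finsupp.single p n) v =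
      n • (Pi.single p.2 (act ρ p.1 *ᵥ v) : BlockChain k) :=
  block.tensor_single (Ad.comp ρ) (k := k) p n v

theorem chainTensor_add {k : ℕ} (c c' : FreeGroup (Fin 3) × BlockCell k →₀ ℤ) (v : Fin 3 → ℂ) :
    chainTensor ρ (c + c') v = chainTensor ρ c v + chainTensor ρ c' v :=
  congrArg (fun L : (Fin 3 → ℂ) →ₗ[ℂ] block.Chain 3 k => L v)
    (block.tensor_add (Ad.comp ρ) c c')

theorem chainTensor_zero {k : ℕ} (v : Fin 3 → ℂ) :
    chainTensor ρ (0 : FreeGroup (Fin 3) × BlockCell k →₀ ℤ) v = 0 :=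
  congrArg (fun L : (Fin 3 → ℂ) →ₗ[ℂ] block.Chain 3 k => L v)
    (block.tensor_zero (Ad.comp ρ))

theorem chainTensor_leftTranslate {k : ℕ} (γ : FreeGroup (Fin 3))
    (c : FreeGroup (Fin 3) × BlockCell k →₀ ℤ) (v : Fin 3 → ℂ) :
    chainTensor ρ (leftTranslate γ c) v = chainTensor ρ c (act ρ γ *ᵥ v) :=
  block.tensor_leftTranslate (Ad.comp ρ) (k := k) γ c v

theorem chainTensor_sum {k : ℕ} {α : Type} (s : Finset α)
    (c : α → FreeGroup (Fin 3) × BlockCell k →₀ ℤ) (v : Fin 3 → ℂ) :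
    chainTensor ρ (∑ a ∈ s, c a) v = ∑ a ∈ s, chainTensor ρ (c a) v :=
  map_sum (⟨⟨fun c => chainTensor ρ c v, chainTensor_zero ρ v⟩,
    fun c c' => chainTensor_add ρ c c' v⟩ :
      (FreeGroup (Fin 3) × BlockCell k →₀ ℤ) →+ BlockChain k) c s

theorem chainBoundary_chainTensor {k : ℕ} (c : FreeGroup (Fin 3) × BlockCell (k + 1) →₀ ℤ)
    (v : Fin 3 → ℂ) : chainBoundary ρ k (chainTensor ρ c v) =
      chainTensor ρ (c.sum fun p n => n • leftTranslate p.1 (blockBd k p.2)) v :=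
  block.boundary_tensor (Ad.comp ρ) (k := k) c v

theorem chainBoundary_chainBoundary (k : ℕ) (x : BlockChain (k + 2)) :
    chainBoundary ρ k (chainBoundary ρ (k + 1) x) = 0 :=
  block.boundary_boundary (Ad.comp ρ) k x

/-- The chain `v ⊗ f` for the face `f` of the ball `(1, ε)`. -/
def ballChain {k : ℕ} (ε : Bool) (f : Face k) (v : Fin 3 → ℂ) : BlockChain k :=
  chainTensor ρ (Finsupp.single (place ε f) 1) v

theorem ballChain_eq {k : ℕ} (ε : Bool) (f : Face k) (v : Fin 3 → ℂ) :
    ballChain ρ ε f v = Pi.single (place ε f).2 (act ρ (place ε f).1 *ᵥ v) := by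
  rw [ballChain, chainTensor_single, one_smul]

theorem ballChain_cell {k : ℕ} (c : BlockCell k) (v : Fin 3 → ℂ) :
    ballChain ρ c.1.1 c.1.2 v = Pi.single c v := by
  rw [ballChain_eq, place_self, act_one, Matrix.one_mulVec]

/-- Inside a single ball the boundary is untwisted: the coefficient `v` is carried unchanged to all
faces. The representation enters only when a glued face of the ball `(1, false)` is rewritten
through its chosen lift. -/
theorem boundary_ballChain {k : ℕ} (ε : Bool) (f : Face (k + 1)) (v : Fin 3 → ℂ) :
    chainBoundary ρ k (ballChain ρ ε f v) =
      ∑ g : Face k, incidence f.1 g.1 • ballChain ρ ε g v := by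
  rw [ballChain, chainBoundary_chainTensor, Finsupp.sum_single_index (by simp), one_smul,
    leftTranslate_blockBd_place, chainTensor_sum]
  refine Finset.sum_congr rfl fun g _ => ?_
  rw [ballChain, chainTensor_single, chainTensor_single, one_smul]

theorem ballChain_apply {k : ℕ} (ε : Bool) (f : Face k) (v : Fin 3 → ℂ)
    (c : BlockCell k) : ballChain ρ ε f v c =
      if side ε f.1 = c.1.1 ∧ f = c.1.2 then act ρ (place ε f).1 *ᵥ v else 0 := by
  rw [ballChain_eq]
  split_ifs with h
  · have h1 : (place ε f).2 = c := by
      apply Subtype.ext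
      rw [place_face]
      exact Prod.ext h.1 h.2
    rw [h1, Pi.single_eq_same]
  · rw [Pi.single_eq_of_ne]
    rintro rfl
    apply h
    rw [place_face]
    exact ⟨rfl, rfl⟩

theorem boundary_ballChain_apply {k : ℕ} (ε : Bool) (f : Face (k + 1)) (v : Fin 3 → ℂ)
    (c : BlockCell k) : chainBoundary ρ k (ballChain ρ ε f v) c =
      if side ε c.1.2.1 = c.1.1 then
        incidence f.1 c.1.2.1 • (act ρ (place ε c.1.2).1 *ᵥ v) else 0 := by
  rw [boundary_ballChain, Finset.sum_apply, Finset.sum_eq_single c.1.2]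
  · rw [Pi.smul_apply, ballChain_apply]
    split_ifs <;> simp_all
  · intro g _ hg
    rw [Pi.smul_apply, ballChain_apply, if_neg fun h => hg h.2, smul_zero]
  · simp

/-! ### The augmentation and the cocycles dual to the critical edges -/

/-- The sum of the coefficients of a chain of vertices. -/
def augmentation : BlockChain 0 →ₗ[ℂ] (Fin 3 → ℂ) := ∑ c, LinearMap.proj c

theorem augmentation_single (c : BlockCell 0) (v : Fin 3 → ℂ) :
    augmentation (Pi.single c v) = v := by
  rw [augmentation, LinearMap.sum_apply, Finset.sum_eq_single c]
  · simp
  · intro c' _ h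
    simp [h]
  · simp

theorem vertex_bijective (w : Face 0) : Function.Bijective w.1 := by
  have hs : Function.Surjective w.1 := fun i => (w.2 i).2 (by omega)
  exact ⟨Finite.injective_iff_surjective.2 hs, hs⟩

theorem augmentation_ballChain_true (w : Face 0) (v : Fin 3 → ℂ) :
    augmentation (ballChain ρ true w v) = v := by
  obtain ⟨j, hj⟩ := (vertex_bijective w).2 0
  have hg : InGlued j w.1 := fun a =>
    ⟨fun h => (vertex_bijective w).1 (h.trans hj.symm), fun h => h ▸ hj⟩
  rw [ballChain_eq, augmentation_single, place_of_inGlued _ _ hg, if_pos rfl, act_one,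
    Matrix.one_mulVec]

/-- A vertex lies in exactly one glued facet, that of its element of level 0. Its chosen lift
belongs to `(1, true)`, and the ball `(1, false)` contains the translate by `(crossing j)⁻¹`. -/
theorem augmentation_ballChain_false (w : Face 0) (v : Fin 3 → ℂ) :
    augmentation (ballChain ρ false w v) =
      ∑ j, if w.1 j = 0 then act ρ (crossing j)⁻¹ *ᵥ v else 0 := by
  obtain ⟨j, hj⟩ := (vertex_bijective w).2 0
  have hg : InGlued j w.1 := fun a =>
    ⟨fun h => (vertex_bijective w).1 (h.trans hj.symm), fun h => h ▸ hj⟩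
  rw [ballChain_eq, augmentation_single, place_of_inGlued _ _ hg, Finset.sum_eq_single j]
  · simp [hj]
  · intro i _ hi
    rw [if_neg fun h => hi ((hg i).1 h)]
  · simp

theorem augmentation_boundary_true (f : Face 1) (v : Fin 3 → ℂ) :
    augmentation (chainBoundary ρ 0 (ballChain ρ true f v)) = 0 := by
  rw [boundary_ballChain, map_sum]
  simp only [map_zsmul, augmentation_ballChain_true]
  rw [← Finset.sum_smul, sum_incidence_edge _ f.2, zero_smul]

theorem augmentation_boundary_false (f : Face 1) (v : Fin 3 → ℂ) :
    augmentation (chainBoundary ρ 0 (ballChain ρ false f v)) =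
      ∑ j, endpointCount j f.1 • (act ρ (crossing j)⁻¹ *ᵥ v) := by
  rw [boundary_ballChain, map_sum]
  simp only [map_zsmul, augmentation_ballChain_false, endpointCount, Finset.smul_sum,
    Finset.sum_smul]
  rw [Finset.sum_comm]
  refine Finset.sum_congr rfl fun j _ => Finset.sum_congr rfl fun w _ => ?_
  split_ifs <;> simp

/-- Both ends of such an edge lie in the same facet `G_j`, so they cancel when `a = j` and neither
is counted otherwise. -/
theorem endpointCount_of_inGlued (f : Face 1) {j : Fin 4} (hj : InGlued j f.1) (a : Fin 4) :
    endpointCount a f.1 = 0 := by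
  have h : endpointCount a f.1 = ∑ w : Face 0, if a = j then incidence f.1 w.1 else 0 := by
    refine Finset.sum_congr rfl fun w _ => ?_
    by_cases h0 : incidence f.1 w.1 = 0
    · simp [h0]
    · simp only [inGlued_of_incidence f w hj h0 a]
  rw [h]
  split_ifs
  · exact sum_incidence_edge _ f.2
  · simp

/-- The count is the coboundary of the indicator function of the vertices in `G_a`, and hence a
cocycle on the ball. -/
theorem sum_incidence_mul_endpointCount (u : Face 2) (a : Fin 4) :
    ∑ g : Face 1, incidence u.1 g.1 * endpointCount a g.1 = 0 := by
  simp only [endpointCount, Finset.mul_sum]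
  rw [Finset.sum_comm]
  refine Finset.sum_eq_zero fun w _ => ?_
  split_ifs
  · exact incidence_sq u w
  · simp

/-- The edges in the copy `false`, counted with their signed number of end points in `G_a`. -/
def edgeCocycle (a : Fin 4) : BlockChain 1 →ₗ[ℂ] (Fin 3 → ℂ) :=
  ∑ c : BlockCell 1, (if c.1.1 then 0 else endpointCount a c.1.2.1) • LinearMap.proj c

theorem edgeCocycle_single (a : Fin 4) (c : BlockCell 1) (v : Fin 3 → ℂ) :
    edgeCocycle a (Pi.single c v) =
      (if c.1.1 then 0 else endpointCount a c.1.2.1) • v := by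
  rw [edgeCocycle, LinearMap.sum_apply, Finset.sum_eq_single c]
  · rw [LinearMap.smul_apply, LinearMap.proj_apply, Pi.single_eq_same]
  · intro c' _ h
    rw [LinearMap.smul_apply, LinearMap.proj_apply, Pi.single_eq_of_ne h, smul_zero]
  · simp

/-- Glued edges of the ball `(1, false)` are listed in the copy `true`, where the cocycle is zero;
this is consistent because their count vanishes. So no twisting appears. -/
theorem edgeCocycle_ballChain (a : Fin 4) (ε : Bool) (g : Face 1) (v : Fin 3 → ℂ) :
    edgeCocycle a (ballChain ρ ε g v) = (if ε then 0 else endpointCount a g.1) • v := by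
  rw [ballChain_eq, edgeCocycle_single, place_face]
  by_cases h : ∃ j, InGlued j g.1
  · obtain ⟨j, hj⟩ := h
    simp [endpointCount_of_inGlued g hj]
  · rw [place, dif_neg h, act_one, Matrix.one_mulVec, side]
    simp [h]

theorem edgeCocycle_boundary (a : Fin 4) (ε : Bool) (u : Face 2) (v : Fin 3 → ℂ) :
    edgeCocycle a (chainBoundary ρ 1 (ballChain ρ ε u v)) = 0 := by
  rw [boundary_ballChain, map_sum]
  simp only [map_zsmul, edgeCocycle_ballChain]
  cases ε
  · simp only [Bool.false_eq_true, if_false, smul_smul]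
    rw [← Finset.sum_smul, sum_incidence_mul_endpointCount, zero_smul]
  · simp

end Chains

end DBlock
end

/-! ### The adapted family of chains given by the matching. -/

noncomputable section

namespace DBlock

open ReidemeisterTorsion

/-- The cells that are matched with a cell of dimension one less. -/
abbrev Source (k : ℕ) : Type := {c : BlockCell k // IsSource c.1.1 c.1.2.1}

/-- The unmatched cells. -/
abbrev Critical (k : ℕ) : Type := {c : BlockCell k // IsCritical c.1.1 c.1.2.1}

theorem lt_four_of_source {k : ℕ} (s : Source (k + 1)) : k < 4 :=
  (Nat.lt_succ_self k).trans (lt_four_of_face s.1.1.2)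

/-- The cell matched with a source. -/
def Source.target {k : ℕ} (s : Source (k + 1)) : BlockCell k :=
  (isCell_down (lt_four_of_source s) _ _ (isCell _ s.1) s.2).1.toCell

theorem Source.target_face {k : ℕ} (s : Source (k + 1)) :
    s.target.1.2.1 = down s.1.1.1 s.1.1.2.1 := rfl

theorem Source.target_side {k : ℕ} (s : Source (k + 1)) : s.target.1.1 = s.1.1.1 := rfl

theorem Source.isTarget {k : ℕ} (s : Source (k + 1)) :
    IsTarget s.target.1.1 s.target.1.2.1 :=
  (isCell_down (lt_four_of_source s) _ _ (isCell _ s.1) s.2).2.1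

theorem Source.up_target {k : ℕ} (s : Source (k + 1)) :
    up s.target.1.1 s.target.1.2.1 = s.1.1.2.1 :=
  (isCell_down (lt_four_of_source s) _ _ (isCell _ s.1) s.2).2.2

theorem target_injective (k : ℕ) : Function.Injective (Source.target (k := k)) := by
  intro s t h
  apply Subtype.ext
  refine cell_ext ?_ ?_
  · rw [← s.target_side, h, t.target_side]
  · rw [← s.up_target, h, t.up_target]

theorem IsTarget.not_isSource {ε : Bool} {f : Fin 4 → Fin 4} (h : IsTarget ε f) :
    ¬ IsSource ε f := fun h' => h' h.1

theorem IsCritical.not_isSource {ε : Bool} {f : Fin 4 → Fin 4} (h : IsCritical ε f) :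
    ¬ IsSource ε f := fun h' => h' h.1

theorem IsTarget.not_isCritical {ε : Bool} {f : Fin 4 → Fin 4} (h : IsTarget ε f) :
    ¬ IsCritical ε f := fun h' => absurd h.2 (not_lt.2 h'.2)

theorem exists_target {k : ℕ} (c : BlockCell k) (h : IsTarget c.1.1 c.1.2.1) :
    ∃ s : Source (k + 1), s.target = c := by
  obtain ⟨h1, h2, h3⟩ := isCell_up (lt_four_of_face c.1.2) _ _ (isCell k c) h
  exact ⟨⟨h1.toCell, h2⟩, cell_ext rfl h3⟩

/-- Every cell is the target of a source, a source, or critical. -/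
def cellEquiv (k : ℕ) : (Source (k + 1) ⊕ Source k) ⊕ Critical k ≃ BlockCell k :=
  Equiv.ofBijective (Sum.elim (Sum.elim Source.target Subtype.val) Subtype.val) <| by
    constructor
    · rintro ((s | s) | s) ((t | t) | t) h <;> simp only [Sum.elim_inl, Sum.elim_inr] at h
      · rw [target_injective k h]
      · exact absurd t.2 (h ▸ s.isTarget.not_isSource)
      · exact absurd t.2 (h ▸ s.isTarget.not_isCritical)
      · exact absurd s.2 (h ▸ t.isTarget.not_isSource)
      · rw [Subtype.ext h]
      · exact absurd s.2 (h ▸ t.2.not_isSource)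
      · exact absurd s.2 (h ▸ t.isTarget.not_isCritical)
      · exact absurd t.2 (h ▸ s.2.not_isSource)
      · rw [Subtype.ext h]
    · intro c
      by_cases h1 : IsSource c.1.1 c.1.2.1
      · exact ⟨Sum.inl (Sum.inr ⟨c, h1⟩), rfl⟩
      by_cases h2 : IsTarget c.1.1 c.1.2.1
      · obtain ⟨s, hs⟩ := exists_target c h2
        exact ⟨Sum.inl (Sum.inl s), hs⟩
      · refine ⟨Sum.inr ⟨c, not_not.1 h1, ?_⟩, rfl⟩
        exact not_lt.1 fun h => h2 ⟨not_not.1 h1, h⟩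

/-- The additional lifts in degree one. -/
abbrev Extra : ℕ → Type
  | 1 => Fin 3
  | _ => Empty

instance : ∀ k, Fintype (Extra k)
  | 0 => inferInstanceAs (Fintype Empty)
  | 1 => inferInstanceAs (Fintype (Fin 3))
  | _ + 2 => inferInstanceAs (Fintype Empty)

instance : ∀ k, Fintype (BasisIndex k)
  | 0 => inferInstanceAs (Fintype Empty)
  | 1 => inferInstanceAs (Fintype EdgePair)
  | _ + 2 => inferInstanceAs (Fintype Empty)

/-- The indices of the lifts in the splitting of the twisted complex. -/
abbrev LiftIndex (k : ℕ) : Type := (Source k × Fin 3) ⊕ Extra k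

instance : IsEmpty (Source 0) := ⟨fun s => not_isSource_zero _ _ (isCell 0 s.1) s.2⟩

instance : IsEmpty (LiftIndex 0) := inferInstanceAs (IsEmpty (_ ⊕ Empty))

instance : IsEmpty (LiftIndex 4) := by
  have : IsEmpty (Source 4) := ⟨fun s => absurd (lt_four_of_face s.1.1.2) (by decide)⟩
  exact inferInstanceAs (IsEmpty (_ ⊕ Empty))

/-- The critical vertex. -/
def criticalVertex : Critical 0 :=
  ⟨IsCell.toCell (k := 0) (ε := true) (f := id) (by decide +kernel),
    ((isCritical_iff (by decide) _ _ (by decide +kernel)).2 (Or.inl ⟨rfl, rfl, rfl⟩))⟩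

theorem isCell_criticalEdge : ∀ a, IsCell 1 false (criticalEdge a) := by decide +kernel

/-- The critical edges. -/
def criticalEdgeCell (a : Fin 3) : Critical 1 :=
  ⟨(isCell_criticalEdge a).toCell, ((isCritical_iff (by decide) _ _ (isCell_criticalEdge a)).2
    (Or.inr ⟨rfl, rfl, a, rfl⟩))⟩

theorem criticalEdge_injective : Function.Injective criticalEdge := by decide +kernel

def criticalZeroEquiv : Unit ≃ Critical 0 :=
  Equiv.ofBijective (fun _ => criticalVertex) <| by
    refine ⟨fun _ _ _ => rfl, fun c => ⟨(), ?_⟩⟩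
    rcases (isCritical_iff (by decide) _ _ (isCell 0 c.1)).1 c.2 with ⟨-, h1, h2⟩ | ⟨h, -⟩
    · exact Subtype.ext (cell_ext h1.symm h2.symm)
    · exact absurd h (by decide)

def criticalOneEquiv : Fin 3 ≃ Critical 1 :=
  Equiv.ofBijective criticalEdgeCell <| by
    refine ⟨fun a b h => ?_, fun c => ?_⟩
    · apply criticalEdge_injective
      have := congrArg (fun c : Critical 1 => c.1.1.2.1) h
      exact this
    · rcases (isCritical_iff (by decide) _ _ (isCell 1 c.1)).1 c.2 with ⟨h, -⟩ | ⟨-, h1, a, h2⟩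
      · exact absurd h (by decide)
      · exact ⟨a, Subtype.ext (cell_ext h1.symm h2.symm)⟩

theorem isEmpty_critical (k : ℕ) : IsEmpty (Critical (k + 2)) := by
  refine ⟨fun c => ?_⟩
  rcases (isCritical_iff (lt_four_of_face c.1.1.2) _ _ (isCell _ c.1)).1 c.2 with ⟨h, -⟩ | ⟨h, -⟩
  · omega
  · omega

/-- The additional lifts and the homology classes, distributed over the critical edges. -/
def slot : Fin 3 ⊕ EdgePair → Fin 3 × Fin 3
  | Sum.inl 0 => (0, 1)
  | Sum.inl 1 => (0, 2)
  | Sum.inl 2 => (1, 2)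
  | Sum.inr p => if p.1.2 = 3 then (⟨p.1.1.val, by have := p.2; omega⟩, 0) else
      if p.1.1 = 1 then (2, 2) else if p.1.2 = 1 then (1, 1) else (2, 1)

theorem slot_bijective : Function.Bijective slot := by decide +kernel

/-- Over the critical vertex sit the boundaries of the three extra lifts; over the three critical
edges sit the extra lifts and the six loops, distributed by `slot`. -/
def criticalEquiv : ∀ k, (Extra (k + 1) ⊕ Extra k) ⊕ BasisIndex k ≃ Critical k × Fin 3
  | 0 => ((Equiv.sumEmpty (Fin 3 ⊕ Empty) Empty).trans (Equiv.sumEmpty (Fin 3) Empty)).trans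
      ((Equiv.uniqueProd (Fin 3) Unit).symm.trans (criticalZeroEquiv.prodCongr (Equiv.refl _)))
  | 1 => ((Equiv.emptySum Empty (Fin 3)).sumCongr (Equiv.refl EdgePair)).trans
      ((Equiv.ofBijective slot slot_bijective).trans (criticalOneEquiv.prodCongr (Equiv.refl _)))
  | k + 2 =>
    haveI := isEmpty_critical k
    haveI : IsEmpty ((Extra (k + 2 + 1) ⊕ Extra (k + 2)) ⊕ BasisIndex (k + 2)) :=
      inferInstanceAs (IsEmpty ((Empty ⊕ Empty) ⊕ Empty))
    Equiv.equivOfIsEmpty _ _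

/-- The boundary of a source is assigned to its target and a source to itself. With this bookkeeping
the determinants become block triangular. -/
def indexEquiv (k : ℕ) :
    (LiftIndex (k + 1) ⊕ LiftIndex k) ⊕ BasisIndex k ≃ Σ _ : BlockCell k, Fin 3 :=
  ((Equiv.sumSumSumComm _ _ _ _).sumCongr (Equiv.refl _)).trans <|
  (Equiv.sumAssoc _ _ _).trans <|
  ((Equiv.sumProdDistrib _ _ _).symm.sumCongr (criticalEquiv k)).trans <|
  (Equiv.sumProdDistrib _ _ _).symm.trans <|
  ((cellEquiv k).prodCongr (Equiv.refl _)).trans (Equiv.sigmaEquivProd _ _).symm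

theorem indexEquiv_target {k : ℕ} (s : Source (k + 1)) (r : Fin 3) :
    indexEquiv k (Sum.inl (Sum.inl (Sum.inl (s, r)))) = ⟨s.target, r⟩ := rfl

theorem indexEquiv_source {k : ℕ} (s : Source k) (r : Fin 3) :
    indexEquiv k (Sum.inl (Sum.inr (Sum.inl (s, r)))) = ⟨s.1, r⟩ := rfl

theorem indexEquiv_zero (i : Fin 3) :
    indexEquiv 0 (Sum.inl (Sum.inl (Sum.inr i))) = ⟨criticalVertex.1, i⟩ := rfl

theorem indexEquiv_one_extra (i : Fin 3) :
    indexEquiv 1 (Sum.inl (Sum.inr (Sum.inr i))) =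
      ⟨(criticalEdgeCell (slot (Sum.inl i)).1).1, (slot (Sum.inl i)).2⟩ := rfl

theorem indexEquiv_one_pair (p : EdgePair) :
    indexEquiv 1 (Sum.inr p) =
      ⟨(criticalEdgeCell (slot (Sum.inr p)).1).1, (slot (Sum.inr p)).2⟩ := rfl

section Splitting

variable (ρ : FreeGroup (Fin 3) →* Matrix.SpecialLinearGroup (Fin 2) ℂ)
  (I : EdgePair → Fin 3 → ℂ)

/-- The vector `I p`, transported to the copy `false` of the ball. -/
def transported (p : EdgePair) : Fin 3 → ℂ := act ρ (crossing p.1.1) *ᵥ I p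

/-- The edges of the face opposite to `G_3`. -/
def basePair : Fin 3 → EdgePair
  | 0 => ⟨(0, 1), by decide⟩
  | 1 => ⟨(0, 2), by decide⟩
  | 2 => ⟨(1, 2), by decide⟩

/-- The chains over the critical edges whose boundaries must fill the fibre over the critical
vertex. Using the transported vectors of the loops as coefficients makes both determinants
expressible by the same vectors. -/
def extraLift : ∀ k, Extra k → BlockChain k
  | 0, e => e.elim
  | 1, i => Pi.single (criticalEdgeCell (slot (Sum.inl i)).1).1 (transported ρ I (basePair i))
  | _ + 2, e => e.elim

def loopChain (p : EdgePair) : BlockChain 1 := chainTensor ρ (loopLift p) (I p)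

theorem loopChain_eq (p : EdgePair) : loopChain ρ I p =
    ballChain ρ true (parallelEdge p) (I p) -
      ballChain ρ false (parallelEdge p) (transported ρ I p) := by
  rw [loopChain, loopLift, sub_eq_add_neg, chainTensor_add, sub_eq_add_neg]
  congr 1
  rw [show -leftTranslate (crossing p.1.1) (Finsupp.single (place false (parallelEdge p)) 1) =
    leftTranslate (crossing p.1.1) (Finsupp.single (place false (parallelEdge p)) (-1)) by
      rw [leftTranslate, leftTranslate, Finsupp.mapDomain_single, Finsupp.mapDomain_single,
        Finsupp.single_neg],
    chainTensor_leftTranslate, chainTensor_single, ballChain, chainTensor_single, transported]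
  simp

variable (hI : ∀ p, act ρ (loop p) *ᵥ I p = I p)

theorem act_inv_transported (p : EdgePair) :
    act ρ (crossing p.1.1)⁻¹ *ᵥ transported ρ I p = I p := by
  rw [transported, Matrix.mulVec_mulVec, act_inv_mul, Matrix.one_mulVec]

include hI in
-- Going through `G_j` and back through `G_k` is the loop itself, so this is the invariance of `I
-- p`; the version for `G_j` holds for every vector.
theorem act_inv_transported' (p : EdgePair) :
    act ρ (crossing p.1.2)⁻¹ *ᵥ transported ρ I p = I p := by
  rw [transported, Matrix.mulVec_mulVec, ← act_mul]
  exact hI p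

theorem vertex_of_parallelEdge (p : EdgePair) (w : Face 0) {j : Fin 4} (hj : w.1 j = 0)
    (h : incidence (parallelEdge p).1 w.1 ≠ 0) : j = p.1.1 ∨ j = p.1.2 := by
  obtain ⟨i, hi⟩ := exists_of_incidence_ne_zero h
  have h1 : (parallelEdge p).1 j = 0 := by
    rw [hi]
    simp [hj, merge]
  by_contra hcon
  simp only [parallelEdge, if_neg hcon] at h1
  split_ifs at h1 <;> exact absurd h1 (by decide)

include hI in
-- The two halves of the loop cancel at the end in `G_j` by the definition of the transport, and at
-- the end in `G_k` because `I p` is invariant.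
theorem chainBoundary_loopChain (p : EdgePair) : chainBoundary ρ 0 (loopChain ρ I p) = 0 := by
  rw [loopChain_eq, map_sub, boundary_ballChain, boundary_ballChain, ← Finset.sum_sub_distrib]
  refine Finset.sum_eq_zero fun w _ => ?_
  by_cases h : incidence (parallelEdge p).1 w.1 = 0
  · simp [h]
  obtain ⟨j, hj⟩ := (vertex_bijective w).2 0
  have hg : InGlued j w.1 := fun a =>
    ⟨fun h => (vertex_bijective w).1 (h.trans hj.symm), fun h => h ▸ hj⟩
  rw [ballChain_eq, ballChain_eq, place_of_inGlued _ _ hg, place_of_inGlued _ _ hg, ← smul_sub]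
  simp only [if_true, Bool.false_eq_true, if_false, act_one, Matrix.one_mulVec]
  rcases vertex_of_parallelEdge p w hj h with rfl | rfl
  · rw [act_inv_transported, sub_self, smul_zero]
  · rw [act_inv_transported' ρ I hI, sub_self, smul_zero]

/-- The splitting of the twisted complex of the block. -/
def blockSplitting : Splitting (chainBoundary ρ) LiftIndex BasisIndex where
  lift k := Sum.elim (fun x => Pi.single x.1.1 (Pi.single x.2 1)) (extraLift ρ I k)
  cyc
    | 0, e => e.elim
    | 1, p => loopChain ρ I p
    | _ + 2, e => e.elim
  cyc_mem
    | 0, e => e.elim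
    | 1, p => chainBoundary_loopChain ρ I hI p
    | _ + 2, e => e.elim

/-- The family of chains given by the splitting, indexed by the cells. -/
def blockFamily (k : ℕ) : (Σ _ : BlockCell k, Fin 3) → BlockChain k :=
  (blockSplitting ρ I hI).family k ∘ (indexEquiv k).symm

theorem blockFamily_target {k : ℕ} (s : Source (k + 1)) (r : Fin 3) :
    blockFamily ρ I hI k ⟨s.target, r⟩ =
      chainBoundary ρ k (ballChain ρ s.1.1.1 s.1.1.2 (Pi.single r 1)) := by
  rw [blockFamily, ← indexEquiv_target, Function.comp_apply, Equiv.symm_apply_apply,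
    ballChain_cell]
  rfl

theorem blockFamily_source {k : ℕ} (s : Source k) (r : Fin 3) :
    blockFamily ρ I hI k ⟨s.1, r⟩ = Pi.single s.1 (Pi.single r 1) := by
  rw [blockFamily, ← indexEquiv_source, Function.comp_apply, Equiv.symm_apply_apply]
  rfl

theorem blockFamily_zero (i : Fin 3) :
    blockFamily ρ I hI 0 ⟨criticalVertex.1, i⟩ = chainBoundary ρ 0
      (Pi.single (criticalEdgeCell (slot (Sum.inl i)).1).1 (transported ρ I (basePair i))) := by
  rw [blockFamily, ← indexEquiv_zero, Function.comp_apply, Equiv.symm_apply_apply]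
  rfl

theorem blockFamily_extra (i : Fin 3) :
    blockFamily ρ I hI 1 ⟨(criticalEdgeCell (slot (Sum.inl i)).1).1, (slot (Sum.inl i)).2⟩ =
      Pi.single (criticalEdgeCell (slot (Sum.inl i)).1).1 (transported ρ I (basePair i)) := by
  rw [blockFamily, ← indexEquiv_one_extra, Function.comp_apply, Equiv.symm_apply_apply]
  rfl

theorem blockFamily_pair (p : EdgePair) :
    blockFamily ρ I hI 1 ⟨(criticalEdgeCell (slot (Sum.inr p)).1).1, (slot (Sum.inr p)).2⟩ =
      loopChain ρ I p := by
  rw [blockFamily, ← indexEquiv_one_pair, Function.comp_apply, Equiv.symm_apply_apply]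
  rfl

end Splitting

end DBlock
end

/-! ### Determinants of the adapted family in each degree. -/

noncomputable section

namespace DBlock

open ReidemeisterTorsion

def cellHeight {k : ℕ} (c : BlockCell k) : ℕ := height c.1.1 c.1.2.1

theorem cell_cases {k : ℕ} (c : BlockCell k) : (∃ s : Source (k + 1), c = s.target) ∨
    (∃ s : Source k, c = s.1) ∨ IsCritical c.1.1 c.1.2.1 := by
  obtain ⟨(s | s) | s, rfl⟩ := (cellEquiv k).surjective c
  · exact Or.inl ⟨s, rfl⟩
  · exact Or.inr (Or.inl ⟨s, rfl⟩)
  · exact Or.inr (Or.inr s.2)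

section Determinants

variable (ρ : FreeGroup (Fin 3) →* Matrix.SpecialLinearGroup (Fin 2) ℂ)
  (I : EdgePair → Fin 3 → ℂ) (hI : ∀ p, act ρ (loop p) *ᵥ I p = I p)

/-- Triangularity with respect to the height: the boundary of a source contains, besides critical
cells and its partner, only cells lower than the partner. -/
theorem blockFamily_apply_eq_zero {k : ℕ} {c c' : BlockCell k}
    (hc : ¬ IsCritical c.1.1 c.1.2.1) (hc' : ¬ IsCritical c'.1.1 c'.1.2.1) (r : Fin 3)
    (hne : c ≠ c') (h : ¬ cellHeight c < cellHeight c') :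
    blockFamily ρ I hI k ⟨c', r⟩ c = 0 := by
  rcases cell_cases c' with ⟨s, rfl⟩ | ⟨s, rfl⟩ | hcr
  · rw [blockFamily_target, boundary_ballChain_apply]
    split_ifs with h1
    · by_cases h2 : incidence s.1.1.2.1 c.1.2.1 = 0
      · rw [h2, zero_smul]
      exfalso
      obtain ⟨i, hi⟩ := exists_of_incidence_ne_zero h2
      have h3 := height_lt (lt_four_of_source s) s.1.1.1 c.1.2.1 i (isCell_side _ c.1.2)
        (hi ▸ isCell _ s.1) (hi ▸ s.2)
      rw [← hi, h1] at h3
      rcases h3 with ⟨h3, h4⟩ | h3 | h3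
      · exact hne (cell_ext h3 h4)
      · exact h h3
      · exact hc h3
    · rfl
  · rw [blockFamily_source, Pi.single_eq_of_ne hne]
  · exact absurd hcr hc'

theorem det_blockFamily_diag {k : ℕ} {c : BlockCell k} (hc : ¬ IsCritical c.1.1 c.1.2.1) :
    (Matrix.of fun q r => blockFamily ρ I hI k ⟨c, r⟩ c q).det = 1 ∨
      (Matrix.of fun q r => blockFamily ρ I hI k ⟨c, r⟩ c q).det = -1 := by
  rcases cell_cases c with ⟨s, rfl⟩ | ⟨s, rfl⟩ | hcr
  · have h : (Matrix.of fun q r => blockFamily ρ I hI k ⟨s.target, r⟩ s.target q) =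
        (incidence s.1.1.2.1 s.target.1.2.1 : ℂ) • (1 : Matrix (Fin 3) (Fin 3) ℂ) := by
      ext q r
      have h1 : side s.1.1.1 s.target.1.2.1 = s.target.1.1 := by
        rw [← s.target_side]
        have := place_face s.target.1.1 s.target.1.2
        rw [place_self] at this
        exact (congrArg Prod.fst this).symm
      rw [Matrix.of_apply, blockFamily_target, boundary_ballChain_apply, if_pos h1,
        ← s.target_side, place_self, act_one, Matrix.one_mulVec]
      simp [Matrix.one_apply, Pi.single_apply]
    rw [h, Matrix.det_smul, Matrix.det_one]
    rcases incidence_down (lt_four_of_source s) _ _ (isCell _ s.1) s.2 with h2 | h2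
    · left
      rw [s.target_face, h2]
      simp
    · right
      rw [s.target_face, h2]
      norm_num
  · left
    convert Matrix.det_one (n := Fin 3) (R := ℂ) using 2
    ext q r
    rw [Matrix.of_apply, blockFamily_source]
    simp [Matrix.one_apply, Pi.single_apply]
  · exact absurd hcr hc

theorem det_blockFamily_of_two_le (k : ℕ) :
    (Pi.basis fun _ : BlockCell (k + 2) => Pi.basisFun ℂ (Fin 3)).det
        (blockFamily ρ I hI (k + 2)) = 1 ∨
      (Pi.basis fun _ : BlockCell (k + 2) => Pi.basisFun ℂ (Fin 3)).det
        (blockFamily ρ I hI (k + 2)) = -1 := by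
  have hc : ∀ c : BlockCell (k + 2), ¬ IsCritical c.1.1 c.1.2.1 := fun c h =>
    (isEmpty_critical k).false ⟨c, h⟩
  rw [det_stdBasis_eq_prod (blockFamily ρ I hI (k + 2)) (fun c => LinearMap.proj c) cellHeight
    (fun _ => False) (fun _ _ _ => rfl) (fun _ _ _ h => h.elim)
    (fun c c' r hne h => blockFamily_apply_eq_zero ρ I hI (hc c) (hc c') r hne h)]
  simpa using prod_eq_or_neg (fun c => (Matrix.of fun q r =>
    blockFamily ρ I hI (k + 2) ⟨c, r⟩ c q).det) ∅ (fun c _ => det_blockFamily_diag ρ I hI (hc c))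

/-- A noncritical vertex is the target of an edge in the copy `true`, and the two ends of such an
edge carry opposite coefficients without twisting. -/
theorem augmentation_blockFamily {c : BlockCell 0} (hc : ¬ IsCritical c.1.1 c.1.2.1) (r : Fin 3) :
    augmentation (blockFamily ρ I hI 0 ⟨c, r⟩) = 0 := by
  rcases cell_cases c with ⟨s, rfl⟩ | ⟨s, -⟩ | hcr
  · rw [blockFamily_target, show s.1.1.1 = true from ?_, augmentation_boundary_true]
    by_contra h
    rw [Bool.not_eq_true] at h
    have h1 := isCell _ s.1
    have h2 := s.2
    rw [h] at h1 h2
    exact not_isSource_one _ h1 h2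
  · exact isEmptyElim s
  · exact absurd hcr hc

theorem height_lt_of_not_isCritical {ε : Bool} {f : Fin 4 → Fin 4} (h : ¬ IsCritical ε f) :
    height ε f < 1000 := by
  simp only [height, if_neg h]
  have h1 := (f 3).isLt
  have h2 := (f (pivot ε f)).isLt
  split_ifs <;> omega

theorem le_height_of_isCritical {ε : Bool} {f : Fin 4 → Fin 4} (h : IsCritical ε f) :
    1000 ≤ height ε f := by
  unfold height
  rw [if_neg h.not_isSource, if_pos h]
  generalize 1000 = n
  exact Nat.le_add_right n _

theorem crossing_three : crossing 3 = 1 := rfl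

/-- The end in `G_a` is twisted by `(crossing a)⁻¹`. The end in `G_3` is not twisted, since
`crossing 3` is trivial. -/
theorem augmentation_criticalEdge (a : Fin 3) (v : Fin 3 → ℂ) :
    augmentation (chainBoundary ρ 0 (Pi.single (criticalEdgeCell a).1 v)) =
      act ρ (crossing a.castSucc)⁻¹ *ᵥ v - v := by
  rw [← ballChain_cell ρ, show (criticalEdgeCell a).1.1.1 = false from rfl,
    augmentation_boundary_false]
  have h : ∀ j, endpointCount j (criticalEdgeCell a).1.1.2.1 =
      if j = a.castSucc then 1 else if j = 3 then -1 else 0 :=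
    endpointCount_parallelEdge ⟨(a.castSucc, 3), Fin.castSucc_lt_last a⟩
  simp only [h]
  rw [Fin.sum_univ_castSucc, Finset.sum_eq_single a]
  · have h1 : Fin.last 3 ≠ a.castSucc := (Fin.castSucc_lt_last a).ne'
    rw [if_pos rfl, if_neg h1, show Fin.last 3 = 3 from rfl, if_pos rfl, crossing_three, inv_one,
      act_one, Matrix.one_mulVec]
    simp [sub_eq_add_neg]
  · intro b _ hb
    have h1 : b.castSucc ≠ 3 := (Fin.castSucc_lt_last b).ne
    rw [if_neg (fun h => hb (Fin.castSucc_injective _ h)), if_neg h1, zero_smul]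
  · simp

/-- The triple product of three vectors. -/
def tripleProduct (a b c : Fin 3 → ℂ) : ℂ := (Matrix.of ![a, b, c]).det

theorem det_columns (w : Fin 3 → Fin 3 → ℂ) :
    (Matrix.of fun q r => w r q).det = tripleProduct (w 0) (w 1) (w 2) := by
  rw [tripleProduct, ← Matrix.det_transpose]
  congr 1
  ext q r
  fin_cases q <;> rfl

/-- The coordinate at the critical vertex is replaced by the augmentation, which kills the family at
all other vertices. The only block that is not `±1` then consists of the augmented boundaries of the
extra lifts. -/
theorem det_blockFamily_zero :
    (Pi.basis fun _ : BlockCell 0 => Pi.basisFun ℂ (Fin 3)).det (blockFamily ρ I hI 0) =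
        tripleProduct (I (basePair 0) - transported ρ I (basePair 0))
          (I (basePair 1) - transported ρ I (basePair 1))
          (I (basePair 2) - transported ρ I (basePair 2)) ∨
      (Pi.basis fun _ : BlockCell 0 => Pi.basisFun ℂ (Fin 3)).det (blockFamily ρ I hI 0) =
        -tripleProduct (I (basePair 0) - transported ρ I (basePair 0))
          (I (basePair 1) - transported ρ I (basePair 1))
          (I (basePair 2) - transported ρ I (basePair 2)) := by
  classical
  have hcrit : ∀ c : BlockCell 0, IsCritical c.1.1 c.1.2.1 → c = criticalVertex.1 := by
    intro c hc
    obtain ⟨_, h⟩ := criticalZeroEquiv.surjective ⟨c, hc⟩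
    exact (congrArg Subtype.val h).symm
  -- The extra lift `i` sits on the critical edge of the smaller index of `basePair i`, so its first
  -- end undoes the transport.
  have hinv : ∀ i, act ρ (crossing (slot (Sum.inl i)).1.castSucc)⁻¹ *ᵥ
      transported ρ I (basePair i) = I (basePair i) := by
    intro i
    have := act_inv_transported ρ I (basePair i)
    fin_cases i <;> exact this
  let ψ : BlockCell 0 → BlockChain 0 →ₗ[ℂ] (Fin 3 → ℂ) := fun c =>
    if IsCritical c.1.1 c.1.2.1 then augmentation else LinearMap.proj c
  have hpos : ∀ {c : BlockCell 0}, IsCritical c.1.1 c.1.2.1 → ψ c = augmentation :=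
    fun h => if_pos h
  have hneg : ∀ {c : BlockCell 0}, ¬ IsCritical c.1.1 c.1.2.1 → ψ c = LinearMap.proj c :=
    fun h => if_neg h
  rw [det_stdBasis_eq_prod (blockFamily ρ I hI 0) ψ cellHeight
    (fun c => IsCritical c.1.1 c.1.2.1)]
  · have h1 := prod_eq_or_neg (fun c => (Matrix.of fun q r =>
      ψ c (blockFamily ρ I hI 0 ⟨c, r⟩) q).det) {criticalVertex.1} (fun c hc => by
        have hc' : ¬ IsCritical c.1.1 c.1.2.1 := fun h =>
          hc (Finset.mem_singleton.2 (hcrit c h))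
        simp only [hneg hc']
        exact det_blockFamily_diag ρ I hI hc')
    rw [Finset.prod_singleton] at h1
    convert h1 using 2 <;> simp only [hpos criticalVertex.2, blockFamily_zero] <;>
    · rw [det_columns]
      simp only [augmentation_criticalEdge, hinv]
  · intro c hc x
    rw [hneg hc]
    rfl
  · intro c c' v hc hc'
    rw [hpos hc, augmentation_single, if_pos ((hcrit c hc).trans (hcrit c' hc').symm)]
  · intro c c' r hne h
    by_cases hc' : IsCritical c'.1.1 c'.1.2.1
    · by_cases hc : IsCritical c.1.1 c.1.2.1
      · exact absurd ((hcrit c hc).trans (hcrit c' hc').symm) hne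
      · exact absurd ((height_lt_of_not_isCritical hc).trans_le (le_height_of_isCritical hc')) h
    · by_cases hc : IsCritical c.1.1 c.1.2.1
      · rw [hpos hc, augmentation_blockFamily ρ I hI hc']
      · rw [hneg hc]
        exact blockFamily_apply_eq_zero ρ I hI hc hc' r hne h

theorem edgeCocycle_blockFamily {c : BlockCell 1} (hc : ¬ IsCritical c.1.1 c.1.2.1) (a : Fin 4)
    (r : Fin 3) : edgeCocycle a (blockFamily ρ I hI 1 ⟨c, r⟩) = 0 := by
  rcases cell_cases c with ⟨s, rfl⟩ | ⟨s, rfl⟩ | hcr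
  · rw [blockFamily_target, edgeCocycle_boundary]
  · rw [blockFamily_source, edgeCocycle_single, if_pos, zero_smul]
    by_contra h
    rw [Bool.not_eq_true] at h
    have h1 := isCell _ s.1
    have h2 := s.2
    rw [h] at h1 h2
    exact not_isSource_one _ h1 h2
  · exact absurd hcr hc

theorem edgeCocycle_loopChain (a : Fin 4) (p : EdgePair) : edgeCocycle a (loopChain ρ I p) =
    (if a = p.1.1 then -1 else if a = p.1.2 then 1 else 0 : ℤ) • transported ρ I p := by
  rw [loopChain_eq, map_sub, edgeCocycle_ballChain, edgeCocycle_ballChain, if_pos rfl,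
    if_neg (by decide), endpointCount_parallelEdge]
  split_ifs <;> simp

theorem edgeCocycle_criticalEdge (a b : Fin 3) (v : Fin 3 → ℂ) :
    edgeCocycle a.castSucc (Pi.single (criticalEdgeCell b).1 v) = if a = b then v else 0 := by
  rw [edgeCocycle_single]
  have h : endpointCount a.castSucc (criticalEdgeCell b).1.1.2.1 =
      if a.castSucc = b.castSucc then 1 else if a.castSucc = 3 then -1 else 0 :=
    endpointCount_parallelEdge ⟨(b.castSucc, 3), Fin.castSucc_lt_last b⟩ a.castSucc
  rw [if_neg (show ¬ (criticalEdgeCell b).1.1.1 = true from Bool.false_ne_true), h,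
    if_neg (show a.castSucc ≠ 3 from (Fin.castSucc_lt_last a).ne)]
  by_cases hab : a = b
  · simp [hab]
  · rw [if_neg hab, if_neg fun h => hab (Fin.castSucc_injective _ h), zero_smul]

theorem edgeCocycle_blockFamily_extra {b r i : Fin 3} (h : slot (Sum.inl i) = (b, r))
    (a : Fin 3) : edgeCocycle a.castSucc (blockFamily ρ I hI 1 ⟨(criticalEdgeCell b).1, r⟩) =
      if a = b then transported ρ I (basePair i) else 0 := by
  obtain rfl : (slot (Sum.inl i)).1 = b := by rw [h]
  obtain rfl : (slot (Sum.inl i)).2 = r := by rw [h]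
  rw [blockFamily_extra, edgeCocycle_criticalEdge]

theorem edgeCocycle_blockFamily_pair {b r : Fin 3} {p : EdgePair}
    (h : slot (Sum.inr p) = (b, r)) (a : Fin 3) :
    edgeCocycle a.castSucc (blockFamily ρ I hI 1 ⟨(criticalEdgeCell b).1, r⟩) =
      (if a.castSucc = p.1.1 then -1 else if a.castSucc = p.1.2 then 1 else 0 : ℤ) •
        transported ρ I p := by
  obtain rfl : (slot (Sum.inr p)).1 = b := by rw [h]
  obtain rfl : (slot (Sum.inr p)).2 = r := by rw [h]
  rw [blockFamily_pair, edgeCocycle_loopChain]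

/-- An extra lift is supported on its own critical edge, and a loop is placed in the slot of its
largest index below 3. Therefore no member of the family reaches a later critical edge. -/
theorem edgeCocycle_blockFamily_of_lt {a b : Fin 3} (hab : b < a) (r : Fin 3) :
    edgeCocycle a.castSucc (blockFamily ρ I hI 1 ⟨(criticalEdgeCell b).1, r⟩) = 0 := by
  obtain ⟨i | p, hx⟩ := slot_bijective.2 (b, r)
  · rw [edgeCocycle_blockFamily_extra ρ I hI hx, if_neg hab.ne']
  · rw [edgeCocycle_blockFamily_pair ρ I hI hx]
    have key : ∀ (p : EdgePair) (a : Fin 3), (slot (Sum.inr p)).1 < a →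
        (if a.castSucc = p.1.1 then -1 else if a.castSucc = p.1.2 then 1 else 0 : ℤ) = 0 := by
      decide +kernel
    rw [key p a (by rw [hx]; exact hab), zero_smul]

theorem height_criticalEdge : ∀ a : Fin 3, height false (criticalEdge a) = 1000 + a.val := by
  decide +kernel

theorem det_blockFamily_criticalEdge_zero :
    (Matrix.of fun q r => edgeCocycle (Fin.castSucc 0)
      (blockFamily ρ I hI 1 ⟨(criticalEdgeCell 0).1, r⟩) q).det =
    -tripleProduct (transported ρ I ⟨(0, 3), by decide⟩) (transported ρ I ⟨(0, 1), by decide⟩)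
      (transported ρ I ⟨(0, 2), by decide⟩) := by
  rw [det_columns, edgeCocycle_blockFamily_pair ρ I hI (b := 0) (r := 0) (p := ⟨(0, 3), by decide⟩) rfl 0,
    edgeCocycle_blockFamily_extra ρ I hI (b := 0) (r := 1) (i := 0) rfl 0,
    edgeCocycle_blockFamily_extra ρ I hI (b := 0) (r := 2) (i := 1) rfl 0]
  simp [tripleProduct, Matrix.det_fin_three, basePair]
  ring

theorem det_blockFamily_criticalEdge_one :
    (Matrix.of fun q r => edgeCocycle (Fin.castSucc 1)
      (blockFamily ρ I hI 1 ⟨(criticalEdgeCell 1).1, r⟩) q).det =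
    -tripleProduct (transported ρ I ⟨(1, 3), by decide⟩) (transported ρ I ⟨(0, 1), by decide⟩)
      (transported ρ I ⟨(1, 2), by decide⟩) := by
  rw [det_columns, edgeCocycle_blockFamily_pair ρ I hI (b := 1) (r := 0) (p := ⟨(1, 3), by decide⟩) rfl 1,
    edgeCocycle_blockFamily_pair ρ I hI (b := 1) (r := 1) (p := ⟨(0, 1), by decide⟩) rfl 1,
    edgeCocycle_blockFamily_extra ρ I hI (b := 1) (r := 2) (i := 2) rfl 1]
  simp [tripleProduct, Matrix.det_fin_three, basePair]
  ring

theorem det_blockFamily_criticalEdge_two :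
    (Matrix.of fun q r => edgeCocycle (Fin.castSucc 2)
      (blockFamily ρ I hI 1 ⟨(criticalEdgeCell 2).1, r⟩) q).det =
    -tripleProduct (transported ρ I ⟨(2, 3), by decide⟩) (transported ρ I ⟨(0, 2), by decide⟩)
      (transported ρ I ⟨(1, 2), by decide⟩) := by
  rw [det_columns, edgeCocycle_blockFamily_pair ρ I hI (b := 2) (r := 0) (p := ⟨(2, 3), by decide⟩) rfl 2,
    edgeCocycle_blockFamily_pair ρ I hI (b := 2) (r := 1) (p := ⟨(0, 2), by decide⟩) rfl 2,
    edgeCocycle_blockFamily_pair ρ I hI (b := 2) (r := 2) (p := ⟨(1, 2), by decide⟩) rfl 2]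
  simp [tripleProduct, Matrix.det_fin_three]
  ring

/-- The product of the triple products of the transported invariant vectors at the first three
facets. -/
def facetProduct : ℂ :=
  tripleProduct (transported ρ I ⟨(0, 3), by decide⟩) (transported ρ I ⟨(0, 1), by decide⟩)
      (transported ρ I ⟨(0, 2), by decide⟩) *
    tripleProduct (transported ρ I ⟨(1, 3), by decide⟩) (transported ρ I ⟨(0, 1), by decide⟩)
      (transported ρ I ⟨(1, 2), by decide⟩) *
    tripleProduct (transported ρ I ⟨(2, 3), by decide⟩) (transported ρ I ⟨(0, 2), by decide⟩)
      (transported ρ I ⟨(1, 2), by decide⟩)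

/-- At the critical edges the coordinates are replaced by the edge cocycles, which kill the family
at all other edges. What remains is block triangular for the order of the three critical edges, and
each diagonal block is a triple product of the transported vectors at one facet. -/
theorem det_blockFamily_one :
    (Pi.basis fun _ : BlockCell 1 => Pi.basisFun ℂ (Fin 3)).det (blockFamily ρ I hI 1) =
        facetProduct ρ I ∨
      (Pi.basis fun _ : BlockCell 1 => Pi.basisFun ℂ (Fin 3)).det (blockFamily ρ I hI 1) =
        -facetProduct ρ I := by
  classical
  have hcrit : ∀ c : BlockCell 1, IsCritical c.1.1 c.1.2.1 → ∃ a, c = (criticalEdgeCell a).1 := by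
    intro c hc
    obtain ⟨a, h⟩ := criticalOneEquiv.surjective ⟨c, hc⟩
    exact ⟨a, (congrArg Subtype.val h).symm⟩
  have hinj : ∀ {a b : Fin 3}, (criticalEdgeCell a).1 = (criticalEdgeCell b).1 → a = b :=
    fun h => criticalOneEquiv.injective (Subtype.ext h)
  let ψ : BlockCell 1 → BlockChain 1 →ₗ[ℂ] (Fin 3 → ℂ) := fun c =>
    if h : IsCritical c.1.1 c.1.2.1 then edgeCocycle (hcrit c h).choose.castSucc
    else LinearMap.proj c
  have hpos : ∀ a, ψ (criticalEdgeCell a).1 = edgeCocycle a.castSucc := by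
    intro a
    have h : ∃ b, (criticalEdgeCell a).1 = (criticalEdgeCell b).1 := ⟨a, rfl⟩
    have h2 : ψ (criticalEdgeCell a).1 = edgeCocycle h.choose.castSucc :=
      dif_pos (criticalEdgeCell a).2
    rw [h2, ← hinj h.choose_spec]
  have hneg : ∀ {c : BlockCell 1}, ¬ IsCritical c.1.1 c.1.2.1 → ψ c = LinearMap.proj c :=
    fun h => dif_neg h
  rw [det_stdBasis_eq_prod (blockFamily ρ I hI 1) ψ cellHeight
    (fun c => IsCritical c.1.1 c.1.2.1)]
  · have h1 := prod_eq_or_neg (fun c => (Matrix.of fun q r =>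
      ψ c (blockFamily ρ I hI 1 ⟨c, r⟩) q).det)
      (Finset.univ.image fun a => (criticalEdgeCell a).1) (fun c hc => by
        have hc' : ¬ IsCritical c.1.1 c.1.2.1 := by
          intro h
          obtain ⟨a, rfl⟩ := hcrit c h
          exact hc (Finset.mem_image_of_mem _ (Finset.mem_univ a))
        simp only [hneg hc']
        exact det_blockFamily_diag ρ I hI hc')
    rw [Finset.prod_image (fun a _ b _ h => hinj h), Fin.prod_univ_three] at h1
    simp only [hpos, det_blockFamily_criticalEdge_zero, det_blockFamily_criticalEdge_one,
      det_blockFamily_criticalEdge_two] at h1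
    rcases h1 with h1 | h1
    · right
      rw [h1, facetProduct]
      ring
    · left
      rw [h1, facetProduct]
      ring
  · intro c hc x
    rw [hneg hc]
    rfl
  · intro c c' v hc hc'
    obtain ⟨a, rfl⟩ := hcrit c hc
    obtain ⟨b, rfl⟩ := hcrit c' hc'
    rw [hpos, edgeCocycle_criticalEdge]
    by_cases hab : a = b
    · rw [if_pos hab, if_pos (by rw [hab])]
    · rw [if_neg hab, if_neg fun h => hab (hinj h)]
  · intro c c' r hne h
    by_cases hc' : IsCritical c'.1.1 c'.1.2.1
    · by_cases hc : IsCritical c.1.1 c.1.2.1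
      · obtain ⟨a, rfl⟩ := hcrit c hc
        obtain ⟨b, rfl⟩ := hcrit c' hc'
        rw [hpos, edgeCocycle_blockFamily_of_lt]
        have h2 : ¬ 1000 + a.val < 1000 + b.val := by
          rw [← height_criticalEdge, ← height_criticalEdge]
          exact h
        have h3 : a ≠ b := fun h => hne (by rw [h])
        omega
      · exact absurd ((height_lt_of_not_isCritical hc).trans_le (le_height_of_isCritical hc')) h
    · by_cases hc : IsCritical c.1.1 c.1.2.1
      · obtain ⟨a, rfl⟩ := hcrit c hc
        rw [hpos, edgeCocycle_blockFamily ρ I hI hc']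
      · rw [hneg hc]
        exact blockFamily_apply_eq_zero ρ I hI hc hc' r hne h


end Determinants

end DBlock
end

/-! ### Homology and torsion from the invariant vectors. -/

noncomputable section

namespace DBlock

open ReidemeisterTorsion

section Torsion

variable (ρ : FreeGroup (Fin 3) →* Matrix.SpecialLinearGroup (Fin 2) ℂ)
  (I : EdgePair → Fin 3 → ℂ)

/-- The triple product of the differences between the invariant vectors of the three edges opposite
to `G_3` and their transports. -/
def baseProduct : ℂ :=
  tripleProduct (I (basePair 0) - transported ρ I (basePair 0))
    (I (basePair 1) - transported ρ I (basePair 1))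
    (I (basePair 2) - transported ρ I (basePair 2))

def chainBasis (k : ℕ) : Module.Basis (Σ _ : BlockCell k, Fin 3) ℂ (BlockChain k) :=
  Pi.basis fun _ => Pi.basisFun ℂ (Fin 3)

variable (hI : ∀ p, act ρ (loop p) *ᵥ I p = I p)

theorem det_family_ne_zero (hX : facetProduct ρ I ≠ 0) (hY : baseProduct ρ I ≠ 0) (k : ℕ) :
    (chainBasis k).det ((blockSplitting ρ I hI).family k ∘ (indexEquiv k).symm) ≠ 0 := by
  change (chainBasis k).det (blockFamily ρ I hI k) ≠ 0
  match k with
  | 0 =>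
    rcases det_blockFamily_zero ρ I hI with h | h <;> rw [chainBasis, h]
    · exact hY
    · exact neg_ne_zero.2 hY
  | 1 =>
    rcases det_blockFamily_one ρ I hI with h | h <;> rw [chainBasis, h]
    · exact hX
    · exact neg_ne_zero.2 hX
  | k + 2 => rcases det_blockFamily_of_two_le ρ I hI k with h | h <;> rw [chainBasis, h] <;> simp

/-- Degrees 2 and 3 contribute `±1`, degree 1 enters with exponent `1` and degree 0 with exponent
`-1`. Squaring removes the undetermined signs. -/
theorem prod_det_family_sq :
    (∏ k ∈ Finset.range (3 + 1), (chainBasis k).det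
      ((blockSplitting ρ I hI).family k ∘ (indexEquiv k).symm) ^ ((-1 : ℤ) ^ (k + 1))) ^ 2 =
    (facetProduct ρ I / baseProduct ρ I) ^ 2 := by
  change (∏ k ∈ Finset.range (3 + 1),
    (chainBasis k).det (blockFamily ρ I hI k) ^ ((-1 : ℤ) ^ (k + 1))) ^ 2 = _
  have h0 : (chainBasis 0).det (blockFamily ρ I hI 0) ^ 2 = baseProduct ρ I ^ 2 :=
    sq_eq_sq_iff_eq_or_eq_neg.2 (det_blockFamily_zero ρ I hI)
  have h1 : (chainBasis 1).det (blockFamily ρ I hI 1) ^ 2 = facetProduct ρ I ^ 2 :=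
    sq_eq_sq_iff_eq_or_eq_neg.2 (det_blockFamily_one ρ I hI)
  have h2 : (chainBasis 2).det (blockFamily ρ I hI 2) ^ 2 = 1 := by
    rcases det_blockFamily_of_two_le ρ I hI 0 with h | h <;> rw [chainBasis, h] <;> norm_num
  have h3 : (chainBasis 3).det (blockFamily ρ I hI 3) ^ 2 = 1 := by
    rcases det_blockFamily_of_two_le ρ I hI 1 with h | h <;> rw [chainBasis, h] <;> norm_num
  simp only [Finset.prod_range_succ, Finset.prod_range_zero, one_mul]
  norm_num [mul_pow, h0, h1, h2, h3]
  rw [div_pow, div_eq_inv_mul]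

theorem Represents.apply_eq {J : EdgePair → Fin 3 → ℂ}
    {h : EdgePair → TwistedHomology ρ 1} (hJ : Represents ρ J h) (p : EdgePair)
    (hz : loopChain ρ J p ∈ cycles (chainBoundary ρ) 1) :
    h p = homologyClass (chainBoundary ρ) 1 (loopChain ρ J p) hz := by
  obtain ⟨_, h1⟩ := hJ p
  exact h1

/-- The homology and the torsion of the block in terms of the invariant vectors of the six edges. -/
theorem homology_and_torsion (hI : ∀ p, act ρ (loop p) *ᵥ I p = I p)
    (hX : facetProduct ρ I ≠ 0) (hY : baseProduct ρ I ≠ 0) :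
    (∀ k, k ≠ 1 → Subsingleton (TwistedHomology ρ k)) ∧
      (∃ h : Module.Basis EdgePair ℂ (TwistedHomology ρ 1), Represents ρ I h) ∧
      ∀ h : EdgePair → TwistedHomology ρ 1, Represents ρ I h →
        ∀ t : ℂ, t ^ 2 = (facetProduct ρ I / baseProduct ρ I) ^ 2 →
          blockTorsion ρ h = {t, -t} := by
  have hne := det_family_ne_zero ρ I hI hX hY
  obtain ⟨b, hb⟩ := (blockSplitting ρ I hI).exists_basis chainBasis
    (fun k => (indexEquiv k).symm) hne
  have hB := fun k => (blockSplitting ρ I hI).homologyBasis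
    (chainBoundary_chainBoundary ρ) b hb k
  refine ⟨fun k hk => ?_, ?_, fun h hh t ht => ?_⟩
  · have : IsEmpty (BasisIndex k) := by
      match k, hk with
      | 0, _ => exact inferInstanceAs (IsEmpty Empty)
      | k + 2, _ => exact inferInstanceAs (IsEmpty Empty)
    exact (hB k).repr.toEquiv.subsingleton
  · refine ⟨(blockSplitting ρ I hI).homologyBasis (chainBoundary_chainBoundary ρ) b hb 1,
      fun p => ⟨chainBoundary_loopChain ρ I hI p, ?_⟩⟩
    exact (blockSplitting ρ I hI).homologyBasis_apply (chainBoundary_chainBoundary ρ) b hb 1 p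
  · have : IsEmpty (LiftIndex (3 + 1)) := inferInstanceAs (IsEmpty (LiftIndex 4))
    have key := (blockSplitting ρ I hI).torsion_eq (chainBoundary_chainBoundary ρ) chainBasis
      (fun k => (indexEquiv k).symm) hne (h := inDegreeOne h) (fun k i => ?_) 3 (t := t) ?_
    · exact key
    · match k, i with
      | 0, e => exact e.elim
      | 1, p => exact Represents.apply_eq ρ hh p _
      | _ + 2, e => exact e.elim
    · rw [← prod_det_family_sq ρ I hI] at ht
      exact sq_eq_sq_iff_eq_or_eq_neg.1 ht

end Torsion

end DBlock
end

noncomputable section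

namespace DBlock

open ReidemeisterTorsion

/-! ## Invariant quadratic forms -/

/-- The binary quadratic form fixed by the transpose of `A * B.adjugate`. -/
def axis (A B : Matrix (Fin 2) (Fin 2) ℂ) : Fin 3 → ℂ :=
  ![A 1 0 * B 1 1 - A 1 1 * B 1 0,
    A 1 1 * B 0 0 - A 1 0 * B 0 1 - A 0 0 * B 1 1 + A 0 1 * B 1 0,
    A 0 0 * B 0 1 - A 0 1 * B 0 0]

/-- The binary quadratic form fixed by the transpose of `A.adjugate * B`. -/
def coaxis (A B : Matrix (Fin 2) (Fin 2) ℂ) : Fin 3 → ℂ :=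
  ![A 1 0 * B 0 0 - A 0 0 * B 1 0,
    A 1 0 * B 0 1 - A 0 0 * B 1 1 + A 1 1 * B 0 0 - A 0 1 * B 1 0,
    A 1 1 * B 0 1 - A 0 1 * B 1 1]

/-- The trace of `A * B.adjugate`, the polarization of twice the determinant. -/
def polar (A B : Matrix (Fin 2) (Fin 2) ℂ) : ℂ :=
  A 0 0 * B 1 1 - A 0 1 * B 1 0 - A 1 0 * B 0 1 + A 1 1 * B 0 0

def entryDet (A B C D : Matrix (Fin 2) (Fin 2) ℂ) : ℂ :=
  Matrix.det !![A 0 0, A 0 1, A 1 0, A 1 1; B 0 0, B 0 1, B 1 0, B 1 1;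
    C 0 0, C 0 1, C 1 0, C 1 1; D 0 0, D 0 1, D 1 0, D 1 1]

theorem coaxis_swap (A B : Matrix (Fin 2) (Fin 2) ℂ) : coaxis B A = -coaxis A B := by
  ext i
  fin_cases i <;> simp [coaxis] <;> ring

/-- The form `axis A B` encodes the traceless part of `A adj(B)`. Conjugation by `A` gives `adj(B)
A`, whose traceless part is that of `adj(A) B` up to sign. -/
theorem symSq_mulVec_axis_left (A B : Matrix (Fin 2) (Fin 2) ℂ) :
    symSq Aᵀ *ᵥ axis A B = A.det • coaxis A B := by
  ext i
  fin_cases i <;>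
    simp [symSq, axis, coaxis, Matrix.mulVec, dotProduct, Fin.sum_univ_three,
      Matrix.det_fin_two] <;> ring

/-- This computes the difference between an invariant form and its transport. For `det D = -1` the
right side is twice the axis of the components of `A` and `B` orthogonal to `D`. -/
theorem axis_add_symSq_mulVec_coaxis (A B D : Matrix (Fin 2) (Fin 2) ℂ) :
    (-D.det) • axis A B + symSq D.adjugateᵀ *ᵥ coaxis A B =
      (-2 * D.det) • axis A B + polar B D • axis A D + polar A D • axis D B := by
  ext i
  fin_cases i <;>
    simp [symSq, axis, coaxis, polar, Matrix.det_fin_two, Matrix.adjugate_fin_two] <;> ring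

/-- As a function of `B`, `C`, `D` the left side is alternating and vanishes if one of them is `A`.
So it is a multiple of `entryDet`, the factor being quadratic in `A`. -/
theorem tripleProduct_coaxis (A B C D : Matrix (Fin 2) (Fin 2) ℂ) :
    tripleProduct (coaxis A D) (coaxis A B) (coaxis A C) = A.det * entryDet A B C D := by
  simp [tripleProduct, coaxis, entryDet,
    Matrix.det_succ_row_zero, Fin.sum_univ_succ, Fin.succAbove]
  ring

/-- The right side is the Gram determinant of `A`, `B`, `C` for the bilinear form `polar`. -/
theorem tripleProduct_axis (A B C : Matrix (Fin 2) (Fin 2) ℂ) :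
    2 * tripleProduct (axis A B) (axis A C) (axis B C) =
      polar A A * polar B B * polar C C + 2 * polar A B * polar B C * polar A C -
      polar A A * polar B C ^ 2 - polar B B * polar A C ^ 2 - polar C C * polar A B ^ 2 := by
  simp [tripleProduct, Matrix.det_fin_three, axis, polar]
  ring

theorem axis_ortho (A B D : Matrix (Fin 2) (Fin 2) ℂ) (a b : ℂ) :
    axis (A + a • D) (B + b • D) = axis A B + b • axis A D + a • axis D B := by
  ext i
  fin_cases i <;> simp [axis] <;> ring

theorem axis_discriminant (A B : Matrix (Fin 2) (Fin 2) ℂ) :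
    axis A B 1 ^ 2 - 4 * axis A B 0 * axis A B 2 = polar A B ^ 2 - 4 * A.det * B.det := by
  simp [axis, polar, Matrix.det_fin_two]
  ring

/-- A quadratic form that is fixed by the symmetric square of a matrix is a multiple of the obvious
one. -/
theorem smul_eq_of_symSq_fixed (B : Matrix (Fin 2) (Fin 2) ℂ) (v : Fin 3 → ℂ) :
    ((B 0 0 + B 1 1) ^ 2 - 4 * B.det) • v =
      (v 1 * (B 1 1 - B 0 0) + 2 * v 0 * B 1 0 - 2 * v 2 * B 0 1) •
          ![B 0 1, B 1 1 - B 0 0, -B 1 0] +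
        (symSq B *ᵥ v + symSq B.adjugate *ᵥ v - (2 * B.det) • v) := by
  ext i
  fin_cases i <;>
    simp [symSq, Matrix.vecHead, Matrix.vecTail, dotProduct, Fin.sum_univ_three,
      Matrix.det_fin_two, Matrix.adjugate_fin_two] <;> ring

theorem symSq_one : symSq 1 = 1 := by
  ext i j
  fin_cases i <;> fin_cases j <;> simp [symSq]

theorem symSq_neg (A : Matrix (Fin 2) (Fin 2) ℂ) : symSq (-A) = symSq A := by
  ext i j
  fin_cases i <;> fin_cases j <;> simp [symSq]

/-- The trace of `A adj(B)` is `polar A B`, so the hypothesis says that this matrix of determinant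
one does not have trace `±2`. In `smul_eq_of_symSq_fixed` the error term becomes `v + v - 2v`, and
the factor in front of `v` is invertible. -/
theorem exists_smul_axis {A B : Matrix (Fin 2) (Fin 2) ℂ} (hA : A.det = -1) (hB : B.det = -1)
    (hAB : polar A B ^ 2 ≠ 4) {v : Fin 3 → ℂ} (hv : symSq (A * B.adjugate)ᵀ *ᵥ v = v) :
    ∃ c : ℂ, v = c • axis A B := by
  set C := (A * B.adjugate)ᵀ with hC
  have hdet : C.det = 1 := by
    rw [hC, Matrix.det_transpose, Matrix.det_mul, Matrix.det_adjugate, hA, hB]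
    simp
  have h1 := smul_eq_of_symSq_fixed C v
  have h2 : symSq C.adjugate *ᵥ v = v := by
    conv_lhs => rw [← hv]
    rw [Matrix.mulVec_mulVec, ← symSq_mul, Matrix.adjugate_mul, hdet, one_smul, symSq_one,
      Matrix.one_mulVec]
  have h3 : ![C 0 1, C 1 1 - C 0 0, -C 1 0] = axis A B := by
    ext i
    fin_cases i <;>
      simp [hC, axis, Matrix.mul_apply, Fin.sum_univ_two, Matrix.adjugate_fin_two] <;> ring
  have h4 : C 0 0 + C 1 1 = polar A B := by
    simp [hC, polar, Matrix.mul_apply, Fin.sum_univ_two, Matrix.adjugate_fin_two]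
    ring
  have h5 : v + v - (2 * (1 : ℂ)) • v = 0 := by
    module
  rw [hv, h2, hdet, h3, h4, h5, add_zero, mul_one] at h1
  have h6 : polar A B ^ 2 - 4 ≠ 0 := sub_ne_zero.2 hAB
  refine ⟨(polar A B ^ 2 - 4)⁻¹ * (v 1 * (C 1 1 - C 0 0) + 2 * v 0 * C 1 0 - 2 * v 2 * C 0 1), ?_⟩
  rw [mul_smul, ← h1, inv_smul_smul₀ h6]

/-- The actions of `A` and of `B` both send the axis to `-coaxis A B`, so the quotient of the two
fixes it. -/
theorem symSq_mulVec_axis (A B : Matrix (Fin 2) (Fin 2) ℂ) (hA : A.det = -1) (hB : B.det = -1) :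
    symSq (A * B.adjugate)ᵀ *ᵥ axis A B = axis A B := by
  have h1 : symSq Aᵀ *ᵥ axis A B = -coaxis A B := by
    rw [symSq_mulVec_axis_left, hA, neg_one_smul]
  have h2 : symSq Bᵀ *ᵥ axis A B = -coaxis A B := by
    have h : axis A B = -axis B A := by
      ext i
      fin_cases i <;> simp [axis] <;> ring
    rw [h, Matrix.mulVec_neg, symSq_mulVec_axis_left, hB, neg_one_smul, coaxis_swap,
      neg_neg]
  have h3 : symSq B.adjugateᵀ *ᵥ (symSq Bᵀ *ᵥ axis A B) = axis A B := by
    rw [Matrix.mulVec_mulVec, ← symSq_mul, ← Matrix.transpose_mul, Matrix.mul_adjugate, hB,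
      neg_one_smul, Matrix.transpose_neg, Matrix.transpose_one, symSq_neg, symSq_one,
      Matrix.one_mulVec]
  rw [Matrix.transpose_mul, symSq_mul, ← Matrix.mulVec_mulVec, h1, ← h2, h3]

theorem tripleProduct_mulVec (M : Matrix (Fin 3) (Fin 3) ℂ) (a b c : Fin 3 → ℂ) :
    tripleProduct (M *ᵥ a) (M *ᵥ b) (M *ᵥ c) = M.det * tripleProduct a b c := by
  have h : Matrix.of ![M *ᵥ a, M *ᵥ b, M *ᵥ c] = Matrix.of ![a, b, c] * Mᵀ := by
    ext i j
    fin_cases i <;> simp [Matrix.mul_apply, Matrix.mulVec, dotProduct, mul_comm]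
  rw [tripleProduct, h, Matrix.det_mul, Matrix.det_transpose, mul_comm, tripleProduct]

theorem tripleProduct_smul (x y z : ℂ) (a b c : Fin 3 → ℂ) :
    tripleProduct (x • a) (y • b) (z • c) = x * y * z * tripleProduct a b c := by
  simp [tripleProduct, Matrix.det_fin_three]
  ring

end DBlock
end

noncomputable section

namespace DBlock

open ReidemeisterTorsion

/-! ## The holonomy in terms of normal vectors -/

theorem det_hermitian (x : Fin 4 → ℝ) : (hermitian x).det = -(mink x x : ℂ) := by
  simp only [hermitian, Matrix.det_fin_two_of, mink]
  push_cast
  linear_combination (-(x 2 : ℂ) ^ 2) * -Complex.I_sq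

theorem polar_hermitian (x y : Fin 4 → ℝ) :
    polar (hermitian x) (hermitian y) = -2 * (mink x y : ℂ) := by
  simp [polar, hermitian, mink]
  linear_combination (2 * (x 2 : ℂ) * y 2) * Complex.I_sq

theorem hermitian_conjTranspose (x : Fin 4 → ℝ) : (hermitian x)ᴴ = hermitian x := by
  ext i j
  fin_cases i <;> fin_cases j <;> simp [hermitian, Matrix.conjTranspose_apply] <;> ring

theorem mul_adjugate_mul_self (N X : Matrix (Fin 2) (Fin 2) ℂ) :
    N * X.adjugate * N = polar N X • N - N.det • X := by
  ext i j
  fin_cases i <;> fin_cases j <;>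
    simp [Matrix.mul_apply, Fin.sum_univ_two, Matrix.adjugate_fin_two, polar,
      Matrix.det_fin_two] <;> ring

theorem hermitian_reflect {n : Fin 4 → ℝ} (hn : mink n n = 1) (x : Fin 4 → ℝ) :
    hermitian (reflect n x) = hermitian n * (hermitian x).adjugate * hermitian n := by
  rw [mul_adjugate_mul_self, polar_hermitian, det_hermitian, hn]
  ext i j
  fin_cases i <;> fin_cases j <;> simp [hermitian, reflect] <;> ring

/-- A single reflection is `X ↦ N adj(X) N`. Two of them compose to a conjugation, since the
adjugate reverses products and is an involution on 2×2 matrices. -/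
theorem hermitian_reflect_reflect {n m : Fin 4 → ℝ} (hn : mink n n = 1) (hm : mink m m = 1)
    (x : Fin 4 → ℝ) : hermitian (reflect n (reflect m x)) =
      (hermitian n * (hermitian m).adjugate) * hermitian x *
        (hermitian n * (hermitian m).adjugate)ᴴ := by
  rw [hermitian_reflect hn, hermitian_reflect hm, Matrix.adjugate_mul_distrib,
    Matrix.adjugate_mul_distrib, Matrix.adjugate_adjugate (hermitian x) (by simp),
    Matrix.conjTranspose_mul, Matrix.adjugate_conjTranspose, hermitian_conjTranspose,
    hermitian_conjTranspose]
  simp [mul_assoc]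

/-- Two matrices of determinant one which act in the same way on Hermitian matrices agree up to
sign. -/
theorem eq_or_eq_neg_of_action {A B : Matrix (Fin 2) (Fin 2) ℂ} (hA : A.det = 1) (hB : B.det = 1)
    (h : ∀ x, A * hermitian x * Aᴴ = B * hermitian x * Bᴴ) : A = B ∨ A = -B := by
  set C := B.adjugate * A with hC
  have hBC : A = B * C := by
    rw [hC, ← mul_assoc, Matrix.mul_adjugate, hB, one_smul, one_mul]
  have hCdet : C.det = 1 := by
    rw [hC, Matrix.det_mul, Matrix.det_adjugate, hA, hB]
    simp
  have hCx : ∀ x, C * hermitian x * Cᴴ = hermitian x := by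
    intro x
    have h1 : B.adjugate * B = 1 := by rw [Matrix.adjugate_mul, hB, one_smul]
    have h2 : Bᴴ * B.adjugateᴴ = 1 := by
      rw [← Matrix.conjTranspose_mul, h1, Matrix.conjTranspose_one]
    calc C * hermitian x * Cᴴ = B.adjugate * (A * hermitian x * Aᴴ) * B.adjugateᴴ := by
          rw [hC, Matrix.conjTranspose_mul]
          simp only [mul_assoc]
      _ = (B.adjugate * B) * hermitian x * (Bᴴ * B.adjugateᴴ) := by
          rw [h]
          simp only [mul_assoc]
      _ = hermitian x := by rw [h1, h2, one_mul, mul_one]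
  -- Fixing the base point, the identity matrix, makes `C` unitary; fixing a Hermitian matrix then
  -- means commuting with it.
  have hone : C * Cᴴ = 1 := by
    have h1 := hCx ![1, 0, 0, 0]
    have h2 : hermitian ![1, 0, 0, 0] = 1 := by
      ext i j
      fin_cases i <;> fin_cases j <;> simp [hermitian]
    rwa [h2, mul_one] at h1
  have hcomm : ∀ x, C * hermitian x = hermitian x * C := by
    intro x
    calc C * hermitian x = C * hermitian x * (Cᴴ * C) := by
          rw [mul_eq_one_comm.1 hone, mul_one]
      _ = hermitian x * C := by rw [← mul_assoc, hCx]
  -- Commuting with `diag(1, -1)` kills the off-diagonal entries, and commuting with the swap matrix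
  -- equates the diagonal ones.
  have h3 := hcomm ![0, 0, 0, 1]
  have h1 := hcomm ![0, 1, 0, 0]
  have e1 := congr_fun₂ h3 0 1
  have e2 := congr_fun₂ h3 1 0
  have e3 := congr_fun₂ h1 0 1
  simp [Matrix.mul_apply, Fin.sum_univ_two, hermitian] at e1 e2 e3
  have c01 : C 0 1 = 0 := by linear_combination (-1 / 2 : ℂ) * e1
  have c10 : C 1 0 = 0 := by linear_combination (1 / 2 : ℂ) * e2
  have hsq : C 0 0 ^ 2 = 1 := by
    rw [Matrix.det_fin_two, c01, c10, ← e3] at hCdet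
    linear_combination hCdet
  have hCs : C = C 0 0 • (1 : Matrix (Fin 2) (Fin 2) ℂ) := by
    ext i j
    fin_cases i <;> fin_cases j <;> simp [c01, c10, e3]
  rcases sq_eq_sq_iff_eq_or_eq_neg.1 (hsq.trans (one_pow 2).symm) with h0 | h0 <;> rw [h0] at hCs
  · left
    rw [hBC, hCs, one_smul, mul_one]
  · right
    rw [hBC, hCs]
    simp

theorem entryDet_hermitian_sq (n : Fin 4 → Fin 4 → ℝ) :
    entryDet (hermitian (n 0)) (hermitian (n 1)) (hermitian (n 2)) (hermitian (n 3)) ^ 2 =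
      -16 * ((Matrix.of n).det : ℂ) ^ 2 := by
  -- The linear map from coordinates in `ℝ^{3,1}` to the entries of the Hermitian matrix, acting on
  -- rows.
  let T : Matrix (Fin 4) (Fin 4) ℂ :=
    !![1, 0, 0, 1; 0, 1, 1, 0; 0, Complex.I, -Complex.I, 0; 1, 0, 0, -1]
  have hT : T.det ^ 2 = -16 := by
    simp [T, Matrix.det_succ_row_zero, Fin.sum_univ_succ, Fin.succAbove]
    ring_nf
    simp
  have h : entryDet (hermitian (n 0)) (hermitian (n 1)) (hermitian (n 2)) (hermitian (n 3)) =
      ((Matrix.of n).map (algebraMap ℝ ℂ)).det * T.det := by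
    rw [entryDet, ← Matrix.det_mul]
    congr 1
    ext i j
    fin_cases i <;> fin_cases j <;>
      simp [T, Matrix.mul_apply, Fin.sum_univ_four, hermitian] <;> ring
  have h2 : ((Matrix.of n).map (algebraMap ℝ ℂ)).det = ((Matrix.of n).det : ℂ) :=
    ((algebraMap ℝ ℂ).map_det (Matrix.of n)).symm
  rw [h, h2, mul_pow, hT]
  ring

theorem det_gram (n m : Fin 4 → Fin 4 → ℝ) :
    (Matrix.of fun i j => mink (n i) (m j)).det = -((Matrix.of n).det * (Matrix.of m).det) := by
  have h : (Matrix.of fun i j => mink (n i) (m j)) =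
      Matrix.of n * Matrix.diagonal ![-1, 1, 1, 1] * (Matrix.of m)ᵀ := by
    ext i j
    simp [Matrix.mul_apply, Fin.sum_univ_four, mink, Matrix.diagonal_apply]
  rw [h, Matrix.det_mul, Matrix.det_mul, Matrix.det_transpose, Matrix.det_diagonal,
    Fin.prod_univ_four]
  simp

end DBlock
end

/-! ### Triple products of invariant forms in terms of normal vectors. -/

noncomputable section

namespace DBlock

open ReidemeisterTorsion

section Normals

variable {n : Fin 4 → Fin 4 → ℝ} {ρ : FreeGroup (Fin 3) →* Matrix.SpecialLinearGroup (Fin 2) ℂ}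

theorem act_eq (γ : FreeGroup (Fin 3)) : act ρ γ = symSq (ρ γ).1ᵀ := rfl

theorem det_hermitian_unit {x : Fin 4 → ℝ} (hx : mink x x = 1) : (hermitian x).det = -1 := by
  rw [det_hermitian, hx]
  simp

/-- A lift of the holonomy is determined only up to sign, and the symmetric square does not see the
sign. -/
theorem act_crossing (hn : ∀ j, mink (n j) (n j) = 1) (h : IsHolonomyLift n ρ) (j : Fin 4) :
    act ρ (crossing j) = symSq (hermitian (n j) * (hermitian (n 3)).adjugate)ᵀ := by
  have h1 := eq_or_eq_neg_of_action (A := (ρ (crossing j)).1)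
    (B := hermitian (n j) * (hermitian (n 3)).adjugate) (ρ (crossing j)).2
    (by rw [Matrix.det_mul, Matrix.det_adjugate, det_hermitian_unit (hn j),
          det_hermitian_unit (hn 3)]; simp)
    (fun x => by rw [← h, hermitian_reflect_reflect (hn j) (hn 3)])
  rcases h1 with h1 | h1
  · rw [act_eq, h1]
  · rw [act_eq, h1, Matrix.transpose_neg, symSq_neg]

theorem act_crossing_inv (hn : ∀ j, mink (n j) (n j) = 1) (h : IsHolonomyLift n ρ) (j : Fin 4) :
    act ρ (crossing j)⁻¹ = symSq (hermitian (n 3) * (hermitian (n j)).adjugate)ᵀ := by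
  have h1 := act_inv_mul ρ (crossing j)
  have h2 : symSq (hermitian (n 3) * (hermitian (n j)).adjugate)ᵀ * act ρ (crossing j) = 1 := by
    rw [act_crossing hn h, ← symSq_mul, ← Matrix.transpose_mul,
      show hermitian (n j) * (hermitian (n 3)).adjugate *
        (hermitian (n 3) * (hermitian (n j)).adjugate) = hermitian (n j) *
          ((hermitian (n 3)).adjugate * hermitian (n 3)) * (hermitian (n j)).adjugate by
        simp only [mul_assoc],
      Matrix.adjugate_mul, det_hermitian_unit (hn 3), mul_smul_comm, mul_one, smul_mul_assoc,
      Matrix.mul_adjugate, det_hermitian_unit (hn j)]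
    simp [symSq_one]
  have h3 := mul_eq_one_comm.1 h1
  calc act ρ (crossing j)⁻¹ = symSq (hermitian (n 3) * (hermitian (n j)).adjugate)ᵀ *
        act ρ (crossing j) * act ρ (crossing j)⁻¹ := by rw [h2, one_mul]
    _ = _ := by rw [mul_assoc, h3, mul_one]

/-- The two reflections in `G_3` cancel up to the sign `det N_3 = -1`, which the symmetric square
ignores. -/
theorem act_loop (hn : ∀ j, mink (n j) (n j) = 1) (h : IsHolonomyLift n ρ) (p : EdgePair) :
    act ρ (loop p) =
      symSq (hermitian (n p.1.1) * (hermitian (n p.1.2)).adjugate)ᵀ := by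
  rw [loop, act_mul, act_crossing_inv hn h, act_crossing hn h, ← symSq_mul, ← Matrix.transpose_mul,
      show hermitian (n p.1.1) * (hermitian (n 3)).adjugate *
        (hermitian (n 3) * (hermitian (n p.1.2)).adjugate) = hermitian (n p.1.1) *
          ((hermitian (n 3)).adjugate * hermitian (n 3)) * (hermitian (n p.1.2)).adjugate by
        simp only [mul_assoc],
      Matrix.adjugate_mul, det_hermitian_unit (hn 3), mul_smul_comm, mul_one, smul_mul_assoc,
      neg_one_smul, Matrix.transpose_neg, symSq_neg]

/-- The invariant form of an edge, in terms of the normal vectors. -/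
def edgeAxis (n : Fin 4 → Fin 4 → ℝ) (p : EdgePair) : Fin 3 → ℂ :=
  axis (hermitian (n p.1.1)) (hermitian (n p.1.2))

theorem act_loop_edgeAxis (hn : ∀ j, mink (n j) (n j) = 1) (h : IsHolonomyLift n ρ)
    (p : EdgePair) : act ρ (loop p) *ᵥ edgeAxis n p = edgeAxis n p := by
  rw [act_loop hn h, edgeAxis, symSq_mulVec_axis _ _ (det_hermitian_unit (hn _))
    (det_hermitian_unit (hn _))]

theorem edgeAxis_discriminant (hn : ∀ j, mink (n j) (n j) = 1) (p : EdgePair) :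
    edgeAxis n p 1 ^ 2 - 4 * edgeAxis n p 0 * edgeAxis n p 2 =
      -4 * (1 - mink (n p.1.1) (n p.1.2) ^ 2 : ℝ) := by
  rw [edgeAxis, axis_discriminant, polar_hermitian, det_hermitian_unit (hn _),
    det_hermitian_unit (hn _)]
  push_cast
  ring

theorem exists_smul_edgeAxis (hn : ∀ j, mink (n j) (n j) = 1) (h : IsHolonomyLift n ρ)
    {p : EdgePair} (hp : mink (n p.1.1) (n p.1.2) ^ 2 ≠ 1) {v : Fin 3 → ℂ}
    (hv : IsInvariantVector ρ (loop p) v) : ∃ c : ℂ, c ≠ 0 ∧ v = c • edgeAxis n p := by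
  obtain ⟨hv0, hv1⟩ := hv
  have h1 : symSq (hermitian (n p.1.1) * (hermitian (n p.1.2)).adjugate)ᵀ *ᵥ v = v := by
    rw [← act_loop hn h]
    exact hv1
  obtain ⟨c, hc⟩ := exists_smul_axis (det_hermitian_unit (hn _)) (det_hermitian_unit (hn _))
    (by
      rw [polar_hermitian, mul_pow]
      intro h2
      apply hp
      have h3 : ((mink (n p.1.1) (n p.1.2) ^ 2 : ℝ) : ℂ) = ((1 : ℝ) : ℂ) := by
        push_cast
        linear_combination (1 / 4 : ℂ) * h2
      exact_mod_cast h3) h1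
  refine ⟨c, ?_, hc⟩
  rintro rfl
  exact hv0 (by rw [hc, zero_smul])

theorem transported_edgeAxis (hn : ∀ j, mink (n j) (n j) = 1) (h : IsHolonomyLift n ρ)
    (c : EdgePair → ℂ) (p : EdgePair) : transported ρ (fun p => c p • edgeAxis n p) p =
      (-c p) • (symSq (hermitian (n 3)).adjugateᵀ *ᵥ
        coaxis (hermitian (n p.1.1)) (hermitian (n p.1.2))) := by
  rw [transported, act_crossing hn h, Matrix.transpose_mul, symSq_mul, Matrix.mulVec_smul,
    ← Matrix.mulVec_mulVec, edgeAxis, symSq_mulVec_axis_left, det_hermitian_unit (hn _),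
    neg_one_smul, Matrix.mulVec_neg, smul_neg, neg_smul]

theorem symSq_adjugate_det (hn : ∀ j, mink (n j) (n j) = 1) :
    (symSq (hermitian (n 3)).adjugateᵀ).det = -1 := by
  rw [symSq_det, Matrix.det_transpose, Matrix.det_adjugate, det_hermitian_unit (hn 3)]
  norm_num

/-- The product of the scalars attached to all six edges. -/
def edgeProd (c : EdgePair → ℂ) : ℂ :=
  c ⟨(0, 1), by decide⟩ * c ⟨(0, 2), by decide⟩ * c ⟨(0, 3), by decide⟩ *
    c ⟨(1, 2), by decide⟩ * c ⟨(1, 3), by decide⟩ * c ⟨(2, 3), by decide⟩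

/-- The product of the scalars attached to the edges opposite to `G_3`. -/
def baseProd (c : EdgePair → ℂ) : ℂ :=
  c ⟨(0, 1), by decide⟩ * c ⟨(0, 2), by decide⟩ * c ⟨(1, 2), by decide⟩

/-- All vectors are transported by the same matrix, of determinant `-1`, so each facet gives `±` the
determinant `W` of the entries of the four Hermitian matrices. The constant is `W ^ 6 = (-16
det²)³`. The edges 01, 02, 12 occur at two of the three facets, which accounts for the extra factor
`baseProd c`. -/
theorem facetProduct_edgeAxis (hn : ∀ j, mink (n j) (n j) = 1) (h : IsHolonomyLift n ρ)
    (c : EdgePair → ℂ) : facetProduct ρ (fun p => c p • edgeAxis n p) ^ 2 =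
      (edgeProd c * baseProd c) ^ 2 * (-4096 * ((Matrix.of n).det : ℂ) ^ 6) := by
  have e1 : tripleProduct (coaxis (hermitian (n 1)) (hermitian (n 3)))
      (coaxis (hermitian (n 0)) (hermitian (n 1))) (coaxis (hermitian (n 1)) (hermitian (n 2))) =
      (hermitian (n 1)).det * entryDet (hermitian (n 0)) (hermitian (n 1)) (hermitian (n 2))
        (hermitian (n 3)) := by
    generalize hermitian (n 0) = A
    generalize hermitian (n 1) = B
    generalize hermitian (n 2) = C
    generalize hermitian (n 3) = D
    simp [tripleProduct, coaxis, entryDet, Matrix.det_succ_row_zero, Fin.sum_univ_succ,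
      Fin.succAbove]
    ring
  have e2 : tripleProduct (coaxis (hermitian (n 2)) (hermitian (n 3)))
      (coaxis (hermitian (n 0)) (hermitian (n 2))) (coaxis (hermitian (n 1)) (hermitian (n 2))) =
      (hermitian (n 2)).det * entryDet (hermitian (n 0)) (hermitian (n 1)) (hermitian (n 2))
        (hermitian (n 3)) := by
    generalize hermitian (n 0) = A
    generalize hermitian (n 1) = B
    generalize hermitian (n 2) = C
    generalize hermitian (n 3) = D
    simp [tripleProduct, coaxis, entryDet, Matrix.det_succ_row_zero, Fin.sum_univ_succ,
      Fin.succAbove]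
    ring
  have hW := entryDet_hermitian_sq n
  simp only [facetProduct, transported_edgeAxis hn h, tripleProduct_smul, tripleProduct_mulVec,
    symSq_adjugate_det hn, tripleProduct_coaxis, e1, e2, det_hermitian_unit (hn _)]
  set W := entryDet (hermitian (n 0)) (hermitian (n 1)) (hermitian (n 2)) (hermitian (n 3))
  set δ := ((Matrix.of n).det : ℂ)
  have hW6 : W ^ 6 = -4096 * δ ^ 6 := by
    rw [show W ^ 6 = (W ^ 2) ^ 3 by ring, hW]
    ring
  rw [edgeProd, baseProd, ← hW6]
  ring

/-- The Schur complement of the last diagonal entry: the right side is the Gram determinant of the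
first three vectors projected orthogonally to the fourth. -/
theorem gram_ortho (g : Fin 4 → Fin 4 → ℝ) (hs : ∀ i j, g i j = g j i) (hd : ∀ i, g i i = 1) :
    (Matrix.of g).det =
      (1 - g 0 3 ^ 2) * (1 - g 1 3 ^ 2) * (1 - g 2 3 ^ 2) +
        2 * (g 0 1 - g 0 3 * g 1 3) * (g 1 2 - g 1 3 * g 2 3) * (g 0 2 - g 0 3 * g 2 3) -
        (1 - g 0 3 ^ 2) * (g 1 2 - g 1 3 * g 2 3) ^ 2 -
        (1 - g 1 3 ^ 2) * (g 0 2 - g 0 3 * g 2 3) ^ 2 -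
        (1 - g 2 3 ^ 2) * (g 0 1 - g 0 3 * g 1 3) ^ 2 := by
  simp [Matrix.det_succ_row_zero, Fin.sum_univ_succ, Fin.succAbove, hd]
  rw [hs 1 0, hs 2 0, hs 2 1, hs 3 0, hs 3 1, hs 3 2]
  ring

theorem polar_ortho {A B D : Matrix (Fin 2) (Fin 2) ℂ} (hD : D.det = -1) :
    polar (A + (polar A D / 2) • D) (B + (polar B D / 2) • D) =
      polar A B + polar A D * polar B D / 2 := by
  rw [Matrix.det_fin_two] at hD
  simp [polar]
  linear_combination (1 / 2 : ℂ) * (A 0 0 * D 1 1 - A 0 1 * D 1 0 - A 1 0 * D 0 1 + A 1 1 * D 0 0)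
    * (B 0 0 * D 1 1 - B 0 1 * D 1 0 - B 1 0 * D 0 1 + B 1 1 * D 0 0) * hD

/-- Since `polar` is `-2` times the Minkowski product, the two arguments of `axis` represent the
projections of the normals orthogonal to the unit vector `n 3`. -/
theorem edgeAxis_sub_transported (hn : ∀ j, mink (n j) (n j) = 1) (h : IsHolonomyLift n ρ)
    (c : EdgePair → ℂ) (p : EdgePair) :
    c p • edgeAxis n p - transported ρ (fun p => c p • edgeAxis n p) p =
      (2 * c p) • axis
        (hermitian (n p.1.1) + (polar (hermitian (n p.1.1)) (hermitian (n 3)) / 2) •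
          hermitian (n 3))
        (hermitian (n p.1.2) + (polar (hermitian (n p.1.2)) (hermitian (n 3)) / 2) •
          hermitian (n 3)) := by
  have h1 := axis_add_symSq_mulVec_coaxis (hermitian (n p.1.1)) (hermitian (n p.1.2))
    (hermitian (n 3))
  rw [det_hermitian_unit (hn 3), neg_neg, one_smul] at h1
  rw [transported_edgeAxis hn h, neg_smul, sub_neg_eq_add, edgeAxis, ← smul_add, h1, axis_ortho]
  module

/-- Three factors 2 come from the differences of the forms. The triple product of axes is half a
Gram determinant for `polar`, that is `(-2)³ / 2` times the Minkowski one, which equals `-det²`;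
altogether `8 · 4 = 32`. -/
theorem baseProduct_edgeAxis (hn : ∀ j, mink (n j) (n j) = 1) (h : IsHolonomyLift n ρ)
    (c : EdgePair → ℂ) : baseProduct ρ (fun p => c p • edgeAxis n p) =
      baseProd c * (32 * ((Matrix.of n).det : ℂ) ^ 2) := by
  have hg := gram_ortho (fun i j => mink (n i) (n j))
    (fun i j => TruncatedHyperidealTetrahedron.mink_comm _ _) hn
  rw [det_gram n n] at hg
  have hg' := congrArg (fun x : ℝ => (x : ℂ)) hg
  simp only [baseProduct, edgeAxis_sub_transported hn h, basePair, tripleProduct_smul]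
  have key := tripleProduct_axis
    (hermitian (n 0) + (polar (hermitian (n 0)) (hermitian (n 3)) / 2) • hermitian (n 3))
    (hermitian (n 1) + (polar (hermitian (n 1)) (hermitian (n 3)) / 2) • hermitian (n 3))
    (hermitian (n 2) + (polar (hermitian (n 2)) (hermitian (n 3)) / 2) • hermitian (n 3))
  simp only [polar_ortho (det_hermitian_unit (hn 3))] at key
  generalize tripleProduct _ _ _ = T at key ⊢
  simp only [polar_hermitian, hn] at key
  push_cast at hg'
  rw [baseProd]
  simp only [Complex.ofReal_one] at key
  linear_combination (8 * c ⟨(0, 1), by decide⟩ * c ⟨(0, 2), by decide⟩ *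
    c ⟨(1, 2), by decide⟩) * (1 / 2 * key + 4 * hg')

end Normals

end DBlock
end

/-! ### The double along four planes. -/

noncomputable section

namespace DBlock

open ReidemeisterTorsion

section Normals

variable {n : Fin 4 → Fin 4 → ℝ} {ρ : FreeGroup (Fin 3) →* Matrix.SpecialLinearGroup (Fin 2) ℂ}

theorem edgeProd_ne_zero {c : EdgePair → ℂ} (hc : ∀ p, c p ≠ 0) : edgeProd c ≠ 0 := by
  simp only [edgeProd, ne_eq, mul_eq_zero, hc, or_self, not_false_eq_true]

theorem baseProd_ne_zero {c : EdgePair → ℂ} (hc : ∀ p, c p ≠ 0) : baseProd c ≠ 0 := by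
  simp only [baseProd, ne_eq, mul_eq_zero, hc, or_self, not_false_eq_true]

theorem facetProduct_edgeAxis_ne_zero (hn : ∀ j, mink (n j) (n j) = 1) (h : IsHolonomyLift n ρ)
    (hdet : (Matrix.of n).det ≠ 0) {c : EdgePair → ℂ} (hc : ∀ p, c p ≠ 0) :
    facetProduct ρ (fun p => c p • edgeAxis n p) ≠ 0 := by
  intro h0
  have h1 := facetProduct_edgeAxis hn h c
  rw [h0] at h1
  have hδ : ((Matrix.of n).det : ℂ) ≠ 0 := by exact_mod_cast hdet
  have := mul_ne_zero (pow_ne_zero 2 (mul_ne_zero (edgeProd_ne_zero hc) (baseProd_ne_zero hc)))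
    (mul_ne_zero (by norm_num : (-4096 : ℂ) ≠ 0) (pow_ne_zero 6 hδ))
  exact this (by rw [← h1]; ring)

theorem baseProduct_edgeAxis_ne_zero (hn : ∀ j, mink (n j) (n j) = 1) (h : IsHolonomyLift n ρ)
    (hdet : (Matrix.of n).det ≠ 0) {c : EdgePair → ℂ} (hc : ∀ p, c p ≠ 0) :
    baseProduct ρ (fun p => c p • edgeAxis n p) ≠ 0 := by
  have hδ : ((Matrix.of n).det : ℂ) ≠ 0 := by exact_mod_cast hdet
  rw [baseProduct_edgeAxis hn h]
  exact mul_ne_zero (baseProd_ne_zero hc) (mul_ne_zero (by norm_num) (pow_ne_zero 2 hδ))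

/-- Homology and torsion with respect to multiples of the invariant forms of the edges. -/
theorem homology_and_torsion_edgeAxis (hn : ∀ j, mink (n j) (n j) = 1) (h : IsHolonomyLift n ρ)
    (hdet : (Matrix.of n).det ≠ 0) {c : EdgePair → ℂ} (hc : ∀ p, c p ≠ 0) :
    (∀ k, k ≠ 1 → Subsingleton (TwistedHomology ρ k)) ∧
      (∃ b : Module.Basis EdgePair ℂ (TwistedHomology ρ 1),
        Represents ρ (fun p => c p • edgeAxis n p) b) ∧
      ∀ b : EdgePair → TwistedHomology ρ 1, Represents ρ (fun p => c p • edgeAxis n p) b →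
        ∀ t : ℂ, t ^ 2 = -4 * (edgeProd c * ((Matrix.of n).det : ℂ)) ^ 2 →
          blockTorsion ρ b = {t, -t} := by
  obtain ⟨h1, h2, h3⟩ := homology_and_torsion ρ (fun p => c p • edgeAxis n p)
    (fun p => by rw [Matrix.mulVec_smul, act_loop_edgeAxis hn h])
    (facetProduct_edgeAxis_ne_zero hn h hdet hc) (baseProduct_edgeAxis_ne_zero hn h hdet hc)
  refine ⟨h1, h2, fun b hb t ht => h3 b hb t ?_⟩
  have hδ : ((Matrix.of n).det : ℂ) ≠ 0 := by exact_mod_cast hdet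
  have hB := baseProd_ne_zero hc
  -- The factor `baseProd c` cancels, and `-4096 / 32² = -4`.
  rw [div_pow, facetProduct_edgeAxis hn h, baseProduct_edgeAxis hn h, ht]
  field_simp
  ring

/-- The product, over all six edges, of `1 - g ^ 2`, where `g` is the inner product of the normals. -/
def sineProd (n : Fin 4 → Fin 4 → ℝ) : ℝ :=
  (1 - mink (n 0) (n 1) ^ 2) * (1 - mink (n 0) (n 2) ^ 2) * (1 - mink (n 0) (n 3) ^ 2) *
    (1 - mink (n 1) (n 2) ^ 2) * (1 - mink (n 1) (n 3) ^ 2) * (1 - mink (n 2) (n 3) ^ 2)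

/-- Normalisation makes `c p ^ 2` the inverse of the discriminant `-4 (1 - g²)` of the axis; the six
factors `-4` multiply to 4096. -/
theorem edgeProd_sq_mul_sineProd (hn : ∀ j, mink (n j) (n j) = 1) {c : EdgePair → ℂ}
    (hc : ∀ p, IsNormalized (c p • edgeAxis n p)) :
    edgeProd c ^ 2 * (4096 * sineProd n) = 1 := by
  have key : ∀ p : EdgePair,
      c p ^ 2 * (-4 * (1 - mink (n p.1.1) (n p.1.2) ^ 2 : ℝ)) = 1 := by
    intro p
    rw [← edgeAxis_discriminant hn p, ← hc p]
    simp only [Pi.smul_apply, smul_eq_mul]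
    ring
  rw [edgeProd, sineProd]
  have mul6 : ∀ a₁ a₂ a₃ a₄ a₅ a₆ x₁ x₂ x₃ x₄ x₅ x₆ : ℂ, a₁ ^ 2 * (-4 * x₁) = 1 →
      a₂ ^ 2 * (-4 * x₂) = 1 → a₃ ^ 2 * (-4 * x₃) = 1 → a₄ ^ 2 * (-4 * x₄) = 1 →
      a₅ ^ 2 * (-4 * x₅) = 1 → a₆ ^ 2 * (-4 * x₆) = 1 →
      (a₁ * a₂ * a₃ * a₄ * a₅ * a₆) ^ 2 * (4096 * (x₁ * x₂ * x₃ * x₄ * x₅ * x₆)) = 1 := by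
    intro a₁ a₂ a₃ a₄ a₅ a₆ x₁ x₂ x₃ x₄ x₅ x₆ k₁ k₂ k₃ k₄ k₅ k₆
    calc _ = (a₁ ^ 2 * (-4 * x₁)) * (a₂ ^ 2 * (-4 * x₂)) * (a₃ ^ 2 * (-4 * x₃)) *
          (a₄ ^ 2 * (-4 * x₄)) * (a₅ ^ 2 * (-4 * x₅)) * (a₆ ^ 2 * (-4 * x₆)) := by ring
      _ = 1 := by rw [k₁, k₂, k₃, k₄, k₅, k₆]; norm_num
  simp only [Complex.ofReal_mul]
  exact mul6 _ _ _ _ _ _ _ _ _ _ _ _ (key _) (key _) (key _) (key _) (key _) (key _)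

/-- The homology of the double along four planes, given by their unit normal vectors. -/
theorem homology_of_normals (hn : ∀ j, mink (n j) (n j) = 1) (h : IsHolonomyLift n ρ)
    (hdet : (Matrix.of n).det ≠ 0) (hg : ∀ j k, j ≠ k → mink (n j) (n k) ^ 2 ≠ 1) :
    (∀ k, k ≠ 1 → Subsingleton (TwistedHomology ρ k)) ∧
      Nonempty (TwistedHomology ρ 1 ≃ₗ[ℂ] (Fin 6 → ℂ)) ∧
      (∀ I : EdgePair → Fin 3 → ℂ, (∀ p, IsInvariantVector ρ (loop p) (I p)) →
        ∃ b : Module.Basis EdgePair ℂ (TwistedHomology ρ 1), Represents ρ I b) := by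
  -- The unscaled axes already give a basis indexed by the six edges, and thus the dimension.
  obtain ⟨h1, ⟨b, -⟩, -⟩ := homology_and_torsion_edgeAxis hn h hdet
    (c := fun _ => 1) (fun _ => one_ne_zero)
  refine ⟨h1, ⟨(b.reindex (Fintype.equivFinOfCardEq (by decide))).equivFun⟩, fun I hI => ?_⟩
  choose c hc0 hc using fun p => exists_smul_edgeAxis hn h (hg _ _ p.2.ne) (hI p)
  rw [funext hc]
  exact (homology_and_torsion_edgeAxis hn h hdet hc0).2.1

/-- The torsion of the double along four planes, given by their unit normal vectors. -/
theorem torsion_of_normals (hn : ∀ j, mink (n j) (n j) = 1) (h : IsHolonomyLift n ρ)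
    (hdet : (Matrix.of n).det ≠ 0) (hg : ∀ j k, j ≠ k → mink (n j) (n k) ^ 2 ≠ 1)
    {I : EdgePair → Fin 3 → ℂ} {b : EdgePair → TwistedHomology ρ 1}
    (hI : ∀ p, IsInvariantVector ρ (loop p) (I p) ∧ IsNormalized (I p)) (hb : Represents ρ I b)
    {t : ℂ} (ht : t ^ 2 * (1024 * sineProd n) = -((Matrix.of n).det : ℂ) ^ 2) :
    blockTorsion ρ b = {t, -t} := by
  choose c hc0 hc using fun p => exists_smul_edgeAxis hn h (hg _ _ p.2.ne) (hI p).1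
  obtain rfl := funext hc
  have hE := edgeProd_sq_mul_sineProd hn fun p => (hI p).2
  refine (homology_and_torsion_edgeAxis hn h hdet hc0).2.2 b hb t ?_
  linear_combination (4 * edgeProd c ^ 2) * ht - t ^ 2 * hE

end Normals

end DBlock
end

/-! ### Lengths and angles from Gram determinants. -/

noncomputable section

namespace DBlock

theorem mink_smul_left (a : ℝ) (x y : Fin 4 → ℝ) : mink (a • x) y = a * mink x y := by
  simp only [mink, Pi.smul_apply, smul_eq_mul]; ring

theorem mink_smul_right (a : ℝ) (x y : Fin 4 → ℝ) : mink x (a • y) = a * mink x y := by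
  simp only [mink, Pi.smul_apply, smul_eq_mul]; ring

theorem mink_sub_left (x y z : Fin 4 → ℝ) : mink (x - y) z = mink x z - mink y z := by
  simp only [mink, Pi.sub_apply]; ring

theorem mink_sub_right (x y z : Fin 4 → ℝ) : mink x (y - z) = mink x y - mink x z := by
  simp only [mink, Pi.sub_apply]; ring

theorem det_comp_sq (v : Fin 4 → Fin 4 → ℝ) {f : Fin 4 → Fin 4} (hf : Function.Injective f) :
    (Matrix.of (v ∘ f)).det ^ 2 = (Matrix.of v).det ^ 2 := by
  have h := Matrix.det_permute (Equiv.ofBijective f (Finite.injective_iff_bijective.1 hf))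
    (Matrix.of v)
  have e : (Matrix.of v).submatrix (Equiv.ofBijective f (Finite.injective_iff_bijective.1 hf)) id =
      Matrix.of (v ∘ f) := rfl
  rw [e] at h
  rw [h, mul_pow, ← Int.cast_pow, ← Units.val_pow_eq_pow_val, Int.units_sq]
  simp

namespace TruncatedHyperidealTetrahedron

variable (Δ : TruncatedHyperidealTetrahedron)

/-- The Gram determinant of three hyperideal vertices. -/
def gramThree (a b c : Fin 4) : ℝ :=
  1 + 2 * mink (Δ.v a) (Δ.v b) * mink (Δ.v a) (Δ.v c) * mink (Δ.v b) (Δ.v c) -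
    mink (Δ.v a) (Δ.v b) ^ 2 - mink (Δ.v a) (Δ.v c) ^ 2 - mink (Δ.v b) (Δ.v c) ^ 2

/-- The three products are less than `-1`: the cubic term is negative and the squares exceed 1. -/
theorem gramThree_neg {a b c : Fin 4} (hab : a ≠ b) (hac : a ≠ c) (hbc : b ≠ c) :
    Δ.gramThree a b c < 0 := by
  have h1 := Δ.mink_vertices_lt hab
  have h2 := Δ.mink_vertices_lt hac
  have h3 := Δ.mink_vertices_lt hbc
  rw [gramThree]
  have h4 : 0 < mink (Δ.v a) (Δ.v b) * mink (Δ.v a) (Δ.v c) :=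
    mul_pos_of_neg_of_neg (by linarith) (by linarith)
  have h5 := mul_neg_of_pos_of_neg h4 (by linarith : mink (Δ.v b) (Δ.v c) < 0)
  nlinarith [sq_nonneg (mink (Δ.v a) (Δ.v c)), sq_nonneg (mink (Δ.v b) (Δ.v c))]

theorem gramThree_left_comm (a b c : Fin 4) : Δ.gramThree b a c = Δ.gramThree a b c := by
  rw [gramThree, gramThree, mink_comm (Δ.v b) (Δ.v a)]
  ring

theorem gramThree_right_comm (a b c : Fin 4) : Δ.gramThree a c b = Δ.gramThree a b c := by
  rw [gramThree, gramThree, mink_comm (Δ.v c) (Δ.v b)]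
  ring

theorem vertices_sq_sub_one_pos {m n : Fin 4} (h : m ≠ n) :
    0 < mink (Δ.v m) (Δ.v n) ^ 2 - 1 := by
  nlinarith [Δ.mink_vertices_lt h]

/-- The normals `u` and the vertices `v` are dual families up to scale, so their mixed Gram matrix
is diagonal. -/
theorem det_u_mul_det_v : (Matrix.of Δ.u).det * (Matrix.of Δ.v).det =
    -(mink (Δ.u 0) (Δ.v 0) * mink (Δ.u 1) (Δ.v 1) * mink (Δ.u 2) (Δ.v 2) *
      mink (Δ.u 3) (Δ.v 3)) := by
  have h := det_gram Δ.u Δ.v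
  have e : (Matrix.of fun i j => mink (Δ.u i) (Δ.v j)) =
      Matrix.diagonal fun i => mink (Δ.u i) (Δ.v i) := by
    ext i j
    by_cases hij : i = j
    · subst hij; simp
    · simp [Matrix.diagonal_apply_ne _ hij, Δ.orthogonal i j hij]
  rw [e, Matrix.det_diagonal, Fin.prod_univ_four] at h
  rw [h, neg_neg]

theorem det_u_ne_zero : (Matrix.of Δ.u).det ≠ 0 := by
  intro h0
  have h := Δ.det_u_mul_det_v
  rw [h0, zero_mul, eq_comm, neg_eq_zero] at h
  simp [(Δ.outward _).ne] at h

theorem det_v_ne_zero : (Matrix.of Δ.v).det ≠ 0 := by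
  intro h0
  have h := Δ.det_u_mul_det_v
  rw [h0, mul_zero, eq_comm, neg_eq_zero] at h
  simp [(Δ.outward _).ne] at h

/-- Let `w` be the determinant of the family `v a, v b, v c, u l`. Its Gram determinants with itself
and with the four vertices are `-w²` and `-wδ`, and both are block triangular because `u l` is
orthogonal to the first three vectors. Eliminating `w` gives the claim. -/
theorem gramThree_mul_sq {a b c l : Fin 4} (h : Function.Injective ![a, b, c, l]) :
    Δ.gramThree a b c * mink (Δ.u l) (Δ.v l) ^ 2 = -(Matrix.of Δ.v).det ^ 2 := by
  have hab : a ≠ b := fun e => absurd (@h 0 1 e) (by decide)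
  have hac : a ≠ c := fun e => absurd (@h 0 2 e) (by decide)
  have hal : l ≠ a := fun e => absurd (@h 3 0 e) (by decide)
  have hbc : b ≠ c := fun e => absurd (@h 1 2 e) (by decide)
  have hbl : l ≠ b := fun e => absurd (@h 3 1 e) (by decide)
  have hcl : l ≠ c := fun e => absurd (@h 3 2 e) (by decide)
  have h1 := det_gram ![Δ.v a, Δ.v b, Δ.v c, Δ.u l] (Δ.v ∘ ![a, b, c, l])
  have h2 := det_gram ![Δ.v a, Δ.v b, Δ.v c, Δ.u l] ![Δ.v a, Δ.v b, Δ.v c, Δ.u l]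
  have h3 := det_comp_sq Δ.v h
  generalize (Matrix.of ![Δ.v a, Δ.v b, Δ.v c, Δ.u l]).det = w at h1 h2
  generalize (Matrix.of (Δ.v ∘ ![a, b, c, l])).det = δ at h1 h3
  simp [Matrix.det_succ_row_zero, Fin.sum_univ_succ, Fin.succAbove, Δ.orthogonal l a hal,
    Δ.orthogonal l b hbl, Δ.orthogonal l c hcl, mink_comm _ (Δ.u l), Δ.v_unit, Δ.u_unit,
    mink_comm (Δ.v b) (Δ.v a), mink_comm (Δ.v c) (Δ.v a), mink_comm (Δ.v c) (Δ.v b)] at h1 h2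
  have hG := Δ.gramThree_neg hab hac hbc
  rw [← h3]
  refine mul_left_cancel₀ hG.ne ?_
  have h1' : Δ.gramThree a b c * mink (Δ.u l) (Δ.v l) = -(w * δ) := by
    rw [← h1, gramThree]; ring
  have h2' : Δ.gramThree a b c = -(w * w) := by
    rw [← h2, gramThree]; ring
  linear_combination (Δ.gramThree a b c * mink (Δ.u l) (Δ.v l) - w * δ) * h1' + δ ^ 2 * h2'

/-- The same elimination for the family `v m, v n, u j, u k`, whose Gram matrix splits into two 2×2
blocks. It relates the length of an edge to the dihedral angle along it. -/
theorem vertices_mul_sq {m n j k : Fin 4} (h : Function.Injective ![m, n, j, k]) :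
    (mink (Δ.v m) (Δ.v n) ^ 2 - 1) * (mink (Δ.u j) (Δ.v j) * mink (Δ.u k) (Δ.v k)) ^ 2 =
      (Matrix.of Δ.v).det ^ 2 * (1 - mink (Δ.u j) (Δ.u k) ^ 2) := by
  have hmn : m ≠ n := fun e => absurd (@h 0 1 e) (by decide)
  have hjm : j ≠ m := fun e => absurd (@h 2 0 e) (by decide)
  have hjn : j ≠ n := fun e => absurd (@h 2 1 e) (by decide)
  have hkm : k ≠ m := fun e => absurd (@h 3 0 e) (by decide)
  have hkn : k ≠ n := fun e => absurd (@h 3 1 e) (by decide)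
  have hjk : j ≠ k := fun e => absurd (@h 2 3 e) (by decide)
  have h1 := det_gram ![Δ.v m, Δ.v n, Δ.u j, Δ.u k] (Δ.v ∘ ![m, n, j, k])
  have h2 := det_gram ![Δ.v m, Δ.v n, Δ.u j, Δ.u k] ![Δ.v m, Δ.v n, Δ.u j, Δ.u k]
  have h3 := det_comp_sq Δ.v h
  generalize (Matrix.of ![Δ.v m, Δ.v n, Δ.u j, Δ.u k]).det = w at h1 h2
  generalize (Matrix.of (Δ.v ∘ ![m, n, j, k])).det = δ at h1 h3
  simp [Matrix.det_succ_row_zero, Fin.sum_univ_succ, Fin.succAbove, Δ.orthogonal j m hjm,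
    Δ.orthogonal j n hjn, Δ.orthogonal k m hkm, Δ.orthogonal k n hkn, mink_comm _ (Δ.u j),
    mink_comm (Δ.v _) (Δ.u k), Δ.v_unit, Δ.u_unit, Δ.orthogonal j k hjk,
    Δ.orthogonal k j hjk.symm, mink_comm (Δ.v n) (Δ.v m)] at h1 h2
  have hG := Δ.vertices_sq_sub_one_pos hmn
  rw [← h3]
  refine mul_left_cancel₀ hG.ne' ?_
  have h1' : (mink (Δ.v m) (Δ.v n) ^ 2 - 1) *
      (mink (Δ.u j) (Δ.v j) * mink (Δ.u k) (Δ.v k)) = w * δ := by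
    linear_combination -h1
  have h2' : (mink (Δ.v m) (Δ.v n) ^ 2 - 1) * (1 - mink (Δ.u j) (Δ.u k) ^ 2) = w * w := by
    linear_combination -h2
  linear_combination ((mink (Δ.v m) (Δ.v n) ^ 2 - 1) *
    (mink (Δ.u j) (Δ.v j) * mink (Δ.u k) (Δ.v k)) + w * δ) * h1' - δ ^ 2 * h2'

theorem exists_complement {j k : Fin 4} (h : j ≠ k) :
    ∃ m n, Function.Injective ![m, n, j, k] := by
  revert j k
  decide

/-- Two hexagonal planes meet at an angle, because the opposite pair of vertices spans a plane of
signature `(1, 1)`; `vertices_mul_sq` transfers the sign. -/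
theorem one_sub_normals_sq_pos {j k : Fin 4} (h : j ≠ k) :
    0 < 1 - mink (Δ.u j) (Δ.u k) ^ 2 := by
  obtain ⟨m, n, hf⟩ := exists_complement h
  have h1 := Δ.vertices_mul_sq hf
  have h2 := Δ.vertices_sq_sub_one_pos (m := m) (n := n)
    fun e => absurd (@hf 0 1 e) (by decide)
  have h3 : 0 < (mink (Δ.u j) (Δ.v j) * mink (Δ.u k) (Δ.v k)) ^ 2 :=
    pow_pos (mul_pos_of_neg_of_neg (Δ.outward j) (Δ.outward k)) 2
  have h4 := mul_pos h2 h3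
  rw [h1] at h4
  exact pos_of_mul_pos_right h4 (sq_nonneg _)

theorem sin_dihedralAngle_sq {j k : Fin 4} (h : j ≠ k) :
    Real.sin (Δ.dihedralAngle j k) ^ 2 = 1 - mink (Δ.u j) (Δ.u k) ^ 2 := by
  rw [dihedralAngle, Real.sin_arccos, neg_sq, Real.sq_sqrt (Δ.one_sub_normals_sq_pos h).le]

theorem sinh_hdist_sq {x y : Fin 4 → ℝ} (h : 1 ≤ -mink x y) :
    Real.sinh (hdist x y) ^ 2 = mink x y ^ 2 - 1 := by
  rw [Real.sinh_sq, hdist, Real.cosh_arcosh h, neg_sq]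

theorem sinh_edgeLength_sq {m n : Fin 4} (h : m ≠ n) :
    Real.sinh (Δ.edgeLength m n) ^ 2 = mink (Δ.v m) (Δ.v n) ^ 2 - 1 := by
  have hpos := Δ.vertices_sq_sub_one_pos h
  have hlt := Δ.mink_vertices_lt h
  have e : mink (Δ.vertex m n) (Δ.vertex n m) = mink (Δ.v m) (Δ.v n) := by
    simp only [vertex, mink_smul_left, mink_smul_right, mink_sub_left, mink_sub_right, Δ.v_unit,
      mink_comm (Δ.v n) (Δ.v m)]
    generalize mink (Δ.v m) (Δ.v n) = g at hpos
    have hr : (Real.sqrt (g ^ 2 - 1))⁻¹ ^ 2 * (g ^ 2 - 1) = 1 := by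
      rw [inv_pow, Real.sq_sqrt hpos.le, inv_mul_cancel₀ hpos.ne']
    linear_combination g * hr
  rw [edgeLength, sinh_hdist_sq (by rw [e]; linarith), e]

/-- This is the law of cosines for the right-angled hexagon: the hyperbolic cosine of the length is
`(xy - z)` divided by the two square roots, and the numerator of its square minus one is a Gram
determinant. -/
theorem sinh_hdist_vertex_sq {k a b : Fin 4} (hka : k ≠ a) (hkb : k ≠ b) (hab : a ≠ b) :
    Real.sinh (hdist (Δ.vertex k a) (Δ.vertex k b)) ^ 2 *
      ((mink (Δ.v k) (Δ.v a) ^ 2 - 1) * (mink (Δ.v k) (Δ.v b) ^ 2 - 1)) =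
      -Δ.gramThree k a b := by
  have ha := Δ.vertices_sq_sub_one_pos hka
  have hb := Δ.vertices_sq_sub_one_pos hkb
  have ga := Δ.mink_vertices_lt hka
  have gb := Δ.mink_vertices_lt hkb
  have gab := Δ.mink_vertices_lt hab
  have e : mink (Δ.vertex k a) (Δ.vertex k b) =
      (Real.sqrt (mink (Δ.v k) (Δ.v a) ^ 2 - 1))⁻¹ *
        (Real.sqrt (mink (Δ.v k) (Δ.v b) ^ 2 - 1))⁻¹ *
        (mink (Δ.v a) (Δ.v b) - mink (Δ.v k) (Δ.v a) * mink (Δ.v k) (Δ.v b)) := by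
    simp only [vertex, mink_smul_left, mink_smul_right, mink_sub_left, mink_sub_right, Δ.v_unit,
      mink_comm (Δ.v a) (Δ.v k)]
    ring
  rw [gramThree]
  generalize mink (Δ.v k) (Δ.v a) = x at *
  generalize mink (Δ.v k) (Δ.v b) = y at *
  generalize mink (Δ.v a) (Δ.v b) = z at *
  have hx := Real.sq_sqrt ha.le
  have hy := Real.sq_sqrt hb.le
  have px := Real.sqrt_pos.2 ha
  have py := Real.sqrt_pos.2 hb
  generalize Real.sqrt (x ^ 2 - 1) = r at *
  generalize Real.sqrt (y ^ 2 - 1) = s at *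
  have hxy : 0 < x * y := mul_pos_of_neg_of_neg (by linarith) (by linarith)
  -- Needed so that the argument of `arcosh` is at least 1. Here `(x² - 1)(y² - 1) ≤ (xy)²`, and `z`
  -- is negative.
  have hrs : r * s ≤ x * y - z := by
    refine abs_le_of_sq_le_sq' ?_ (by linarith) |>.2
    have : (r * s) ^ 2 ≤ (x * y) ^ 2 := by
      rw [mul_pow, mul_pow, hx, hy]
      nlinarith
    nlinarith
  have h1 : 1 ≤ -mink (Δ.vertex k a) (Δ.vertex k b) := by
    rw [e, show -(r⁻¹ * s⁻¹ * (z - x * y)) = (x * y - z) / (r * s) by field_simp; ring,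
      one_le_div (mul_pos px py)]
    exact hrs
  rw [sinh_hdist_sq h1, e, ← hx, ← hy]
  field_simp
  rw [hx, hy]
  ring

end TruncatedHyperidealTetrahedron

end DBlock
end

/-! ### Conversion of the determinants into the stated formulas. -/

noncomputable section

namespace DBlock

theorem torsion_value_sq {a b c x y z N δ : ℝ} (hx : x ≠ 0) (hy : y ≠ 0) (hz : z ≠ 0)
    (h : a ^ 2 * b ^ 2 * c ^ 2 * N = δ ^ 2) :
    (Complex.I * a * b * c / (32 * x * y * z)) ^ 2 *
      (1024 * ((x ^ 2 * y ^ 2 * z ^ 2 * N : ℝ) : ℂ)) = -(δ : ℂ) ^ 2 := by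
  have hx' : (x : ℂ) ≠ 0 := by exact_mod_cast hx
  have hy' : (y : ℂ) ≠ 0 := by exact_mod_cast hy
  have hz' : (z : ℂ) ≠ 0 := by exact_mod_cast hz
  have h' : (a : ℂ) ^ 2 * b ^ 2 * c ^ 2 * N = δ ^ 2 := by exact_mod_cast h
  rw [← h']
  push_cast
  field_simp
  rw [Complex.I_sq]
  ring

namespace TruncatedHyperidealTetrahedron

variable (Δ : TruncatedHyperidealTetrahedron)

theorem sin_dihedralAngle_ne_zero {j k : Fin 4} (h : j ≠ k) :
    Real.sin (Δ.dihedralAngle j k) ≠ 0 := by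
  intro h0
  have h1 := Δ.sin_dihedralAngle_sq h
  rw [h0] at h1
  linarith [Δ.one_sub_normals_sq_pos h]

theorem sinh_edgeLength_ne_zero {m n : Fin 4} (h : m ≠ n) :
    Real.sinh (Δ.edgeLength m n) ≠ 0 := by
  intro h0
  have h1 := Δ.sinh_edgeLength_sq h
  rw [h0] at h1
  linarith [Δ.vertices_sq_sub_one_pos h]

theorem normals_sq_ne_one {j k : Fin 4} (h : j ≠ k) : mink (Δ.u j) (Δ.u k) ^ 2 ≠ 1 := by
  exact (sub_pos.1 (Δ.one_sub_normals_sq_pos h)).ne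

theorem vertices_sq_ne_one {j k : Fin 4} (h : j ≠ k) : mink (Δ.v j) (Δ.v k) ^ 2 ≠ 1 :=
  (sub_pos.1 (Δ.vertices_sq_sub_one_pos h)).ne'

/-- The edge and the two short edges lie in `H_3`. Both short lengths involve the Gram determinant
of `v 0, v 1, v 2`, the three sines at `H_3` become lengths by `vertices_mul_sq`, and the length
factors cancel. -/
theorem sinh_mul_sin_sq_eq_det_u_sq :
    Real.sinh (Δ.lα 0 3) ^ 2 * Real.sinh (Δ.sα 1 3) ^ 2 * Real.sinh (Δ.sα 2 3) ^ 2 *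
      ((1 - mink (Δ.u 0) (Δ.u 3) ^ 2) * (1 - mink (Δ.u 1) (Δ.u 3) ^ 2) *
        (1 - mink (Δ.u 2) (Δ.u 3) ^ 2)) = (Matrix.of Δ.u).det ^ 2 := by
  have hl : Real.sinh (Δ.lα 0 3) ^ 2 = _ :=
    Δ.sinh_edgeLength_sq (m := 1) (n := 2) (by decide)
  have hs : Real.sinh (Δ.sα 1 3) ^ 2 * _ = _ :=
    Δ.sinh_hdist_vertex_sq (k := 1) (a := 0) (b := 2) (by decide) (by decide) (by decide)
  have hs' : Real.sinh (Δ.sα 2 3) ^ 2 * _ = _ :=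
    Δ.sinh_hdist_vertex_sq (k := 2) (a := 0) (b := 1) (by decide) (by decide) (by decide)
  have hG := Δ.gramThree_mul_sq (a := 0) (b := 1) (c := 2) (l := 3) (by decide)
  have p0 := Δ.vertices_mul_sq (m := 1) (n := 2) (j := 0) (k := 3) (by decide)
  have p1 := Δ.vertices_mul_sq (m := 0) (n := 2) (j := 1) (k := 3) (by decide)
  have p2 := Δ.vertices_mul_sq (m := 0) (n := 1) (j := 2) (k := 3) (by decide)
  have hd := Δ.det_u_mul_det_v
  have hδ := Δ.det_v_ne_zero
  rw [gramThree_left_comm, mink_comm (Δ.v 1) (Δ.v 0)] at hs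
  rw [gramThree_left_comm, gramThree_right_comm, mink_comm (Δ.v 2) (Δ.v 0),
    mink_comm (Δ.v 2) (Δ.v 1)] at hs'
  rw [hl]
  generalize Real.sinh (Δ.sα 1 3) = S at *
  generalize Real.sinh (Δ.sα 2 3) = S' at *
  generalize mink (Δ.v 1) (Δ.v 2) ^ 2 - 1 = A at *
  generalize mink (Δ.v 0) (Δ.v 2) ^ 2 - 1 = B at *
  generalize mink (Δ.v 0) (Δ.v 1) ^ 2 - 1 = C at *
  generalize 1 - mink (Δ.u 0) (Δ.u 3) ^ 2 = N at *
  generalize 1 - mink (Δ.u 1) (Δ.u 3) ^ 2 = N' at *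
  generalize 1 - mink (Δ.u 2) (Δ.u 3) ^ 2 = N'' at *
  generalize mink (Δ.u 0) (Δ.v 0) = d₀ at *
  generalize mink (Δ.u 1) (Δ.v 1) = d₁ at *
  generalize mink (Δ.u 2) (Δ.v 2) = d₂ at *
  generalize mink (Δ.u 3) (Δ.v 3) = d₃ at *
  generalize (Matrix.of Δ.v).det = δ at *
  generalize (Matrix.of Δ.u).det = ε at *
  generalize Δ.gramThree 0 1 2 = G at *
  -- Three factors `δ²` are absorbed by the three angles; on the other side they arise as `δ⁴` from
  -- `G²` and `δ²` from duality.
  refine mul_left_cancel₀ (pow_ne_zero 6 hδ) ?_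
  calc δ ^ 6 * (A * S ^ 2 * S' ^ 2 * (N * N' * N'')) =
        (δ ^ 2 * N) * (δ ^ 2 * N') * (δ ^ 2 * N'') * (A * S ^ 2 * S' ^ 2) := by ring
    _ = (S ^ 2 * (C * A)) * (S' ^ 2 * (B * A)) * d₃ ^ 4 * (d₀ * d₁ * d₂ * d₃) ^ 2 := by
        rw [← p0, ← p1, ← p2]; ring
    _ = (G * d₃ ^ 2) ^ 2 * (-(d₀ * d₁ * d₂ * d₃)) ^ 2 := by rw [hs, hs']; ring
    _ = δ ^ 6 * ε ^ 2 := by rw [hG, ← hd]; ring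

/-- Both short edges lie in `T_3`. Their Gram determinants involve the products `⟨u_1, v_1⟩` and
`⟨u_2, v_2⟩`, which are exactly those relating the angle between `H_1` and `H_2` to the edge joining
`T_0` and `T_3`. -/
theorem sin_mul_sinh_sq_eq_det_v_sq :
    Real.sin (Δ.αl 0 3) ^ 2 * Real.sinh (Δ.sl 1 3) ^ 2 * Real.sinh (Δ.sl 2 3) ^ 2 *
      ((mink (Δ.v 0) (Δ.v 3) ^ 2 - 1) * (mink (Δ.v 1) (Δ.v 3) ^ 2 - 1) *
        (mink (Δ.v 2) (Δ.v 3) ^ 2 - 1)) = (Matrix.of Δ.v).det ^ 2 := by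
  have ha : Real.sin (Δ.αl 0 3) ^ 2 = _ :=
    Δ.sin_dihedralAngle_sq (j := 1) (k := 2) (by decide)
  have hs : Real.sinh (Δ.sl 1 3) ^ 2 * _ = _ :=
    Δ.sinh_hdist_vertex_sq (k := 3) (a := 0) (b := 2) (by decide) (by decide) (by decide)
  have hs' : Real.sinh (Δ.sl 2 3) ^ 2 * _ = _ :=
    Δ.sinh_hdist_vertex_sq (k := 3) (a := 0) (b := 1) (by decide) (by decide) (by decide)
  have hG := Δ.gramThree_mul_sq (a := 3) (b := 0) (c := 2) (l := 1) (by decide)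
  have hG' := Δ.gramThree_mul_sq (a := 3) (b := 0) (c := 1) (l := 2) (by decide)
  have p := Δ.vertices_mul_sq (m := 0) (n := 3) (j := 1) (k := 2) (by decide)
  have hδ := Δ.det_v_ne_zero
  simp only [mink_comm (Δ.v 3) _] at hs hs'
  rw [ha]
  generalize Real.sinh (Δ.sl 1 3) = S at *
  generalize Real.sinh (Δ.sl 2 3) = S' at *
  generalize mink (Δ.v 0) (Δ.v 3) ^ 2 - 1 = A at *
  generalize mink (Δ.v 1) (Δ.v 3) ^ 2 - 1 = B at *
  generalize mink (Δ.v 2) (Δ.v 3) ^ 2 - 1 = C at *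
  generalize 1 - mink (Δ.u 1) (Δ.u 2) ^ 2 = N at *
  generalize mink (Δ.u 1) (Δ.v 1) = d at *
  generalize mink (Δ.u 2) (Δ.v 2) = e at *
  generalize (Matrix.of Δ.v).det = δ at *
  refine mul_left_cancel₀ (pow_ne_zero 2 hδ) ?_
  calc δ ^ 2 * (N * S ^ 2 * S' ^ 2 * (A * B * C)) = (δ ^ 2 * N) * (S ^ 2 * S' ^ 2 * (A * B * C)) := by
        ring
    _ = (d ^ 2 * (S ^ 2 * (A * C))) * (e ^ 2 * (S' ^ 2 * (A * B))) := by rw [← p]; ring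
    _ = (Δ.gramThree 3 0 2 * d ^ 2) * (Δ.gramThree 3 0 1 * e ^ 2) := by rw [hs, hs']; ring
    _ = δ ^ 2 * δ ^ 2 := by rw [hG, hG']; ring

end TruncatedHyperidealTetrahedron

end DBlock
end

open DBlock in
theorem proposition4p1 (Δ : TruncatedHyperidealTetrahedron) :
    (∀ ρ : FreeGroup (Fin 3) →* Matrix.SpecialLinearGroup (Fin 2) ℂ, IsHolonomyLift Δ.u ρ →
      (∀ k, k ≠ 1 → Subsingleton (TwistedHomology ρ k)) ∧
      Nonempty (TwistedHomology ρ 1 ≃ₗ[ℂ] (Fin 6 → ℂ)) ∧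
      (∀ I : EdgePair → Fin 3 → ℂ, (∀ p, IsInvariantVector ρ (loop p) (I p)) →
        ∃ h : Module.Basis EdgePair ℂ (TwistedHomology ρ 1), Represents ρ I h) ∧
      (∀ (I : EdgePair → Fin 3 → ℂ) (h : Module.Basis EdgePair ℂ (TwistedHomology ρ 1)),
        (∀ p, IsInvariantVector ρ (loop p) (I p) ∧ IsNormalized (I p)) → Represents ρ I h →
        ∃ t : ℂ, blockTorsion ρ h = {t, -t} ∧
          t = Complex.I * Real.sinh (Δ.lα 0 3) * Real.sinh (Δ.sα 1 3) * Real.sinh (Δ.sα 2 3) /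
            (32 * Real.sin (Δ.αα 0 1) * Real.sin (Δ.αα 0 2) * Real.sin (Δ.αα 1 2)))) ∧
    (∀ ρ : FreeGroup (Fin 3) →* Matrix.SpecialLinearGroup (Fin 2) ℂ, IsHolonomyLift Δ.v ρ →
      (∀ k, k ≠ 1 → Subsingleton (TwistedHomology ρ k)) ∧
      Nonempty (TwistedHomology ρ 1 ≃ₗ[ℂ] (Fin 6 → ℂ)) ∧
      (∀ I : EdgePair → Fin 3 → ℂ, (∀ p, IsInvariantVector ρ (loop p) (I p)) →
        ∃ h : Module.Basis EdgePair ℂ (TwistedHomology ρ 1), Represents ρ I h) ∧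
      (∀ (I : EdgePair → Fin 3 → ℂ) (h : Module.Basis EdgePair ℂ (TwistedHomology ρ 1)),
        (∀ p, IsInvariantVector ρ (loop p) (I p) ∧ IsNormalized (I p)) → Represents ρ I h →
        ∃ t : ℂ, blockTorsion ρ h = {t, -t} ∧
          t = Complex.I * Real.sin (Δ.αl 0 3) * Real.sinh (Δ.sl 1 3) * Real.sinh (Δ.sl 2 3) /
            (32 * Real.sinh (Δ.ll 0 1) * Real.sinh (Δ.ll 0 2) * Real.sinh (Δ.ll 1 2)))) := by
  refine ⟨fun ρ hρ => ?_, fun ρ hρ => ?_⟩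
  · obtain ⟨h₁, h₂, h₃⟩ := homology_of_normals Δ.u_unit hρ Δ.det_u_ne_zero
      fun _ _ => Δ.normals_sq_ne_one
    refine ⟨h₁, h₂, h₃, fun I h hI hh => ⟨_, torsion_of_normals Δ.u_unit hρ Δ.det_u_ne_zero
      (fun _ _ => Δ.normals_sq_ne_one) hI hh ?_, rfl⟩⟩
    -- Three factors of `sineProd` are the sines in the denominator; the other three, at `G_3`, are
    -- absorbed by the trigonometric identity.
    rw [← torsion_value_sq (Δ.sin_dihedralAngle_ne_zero (j := 0) (k := 1) (by decide))
      (Δ.sin_dihedralAngle_ne_zero (j := 0) (k := 2) (by decide))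
      (Δ.sin_dihedralAngle_ne_zero (j := 1) (k := 2) (by decide)) Δ.sinh_mul_sin_sq_eq_det_u_sq,
      Δ.sin_dihedralAngle_sq (by decide), Δ.sin_dihedralAngle_sq (by decide),
      Δ.sin_dihedralAngle_sq (by decide), sineProd]
    congr 3
    ring
  · obtain ⟨h₁, h₂, h₃⟩ := homology_of_normals Δ.v_unit hρ Δ.det_v_ne_zero
      fun _ _ => Δ.vertices_sq_ne_one
    refine ⟨h₁, h₂, h₃, fun I h hI hh => ⟨_, torsion_of_normals Δ.v_unit hρ Δ.det_v_ne_zero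
      (fun _ _ => Δ.vertices_sq_ne_one) hI hh ?_, rfl⟩⟩
    rw [← torsion_value_sq (Δ.sinh_edgeLength_ne_zero (m := 0) (n := 1) (by decide))
      (Δ.sinh_edgeLength_ne_zero (m := 0) (n := 2) (by decide))
      (Δ.sinh_edgeLength_ne_zero (m := 1) (n := 2) (by decide)) Δ.sin_mul_sinh_sq_eq_det_v_sq,
      Δ.sinh_edgeLength_sq (by decide), Δ.sinh_edgeLength_sq (by decide),
      Δ.sinh_edgeLength_sq (by decide), sineProd]
    -- Here every factor of `sineProd` is the negative of a squared hyperbolic sine, and the six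
    -- signs cancel.
    congr 3
    ring
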